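/- Let $\bar S$ be a closed connected oriented surface, let $V\subset\bar S$ be a finite non-empty set of points (the punctures), let $S=\bar S\smallsetminus V$, and let $\widetilde S\to S$ be its universal covering, on which $\pi_1(S)$ acts by deck transformations. Fix disjoint open disc neighborhoods $D_v$ of the punctures $v\in V$, and let $\widetilde A$ be the preimage of $\bigcup_v (D_v\smallsetminus\{v\})$ in $\widetilde S$. A *peripheral subgroup* of $\pi_1(S)$ is the stabilizer of a component of $\widetilde A$; let $\Pi$ be the set of peripheral subgroups. An *enhanced homomorphism* $(r,\{\xi_\pi\}_{\pi\in\Pi})$ consists of a group homomorphism $r:\pi_1(S)\to\mathrm{Isom}^+(\mathbb H^3)$ and, for each $\pi\in\Pi$, of a point $\xi_\pi\in\partial_\infty\mathbb H^3$ fixed by $r(\pi)$, such that $\xi_{\gamma\pi\gamma^{-1}}=r(\gamma)\xi_\pi$ for all $\gamma\in\pi_1(S)$ and $\pi\in\Pi$. An *ideal triangulation* $\lambda$ of $S$ is a triangulation of $\bar S$ with vertex set exactly $V$ (where distinct sides or vertices of a triangle may be identified in $\bar S$, and two triangles may share several edges); its edges are considered as arcs in $S$, and $\widetilde\lambda\subset\widetilde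 S$ denotes the preimage of their union. A *pleated surface* pleated along $\lambda$ is a pair $(\widetilde f,r)$ of a continuous map $\widetilde f:\widetilde S\to\mathbb H^3$ and a homomorphism $r:\pi_1(S)\to\mathrm{Isom}^+(\mathbb H^3)$ such that (1) $\widetilde f$ sends each component of $\widetilde\lambda$ homeomorphically to a complete geodesic; (2) $\widetilde f$ sends the closure of each component of $\widetilde S\smallsetminus\widetilde\lambda$ homeomorphically to an ideal triangle; (3) $\widetilde f(\gamma\widetilde x)=r(\gamma)\widetilde f(\widetilde x)$ for all $\gamma\in\pi_1(S)$ and $\widetilde x\in\widetilde S$. The enhanced homomorphism $(r,\{\xi_\pi\})$ *realizes* $\lambda$ if there is a pleated surface $(\widetilde f,r)$ pleated along $\lambda$ such that, whenever a triangle $T$ (the closure of a component of $\widetilde S\smallsetminus\widetilde\lambda$) has an ideal vertex in the component $\widetilde A_\pi$ of $\widetilde A$ with stabilizer $\pi$, the corresponding ideal vertex of $\widetilde f(T)$ is $\xi_\pi$, in the sense that $\widetilde f(x)\to\xi_\pi$ as $x\in T\cap\widetilde A_\pi$ approaches the puncture. **Theorem.** Every enhanced homomorphism $(r,\{\xi_\pi\}_{\pi\in\Pi})$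 for which $r:\pi_1(S)\to\mathrm{Isom}^+(\mathbb H^3)$ is injective is peripherally generic, that is, it realizes every ideal triangulation $\lambda$ of $S$. -/

import Mathlib

open Topology Filter

noncomputable section

namespace PleatedSurfaces

universe u w

/-! ### Hyperbolic 3-space -/

/-- Euclidean 3-space. -/
abbrev E3 : Type := EuclideanSpace ℝ (Fin 3)

/-- The Minkowski form on `ℝ × ℝ³`, where the first coordinate is the time coordinate. -/
def mink (x y : ℝ × E3) : ℝ := inner ℝ x.2 y.2 - x.1 * y.1

/-- Hyperbolic 3-space: the upper sheet of the hyperboloid, with the subspace topology. -/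
abbrev H3 : Type := {x : ℝ × E3 // mink x x = -1 ∧ 0 < x.1}

/-- The hyperbolic distance. -/
def hdist (x y : H3) : ℝ := Real.arcosh (-mink x.1 y.1)

/-- The projective (Klein) coordinates, identifying hyperbolic space with the open unit ball of
`ℝ³`, in such a way that hyperbolic geodesics and convex hulls become Euclidean ones. -/
def klein (x : H3) : E3 := (x.1.1)⁻¹ • x.1.2

/-- The sphere at infinity: the unit sphere bounding the ball of the projective model. -/
abbrev Boundary : Type := Metric.sphere (0 : E3) 1

/-- The group of orientation-preserving isometries of hyperbolic 3-space. Every isometry of the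
hyperboloid is the restriction of a unique linear map of `ℝ × ℝ³`, which preserves the time
direction, so that it preserves the orientation of the hyperboloid exactly when this linear map
has positive determinant. -/
def IsomPlus : Subgroup (Equiv.Perm H3) where
  carrier := {g | (∀ x y, hdist (g x) (g y) = hdist x y) ∧
    ∃ L : (ℝ × E3) ≃ₗ[ℝ] (ℝ × E3),
      0 < LinearMap.det (L : (ℝ × E3) →ₗ[ℝ] (ℝ × E3)) ∧ ∀ x : H3, L x.1 = (g x).1}
  one_mem' := ⟨fun _ _ => rfl, LinearEquiv.refl ℝ _, by simp, fun _ => rfl⟩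
  mul_mem' := by
    rintro g h ⟨hg, L, hL, hLg⟩ ⟨hh, M, hM, hMh⟩
    refine ⟨fun x y => ?_, M.trans L, ?_, fun x => ?_⟩
    · simp only [Equiv.Perm.mul_apply, hg, hh]
    · rw [LinearEquiv.coe_trans, LinearMap.det_comp]
      exact mul_pos hL hM
    · simp only [Equiv.Perm.mul_apply, LinearEquiv.trans_apply, hMh, hLg]
  inv_mem' := by
    rintro g ⟨hg, L, hL, hLg⟩
    refine ⟨fun x y => ?_, L.symm, ?_, fun x => ?_⟩
    · simpa using (hg (g⁻¹ x) (g⁻¹ y)).symm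
    · rw [LinearEquiv.det_coe_symm]
      exact inv_pos.mpr hL
    · rw [LinearEquiv.symm_apply_eq, hLg]
      simp

/-- A filter on a set of points, with a map to hyperbolic space, converges to the point `ξ` of the
sphere at infinity. -/
def TendstoBoundary {α : Type*} (f : α → H3) (l : Filter α) (ξ : Boundary) : Prop :=
  Tendsto (fun a => klein (f a)) l (𝓝 (ξ : E3))

/-- The continuous extension of `g` to the sphere at infinity maps `ξ` to `η`. -/
def BoundaryMaps (g : Equiv.Perm H3) (ξ η : Boundary) : Prop :=
  TendstoBoundary g (comap klein (𝓝 (ξ : E3))) η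

/-- A complete geodesic: a full open chord of the ball in the projective model. -/
def IsCompleteGeodesic (s : Set H3) : Prop :=
  ∃ ξ η : Boundary, ξ ≠ η ∧ s = klein ⁻¹' segment ℝ (ξ : E3) (η : E3)

/-- An ideal triangle (together with its sides): the convex hull in hyperbolic space of three
distinct points at infinity. -/
def IsIdealTriangle (s : Set H3) : Prop :=
  ∃ ξ : Fin 3 → Boundary, Function.Injective ξ ∧
    s = klein ⁻¹' convexHull ℝ (Set.range fun k => (ξ k : E3))

/-! ### Ideal triangulations of a punctured surface -/

/-- An ideal triangulation of the punctured surface `Sbar ∖ V`: a triangulation of the closed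
oriented surface `Sbar` by finitely many triangles, with vertex set exactly `V`. As usual in this
context, two triangles may meet along several edges or vertices, and sides or vertices of the same
triangle may be identified. The faces are parametrized by the standard triangle, compatibly with
the orientation, and the parametrizations agree along the edges, so that `Sbar` is obtained by
gluing the sides of the triangles in pairs. The side `i` is opposite to the vertex `i`; it is
oriented from the vertex `i + 1` to the vertex `i + 2` (mod 3), and the gluing maps reverse these
orientations, which is exactly the condition that the glued surface is oriented. -/
structure IdealTriangulation {Sbar : Type u} [TopologicalSpace Sbar] (V : Set Sbar) where
  /-- The set of faces. -/
  Face : Type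
  finite_face : Finite Face
  /-- The parametrizations of the faces. -/
  param : Face → stdSimplex ℝ (Fin 3) → Sbar
  continuous_param : ∀ f, Continuous (param f)
  surjective_param : ∀ s, ∃ f x, param f x = s
  param_mem_iff : ∀ f x, param f x ∈ V ↔ ∃ k, x k = 1
  /-- The pairing of the sides of the triangles. -/
  pair : Face × Fin 3 → Face × Fin 3
  pair_pair : ∀ a, pair (pair a) = a
  pair_ne : ∀ a, pair a ≠ a
  param_eq_iff : ∀ f x g y, param f x ∉ V →
    (param f x = param g y ↔
      (f = g ∧ x = y) ∨
      ∃ i j, pair (f, i) = (g, j) ∧ x i = 0 ∧ y j = 0 ∧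
        x (i + 1) = y (j + 2) ∧ x (i + 2) = y (j + 1))

/-- The union of the (open) edges of an ideal triangulation, as a subset of the punctured
surface. -/
def IdealTriangulation.edges {Sbar : Type u} [TopologicalSpace Sbar] {V : Set Sbar}
    (lam : IdealTriangulation V) : Set ↥(Vᶜ) :=
  {s | ∃ f x i, x i = 0 ∧ lam.param f x = s}

/-! ### The fundamental group and its peripheral subgroups -/

/-- The group of deck transformations of `p : E → S`. When `p` is the universal covering of a
connected surface `S`, this is the fundamental group of `S`, with its usual action on `E`. -/
def Deck {S : Type u} {E : Type w} [TopologicalSpace E] (p : E → S) :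
    Subgroup (E ≃ₜ E) where
  carrier := {g | ∀ e, p (g e) = p e}
  one_mem' := fun _ => rfl
  mul_mem' := by
    intro g h hg hh e
    exact (hg (h e)).trans (hh e)
  inv_mem' := by
    intro g hg e
    have h := hg (g⁻¹ e)
    have h2 : g (g⁻¹ e) = e := g.apply_symm_apply e
    rw [h2] at h
    exact h.symm

/-- Annulus neighborhoods of the punctures: disjoint open discs around the points of `V`, from
which these points are removed. -/
structure PunctureDiscs {Sbar : Type u} [TopologicalSpace Sbar] (V : Set Sbar) where
  /-- The disc around each puncture. -/
  disc : V → Set Sbar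
  isOpen_disc : ∀ v, IsOpen (disc v)
  mem_disc : ∀ v : V, (v : Sbar) ∈ disc v
  homeo_disc : ∀ v, Nonempty (disc v ≃ₜ EuclideanSpace ℝ (Fin 2))
  disjoint_disc : ∀ v v', v ≠ v' → Disjoint (disc v) (disc v')

section Peripheral

variable {Sbar : Type u} [TopologicalSpace Sbar] {V : Set Sbar} {E : Type w} [TopologicalSpace E]

/-- The preimage in `E` of the annulus around the puncture `v`. -/
def liftAnnulus (A : PunctureDiscs V) (p : E → ↥(Vᶜ)) (v : V) : Set E :=
  {e | (p e : Sbar) ∈ A.disc v}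

/-- The component of the preimage of the annulus around `v` that contains the point `e`. -/
def annulusComponent (A : PunctureDiscs V) (p : E → ↥(Vᶜ)) (v : V) (e : E) : Set E :=
  connectedComponentIn (liftAnnulus A p v) e

/-- The subgroup of the deck transformations that send a subset of `E` to itself. -/
def setStabilizer (p : E → ↥(Vᶜ)) (C : Set E) : Subgroup (Deck p) where
  carrier := {g | g.1 '' C = C}
  one_mem' := Set.image_id C
  mul_mem' := by
    intro g h hg hh
    change (fun x => g.1 (h.1 x)) '' C = C
    rw [← Set.image_image (fun x => g.1 x) (fun x => h.1 x)]
    exact (congrArg _ hh).trans hg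
  inv_mem' := by
    intro g hg
    change g.1.symm '' C = C
    rw [← g.1.symm.preimage_symm]
    change g.1 ⁻¹' C = C
    conv_lhs => rw [← (show g.1 '' C = C from hg)]
    exact Set.preimage_image_eq C g.1.injective

/-- The peripheral subgroups: the image in the fundamental group of the fundamental group of the
annulus around a puncture, for all choices of base points and paths. In terms of deck
transformations, these are the stabilizers of the components of the preimages of the annuli. -/
def IsPeripheral (A : PunctureDiscs V) (p : E → ↥(Vᶜ)) (P : Subgroup (Deck p)) : Prop :=
  ∃ v, ∃ e ∈ liftAnnulus A p v, P = setStabilizer p (annulusComponent A p v e)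

/-- The conjugate subgroup `γ P γ⁻¹`. -/
def conj {G : Type*} [Group G] (γ : G) (P : Subgroup G) : Subgroup G :=
  P.map (MulAut.conj γ).toMonoidHom

/-- A conjugate of a peripheral subgroup is peripheral. -/
theorem IsPeripheral.conj {A : PunctureDiscs V} {p : E → ↥(Vᶜ)} {P : Subgroup (Deck p)}
    (h : IsPeripheral A p P) (γ : Deck p) : IsPeripheral A p (conj γ P) := by
  obtain ⟨v, e, he, rfl⟩ := h
  have hpre : ∀ δ : Deck p, δ.1 '' liftAnnulus A p v = liftAnnulus A p v := by
    intro δ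
    ext x
    constructor
    · rintro ⟨y, hy, rfl⟩
      have h1 : p (δ.1 y) = p y := δ.2 y
      simpa only [liftAnnulus, Set.mem_ofPred_eq, h1] using hy
    · intro hx
      refine ⟨δ.1.symm x, ?_, δ.1.apply_symm_apply x⟩
      have h1 : p (δ.1.symm x) = p x := (δ⁻¹).2 x
      simpa only [liftAnnulus, Set.mem_ofPred_eq, h1] using hx
  have hC : γ.1 '' annulusComponent A p v e = annulusComponent A p v (γ.1 e) := by
    have h1 := γ.1.image_connectedComponentIn he
    rw [hpre] at h1
    exact h1
  refine ⟨v, γ.1 e, ?_, ?_⟩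
  · rw [← hpre γ]
    exact Set.mem_image_of_mem _ he
  · rw [← hC]
    ext g
    have key : ∀ C : Set E, g ∈ setStabilizer p (γ.1 '' C) ↔ γ⁻¹ * g * γ ∈ setStabilizer p C := by
      intro C
      change g.1 '' (γ.1 '' C) = γ.1 '' C ↔ (fun x => γ.1.symm (g.1 (γ.1 x))) '' C = C
      rw [← Set.image_image (fun x => γ.1.symm x) (fun x => g.1 (γ.1 x)),
        ← Set.image_image (fun x => g.1 x) (fun x => γ.1 x)]
      constructor
      · intro h
        rw [h, Set.image_image]
        simp
      · intro h
        have h2 := congrArg (fun s => γ.1 '' s) h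
        simp only [Set.image_image, Homeomorph.apply_symm_apply] at h2
        simpa only [Set.image_image] using h2
    rw [key]
    constructor
    · rintro ⟨q, hq, rfl⟩
      have h3 : γ⁻¹ * (γ * q * γ⁻¹) * γ = q := by group
      change γ⁻¹ * (γ * q * γ⁻¹) * γ ∈ _
      rw [h3]
      exact hq
    · intro h
      refine ⟨_, h, ?_⟩
      change γ * (γ⁻¹ * g * γ) * γ⁻¹ = g
      group

/-! ### Enhanced homomorphisms and pleated surfaces -/

/-- An enhanced homomorphism from the fundamental group to `IsomPlus`: a group homomorphism `hom`,
together with an equivariant assignment, to each peripheral subgroup `P`, of a point of the sphere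
at infinity that is fixed by `hom P`. -/
structure EnhancedHom (A : PunctureDiscs V) (p : E → ↥(Vᶜ)) where
  /-- The homomorphism. -/
  hom : Deck p →* IsomPlus
  /-- The fixed point assigned to each peripheral subgroup. -/
  pt : {P : Subgroup (Deck p) // IsPeripheral A p P} → Boundary
  fixed : ∀ P, ∀ γ ∈ P.1, BoundaryMaps (hom γ).1 (pt P) (pt P)
  equivariant : ∀ (γ : Deck p) P,
    BoundaryMaps (hom γ).1 (pt P) (pt ⟨PleatedSurfaces.conj γ P.1, P.2.conj γ⟩)

/-- `(f, r)` is a pleated surface with pleating locus the ideal triangulation `lam`. -/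
structure IsPleatedSurface (p : E → ↥(Vᶜ)) (lam : IdealTriangulation V) (f : E → H3)
    (r : Deck p →* IsomPlus) : Prop where
  continuous : Continuous f
  /-- Each component of the preimage of the edges is sent homeomorphically to a geodesic. -/
  edge : ∀ e ∈ p ⁻¹' lam.edges,
    IsEmbedding ((connectedComponentIn (p ⁻¹' lam.edges) e).domRestrict f) ∧
      IsCompleteGeodesic (f '' connectedComponentIn (p ⁻¹' lam.edges) e)
  /-- The closure of each complementary component is sent homeomorphically to an ideal
  triangle. -/
  face : ∀ e ∉ p ⁻¹' lam.edges,
    IsEmbedding ((closure (connectedComponentIn (p ⁻¹' lam.edges)ᶜ e)).domRestrict f) ∧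
      IsIdealTriangle (f '' closure (connectedComponentIn (p ⁻¹' lam.edges)ᶜ e))
  equivariant : ∀ (γ : Deck p) (e : E), f (γ.1 e) = (r γ).1 (f e)

/-- The enhanced homomorphism `ρ` is associated to the map `f : E → H3`: if a triangle of the
lifted triangulation has an ideal vertex in the component `C` of the preimage of the annulus
around the puncture `v`, then the corresponding ideal vertex of the image of the triangle under
`f` is the point that `ρ` assigns to the peripheral subgroup stabilizing `C`. Namely, `f` tends to
this point as one approaches the puncture in the intersection of `C` with the triangle. -/
def IsAssociated {A : PunctureDiscs V} {p : E → ↥(Vᶜ)} (ρ : EnhancedHom A p)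
    (lam : IdealTriangulation V) (f : E → H3) : Prop :=
  ∀ e ∉ p ⁻¹' lam.edges, ∀ (v : V), ∀ (e' : E) (he' : e' ∈ liftAnnulus A p v),
    TendstoBoundary f
      (comap (fun x => (p x : Sbar)) (𝓝 (v : Sbar)) ⊓
        𝓟 (closure (connectedComponentIn (p ⁻¹' lam.edges)ᶜ e) ∩ annulusComponent A p v e'))
      (ρ.pt ⟨setStabilizer p (annulusComponent A p v e'), v, e', he', rfl⟩)

/-- The enhanced homomorphism realizes the ideal triangulation `lam`: it is associated to a
pleated surface with pleating locus `lam`. -/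
def EnhancedHom.Realizes {A : PunctureDiscs V} {p : E → ↥(Vᶜ)} (ρ : EnhancedHom A p)
    (lam : IdealTriangulation V) : Prop :=
  ∃ f : E → H3, IsPleatedSurface p lam f ρ.hom ∧ IsAssociated ρ lam f

/-- An enhanced homomorphism is peripherally generic if it realizes every ideal triangulation. -/
def EnhancedHom.PeripherallyGeneric {A : PunctureDiscs V} {p : E → ↥(Vᶜ)}
    (ρ : EnhancedHom A p) : Prop :=
  ∀ lam : IdealTriangulation V, ρ.Realizes lam

end Peripheral

end PleatedSurfaces

end

open scoped commutatorElement

noncomputable section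

namespace PleatedSurfaces

universe u w

/-! ### The Minkowski form and the projective model -/

/-! A pleated surface is easy to build once the three points at infinity assigned to the vertices of
each lifted triangle are distinct, so the heart of the matter is `EnhancedHom.injective_vert`.
Suppose that the two ends of a lifted edge receive the same point `ξ`. Turning around each end gives
peripheral elements `a` and `b`, whose images under the homomorphism both fix `ξ`. The stabilizer of
`ξ` acts on the boundary minus `ξ` by similarities of a plane. The rotation parts of squares
commute, so `⁅a ^ 2, b ^ 2⁆` and its conjugate by `a ^ 2` act as translations and commute
(`commute_nullStabilizer`, `commute_of_boundaryMaps`). By injectivity the same relation holds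
between the deck transformations `a` and `b`.

The relation fails because the fundamental group maps to the modular group in a way dictated by the
triangulation: develop the lifted triangulation combinatorially onto the Farey tessellation, with
`U` turning inside a triangle and `S` crossing a side. Since the vertices are removed, no condition
arises around them, and simple connectedness of `E` makes the development exist
(`Tri.exists_nbr_eq_mul`); its monodromy is the homomorphism. It sends `a` and `b`, up to a common
conjugation, to nontrivial powers of opposite parabolics, and a matrix computation shows that these
violate the relation (`exists_modularGroup`, `Tri.exists_rotations`). No structure theory of surface
groups is needed.

For the construction, each ideal triangle is parametrized by barycentric coordinates, weighted so as
to be natural under isometries (`apply_idealPoint`). Two adjacent parametrizations disagree along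
the common edge by a translation of the geodesic. Each is precomposed with a shear that absorbs half
of the discrepancy (`shearRatio_mul`); this symmetric choice is canonical, hence equivariant
(`shearRatio_map`). The maps then glue (`EnhancedHom.pleat_flip`), and continuity can be checked
triangle by triangle (`Tri.isOpen_iff`). -/

theorem mink_add_left (u v w : ℝ × E3) : mink (u + v) w = mink u w + mink v w := by
  simp only [mink, Prod.fst_add, Prod.snd_add, inner_add_left]; ring

theorem mink_smul_left (c : ℝ) (v w : ℝ × E3) : mink (c • v) w = c * mink v w := by
  simp only [mink, Prod.smul_fst, Prod.smul_snd, real_inner_smul_left, smul_eq_mul]; ring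

theorem mink_comm (v w : ℝ × E3) : mink v w = mink w v := by
  simp only [mink, real_inner_comm v.2 w.2, mul_comm]

theorem mink_add_right (u v w : ℝ × E3) : mink u (v + w) = mink u v + mink u w := by
  rw [mink_comm, mink_add_left, mink_comm v, mink_comm w]

theorem mink_smul_right (c : ℝ) (v w : ℝ × E3) : mink v (c • w) = c * mink v w := by
  rw [mink_comm, mink_smul_left, mink_comm]

theorem mink_self (v : ℝ × E3) : mink v v = ‖v.2‖ ^ 2 - v.1 ^ 2 := by
  simp only [mink, real_inner_self_eq_norm_sq]; ring

/-- Reversed Cauchy–Schwarz inequality. It places `-mink` in the range where `Real.arcosh` is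
injective, so that preserving `hdist` amounts to preserving `mink`. -/
theorem one_le_neg_mink (x y : H3) : 1 ≤ -mink x.1 y.1 := by
  obtain ⟨⟨a, u⟩, hx, ha⟩ := x
  obtain ⟨⟨b, v⟩, hy, hb⟩ := y
  rw [mink_self] at hx hy
  simp only [mink] at *
  have h1 := real_inner_le_norm u v
  have hab : 1 ≤ a * b := by
    have : 1 ≤ a := by nlinarith [sq_nonneg ‖u‖]
    have : 1 ≤ b := by nlinarith [sq_nonneg ‖v‖]
    nlinarith
  have h2 : ‖u‖ * ‖v‖ ≤ a * b - 1 := by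
    refine abs_le_of_sq_le_sq' ?_ (by linarith) |>.2
    have e1 : ‖u‖ ^ 2 = a ^ 2 - 1 := by linarith
    have e2 : ‖v‖ ^ 2 = b ^ 2 - 1 := by linarith
    rw [mul_pow, e1, e2]
    nlinarith [sq_nonneg (a - b)]
  linarith

/-- The linear extension of an isometry of hyperbolic space preserves the Minkowski form. -/
theorem exists_linearEquiv_of_isomPlus (g : IsomPlus) :
    ∃ L : (ℝ × E3) ≃ₗ[ℝ] (ℝ × E3), (∀ u v, mink (L u) (L v) = mink u v) ∧
      ∀ x : H3, L x.1 = (g.1 x).1 := by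
  obtain ⟨g, hg, L, -, hL⟩ := g
  refine ⟨L, ?_, hL⟩
  have key : ∀ x y : H3, mink (L x.1) (L y.1) = mink x.1 y.1 := by
    intro x y
    rw [hL, hL]
    have := Real.arcosh_injOn (one_le_neg_mink _ _) (one_le_neg_mink _ _) (hg x y)
    linarith
  -- Points of the hyperboloid span: lift the spatial part of `v` to the sheet and correct the time
  -- coordinate along `(1, 0)`. Bilinearity then extends `key` to all vectors.
  have dec : ∀ v : ℝ × E3, ∃ (x y : H3) (c : ℝ), v = x.1 + c • y.1 := by
    rintro ⟨a, z⟩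
    refine ⟨⟨(√(1 + ‖z‖ ^ 2), z), ?_, ?_⟩, ⟨(1, 0), ?_, ?_⟩, a - √(1 + ‖z‖ ^ 2), ?_⟩
    · rw [mink_self]
      simp only
      rw [Real.sq_sqrt (by positivity)]; ring
    · simp only; positivity
    · simp [mink_self]
    · simp
    · ext <;> simp
  intro u v
  obtain ⟨x, y, c, rfl⟩ := dec u
  obtain ⟨x', y', c', rfl⟩ := dec v
  simp only [map_add, map_smul, mink_add_left, mink_add_right, mink_smul_left, mink_smul_right, key]

/-- The point of hyperbolic space in the direction of a timelike vector. -/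
def toH3 (v : ℝ × E3) (h : mink v v < 0 ∧ 0 < v.1) : H3 :=
  ⟨(√(-mink v v))⁻¹ • v, by
    have h1 : 0 < √(-mink v v) := Real.sqrt_pos.2 (by linarith [h.1])
    have h2 : √(-mink v v) ^ 2 = -mink v v := Real.sq_sqrt (by linarith [h.1])
    constructor
    · rw [mink_smul_left, mink_smul_right]
      field_simp
      linarith
    · simp only [Prod.smul_fst, smul_eq_mul]
      have := h.2
      positivity⟩

theorem klein_toH3 (v : ℝ × E3) (h : mink v v < 0 ∧ 0 < v.1) :
    klein (toH3 v h) = v.1⁻¹ • v.2 := by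
  have h1 : 0 < √(-mink v v) := Real.sqrt_pos.2 (by linarith [h.1])
  have h2 := h.2
  simp only [klein, toH3, Prod.smul_fst, Prod.smul_snd, smul_eq_mul, smul_smul]
  congr 1
  field_simp

theorem klein_eq_iff (x : H3) (v : ℝ × E3) (h : mink v v < 0 ∧ 0 < v.1) :
    klein x = v.1⁻¹ • v.2 ↔ x = toH3 v h := by
  refine ⟨fun hx => ?_, fun hx => hx ▸ klein_toH3 v h⟩
  have key : ∀ x y : H3, klein x = klein y → x = y := by
    rintro ⟨⟨a, u⟩, hx, ha⟩ ⟨⟨b, w⟩, hy, hb⟩ hk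
    simp only [klein] at hk
    rw [mink_self] at hx hy
    simp only at *
    have hu : u = (a * b⁻¹) • w := by
      have := congrArg (fun z => a • z) hk
      simpa [smul_smul, ha.ne'] using this
    have hab : a = b := by
      have e : ‖u‖ ^ 2 = (a * b⁻¹) ^ 2 * ‖w‖ ^ 2 := by
        rw [hu, norm_smul, mul_pow, Real.norm_eq_abs, sq_abs]
      have e2 : b ^ 2 * ‖u‖ ^ 2 = a ^ 2 * ‖w‖ ^ 2 := by rw [e]; field_simp
      have e3 : a ^ 2 = b ^ 2 := by nlinarith
      exact (sq_eq_sq₀ ha.le hb.le).1 e3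
    subst hab
    simp [hu, ha.ne']
  apply key
  rw [hx, klein_toH3]

theorem klein_injective : Function.Injective klein := by
  intro x y h
  have hy : mink y.1 y.1 < 0 ∧ 0 < y.1.1 := ⟨by rw [y.2.1]; norm_num, y.2.2⟩
  exact ((klein_eq_iff x y.1 hy).1 h).trans ((klein_eq_iff y y.1 hy).1 rfl).symm

theorem continuous_klein : Continuous klein := by
  unfold klein
  exact ((continuous_fst.comp continuous_subtype_val).inv₀ fun x : H3 => x.2.2.ne').smul
    (continuous_snd.comp continuous_subtype_val)

theorem norm_klein_lt_one (x : H3) : ‖klein x‖ < 1 := by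
  obtain ⟨⟨a, u⟩, hx, ha⟩ := x
  rw [mink_self] at hx
  simp only [klein] at *
  rw [norm_smul, norm_inv, Real.norm_eq_abs, abs_of_pos ha, inv_mul_lt_one₀ ha]
  exact lt_of_pow_lt_pow_left₀ 2 ha.le (by linarith)

section LinearExtension

variable {g : Equiv.Perm H3} {L : (ℝ × E3) ≃ₗ[ℝ] (ℝ × E3)}

/-- Preserving the form would still allow the two sheets to be exchanged; the time direction is kept
because `L` restricts to `g` on the upper sheet. -/
theorem timelike_map (hL : ∀ u v, mink (L u) (L v) = mink u v) (hg : ∀ x : H3, L x.1 = (g x).1)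
    (v : ℝ × E3) (h : mink v v < 0 ∧ 0 < v.1) : mink (L v) (L v) < 0 ∧ 0 < (L v).1 := by
  refine ⟨by rw [hL]; exact h.1, ?_⟩
  have h1 : 0 < √(-mink v v) := Real.sqrt_pos.2 (by linarith [h.1])
  have h2 := hg (toH3 v h)
  have h3 := (g (toH3 v h)).2.2
  rw [← h2] at h3
  simp only [toH3, map_smul, Prod.smul_fst, smul_eq_mul] at h3
  exact (mul_pos_iff_of_pos_left (by positivity)).1 h3

theorem apply_toH3 (hL : ∀ u v, mink (L u) (L v) = mink u v) (hg : ∀ x : H3, L x.1 = (g x).1)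
    (v : ℝ × E3) (h : mink v v < 0 ∧ 0 < v.1) :
    g (toH3 v h) = toH3 (L v) (timelike_map hL hg v h) := by
  apply Subtype.ext
  rw [← hg]
  simp only [toH3, map_smul, hL]

/-- The lightlike vector representing a point at infinity. -/
def nullVec (ξ : Boundary) : ℝ × E3 := (1, ξ)

theorem mink_nullVec_self (ξ : Boundary) : mink (nullVec ξ) (nullVec ξ) = 0 := by
  have : ‖(ξ : E3)‖ = 1 := by simp
  rw [mink_self]
  simp [nullVec, this]

theorem mink_nullVec_neg {ξ η : Boundary} (h : ξ ≠ η) : mink (nullVec ξ) (nullVec η) < 0 := by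
  have h1 : ‖(ξ : E3)‖ = 1 := by simp
  have h2 : ‖(η : E3)‖ = 1 := by simp
  have h3 := (inner_lt_one_iff_real_of_norm_eq_one h1 h2).2 (fun e => h (Subtype.ext e))
  simp only [mink, nullVec]
  linarith

/-- The limit defining `BoundaryMaps` is tested on points tending radially to `ξ`, and continuity of
`L` identifies it with the direction of `L (nullVec ξ)`. The time coordinate of this vector is
nonnegative as a limit, and nonzero because a lightlike vector without time component vanishes. -/
theorem exists_smul_nullVec (hL : ∀ u v, mink (L u) (L v) = mink u v)
    (hg : ∀ x : H3, L x.1 = (g x).1) {ξ η : Boundary} (h : BoundaryMaps g ξ η) :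
    ∃ μ : ℝ, 0 < μ ∧ L (nullVec ξ) = μ • nullVec η := by
  have hξ : ‖(ξ : E3)‖ = 1 := by simp
  set s : ℕ → ℝ := fun n => 1 - 1 / ((n : ℝ) + 1 + 1) with hs
  have hs0 : ∀ n, 0 ≤ s n ∧ s n < 1 := by
    intro n
    have : (0 : ℝ) < (n : ℝ) + 1 + 1 := by positivity
    constructor
    · simp only [hs, sub_nonneg]
      rw [div_le_one this]; linarith [(Nat.cast_nonneg n : (0 : ℝ) ≤ n)]
    · simp only [hs]
      have : 0 < 1 / ((n : ℝ) + 1 + 1) := by positivity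
      linarith
  have hs1 : Tendsto s atTop (𝓝 1) := by
    have h0 := ((tendsto_one_div_add_atTop_nhds_zero_nat (𝕜 := ℝ)).comp
      (tendsto_add_atTop_nat 1)).const_sub 1
    simpa [hs, Function.comp_def] using h0
  set v : ℕ → ℝ × E3 := fun n => (1, s n • (ξ : E3)) with hv
  have hvt : ∀ n, mink (v n) (v n) < 0 ∧ 0 < (v n).1 := by
    intro n
    refine ⟨?_, by simp [hv]⟩
    rw [mink_self]
    simp only [hv, norm_smul, hξ, Real.norm_eq_abs, mul_one, sq_abs]
    nlinarith [hs0 n]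
  have hvlim : Tendsto v atTop (𝓝 (nullVec ξ)) := by
    have : Tendsto (fun n => s n • (ξ : E3)) atTop (𝓝 ((1 : ℝ) • (ξ : E3))) := hs1.smul_const _
    rw [one_smul] at this
    exact tendsto_const_nhds.prodMk_nhds this
  have hk : Tendsto (fun n => toH3 (v n) (hvt n)) atTop (comap klein (𝓝 (ξ : E3))) := by
    rw [tendsto_comap_iff]
    have : (klein ∘ fun n => toH3 (v n) (hvt n)) = fun n => s n • (ξ : E3) := by
      ext1 n
      simp [klein_toH3, hv]
    rw [this]
    simpa using hs1.smul_const (ξ : E3)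
  have hη : Tendsto (fun n => (L (v n)).1⁻¹ • (L (v n)).2) atTop (𝓝 (η : E3)) := by
    have := Tendsto.comp h hk
    refine this.congr fun n => ?_
    simp only [Function.comp, apply_toH3 hL hg, klein_toH3]
  have hLc : Continuous L := (L : (ℝ × E3) →ₗ[ℝ] (ℝ × E3)).continuous_of_finiteDimensional
  have hLlim : Tendsto (fun n => L (v n)) atTop (𝓝 (L (nullVec ξ))) :=
    (hLc.tendsto _).comp hvlim
  have h1 : 0 ≤ (L (nullVec ξ)).1 :=
    ge_of_tendsto ((continuous_fst.tendsto _).comp hLlim)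
      (Eventually.of_forall fun n => (timelike_map hL hg _ (hvt n)).2.le)
  have h0 : mink (L (nullVec ξ)) (L (nullVec ξ)) = 0 := by rw [hL, mink_nullVec_self]
  have h2 : (L (nullVec ξ)).1 ≠ 0 := by
    intro h3
    rw [mink_self, h3] at h0
    have h4 : (L (nullVec ξ)).2 = 0 := by simpa using h0
    have h5 : nullVec ξ = 0 := by
      rw [← L.map_eq_zero_iff]
      exact Prod.ext h3 h4
    simpa [nullVec] using congrArg Prod.fst h5
  have h3 : Tendsto (fun n => (L (v n)).1⁻¹ • (L (v n)).2) atTop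
      (𝓝 ((L (nullVec ξ)).1⁻¹ • (L (nullVec ξ)).2)) :=
    (((continuous_fst.tendsto _).comp hLlim).inv₀ h2).smul
      ((continuous_snd.tendsto _).comp hLlim)
  have h4 := tendsto_nhds_unique h3 hη
  refine ⟨_, lt_of_le_of_ne h1 h2.symm, ?_⟩
  ext1
  · simp [nullVec]
  · simp only [Prod.smul_snd]
    change _ = _ • (η : E3)
    rw [← h4, smul_smul, mul_inv_cancel₀ h2, one_smul]

end LinearExtension

/-! ### The stabilizer of a point at infinity -/

theorem linearEquiv_one_apply {V : Type*} [AddCommGroup V] [Module ℝ V] (v : V) :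
    (1 : V ≃ₗ[ℝ] V) v = v := rfl

/-- The linear isometries of the Minkowski form that preserve the line of `nullVec ξ`. -/
def nullStabilizer (ξ : Boundary) : Subgroup ((ℝ × E3) ≃ₗ[ℝ] (ℝ × E3)) where
  carrier := {L | (∀ u v, mink (L u) (L v) = mink u v) ∧ ∃ μ : ℝ, L (nullVec ξ) = μ • nullVec ξ}
  one_mem' := ⟨fun _ _ => rfl, 1, by simp⟩
  mul_mem' := by
    rintro L M ⟨hL, μ, hμ⟩ ⟨hM, ν, hν⟩
    refine ⟨fun u v => by simp only [LinearEquiv.mul_apply, hL, hM], ν * μ, ?_⟩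
    simp only [LinearEquiv.mul_apply, hν, map_smul, hμ, smul_smul]
  inv_mem' := by
    rintro L ⟨hL, μ, hμ⟩
    refine ⟨fun u v => ?_, μ⁻¹, ?_⟩
    · rw [← hL, ← LinearEquiv.mul_apply, ← LinearEquiv.mul_apply, mul_inv_cancel]
      rfl
    · have h0 : μ ≠ 0 := by
        rintro rfl
        rw [zero_smul, L.map_eq_zero_iff] at hμ
        simpa [nullVec] using congrArg Prod.fst hμ
      apply L.injective
      rw [map_smul, hμ, smul_smul, inv_mul_cancel₀ h0, one_smul, ← LinearEquiv.mul_apply,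
        mul_inv_cancel, linearEquiv_one_apply]

theorem exists_orthonormal_pair (ξ : Boundary) :
    ∃ u : Fin 2 → E3, (∀ i j, inner ℝ (u i) (u j) = if i = j then (1 : ℝ) else 0) ∧
      (∀ i, inner ℝ (u i) (ξ : E3) = (0 : ℝ)) ∧
      ∀ z : E3, z = inner ℝ z (ξ : E3) • (ξ : E3) + ∑ i, (inner ℝ (u i) z : ℝ) • u i := by
  have hξ : ‖(ξ : E3)‖ = 1 := by simp
  have hξ0 : (ξ : E3) ≠ 0 := fun h => by simp [h] at hξ
  have : Fact (Module.finrank ℝ E3 = 2 + 1) := ⟨by simp⟩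
  have hf : Module.finrank ℝ (ℝ ∙ (ξ : E3))ᗮ = 2 := Submodule.finrank_orthogonal_span_singleton hξ0
  let b := (stdOrthonormalBasis ℝ (ℝ ∙ (ξ : E3))ᗮ).reindex (finCongr hf)
  refine ⟨fun i => b i, ?_, ?_, ?_⟩
  · intro i j
    have := orthonormal_iff_ite.1 b.orthonormal i j
    simpa using this
  · intro i
    have := (b i).2
    rw [Submodule.mem_orthogonal_singleton_iff_inner_left] at this
    exact this
  · intro z
    have hz : z - inner ℝ z (ξ : E3) • (ξ : E3) ∈ (ℝ ∙ (ξ : E3))ᗮ := by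
      rw [Submodule.mem_orthogonal_singleton_iff_inner_left, inner_sub_left, real_inner_smul_left,
        real_inner_self_eq_norm_sq, hξ]
      ring
    have h1 := congrArg Subtype.val (b.sum_repr' ⟨_, hz⟩)
    have h2 : ∀ i, (inner ℝ (b i : E3) (ξ : E3) : ℝ) = 0 := by
      intro i
      have := (b i).2
      rwa [Submodule.mem_orthogonal_singleton_iff_inner_left] at this
    simp only [Submodule.coe_sum, Submodule.coe_smul, Submodule.coe_inner, inner_sub_right,
      real_inner_smul_right, h2, mul_zero, sub_zero] at h1
    rw [h1]
    abel

/-- A rotation squares to a rotation and a reflection squares to the identity. Passing to squares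
avoids having to relate the orientation of an isometry to the determinant of its rotation part. -/
theorem exists_orthogonal_sq_eq {A : Matrix (Fin 2) (Fin 2) ℝ} (h : A.transpose * A = 1) :
    ∃ p q : ℝ, A * A = !![p, q; -q, p] := by
  have h00 := congrFun (congrFun h 0) 0
  have h01 := congrFun (congrFun h 0) 1
  have h11 := congrFun (congrFun h 1) 1
  simp only [Matrix.mul_apply, Fin.sum_univ_two, Matrix.transpose_apply, Matrix.one_apply] at h00 h01 h11
  norm_num at h00 h01 h11
  set a := A 0 0
  set b := A 0 1
  set c := A 1 0
  set d := A 1 1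
  have hA : A = !![a, b; c, d] := by ext i j; fin_cases i <;> fin_cases j <;> rfl
  have hdet : (a * d - b * c - 1) * (a * d - b * c + 1) = 0 := by
    have : (a * d - b * c) ^ 2 = (a * a + c * c) * (b * b + d * d) - (a * b + c * d) ^ 2 := by ring
    rw [h00, h11, h01] at this
    linear_combination this
  rw [hA]
  rcases mul_eq_zero.1 hdet with h' | h'
  -- By orthonormality of the columns, `(a - d)^2 + (b + c)^2 = 2 - 2 * (a * d - b * c)`, which is
  -- zero here; the other sign is symmetric.
  · have e1 : a - d = 0 := by nlinarith [sq_nonneg (a - d), sq_nonneg (b + c)]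
    have e2 : b + c = 0 := by nlinarith [sq_nonneg (a - d), sq_nonneg (b + c)]
    have e3 : d = a := by linarith
    have e4 : c = -b := by linarith
    refine ⟨a * a - b * b, 2 * b * a, ?_⟩
    rw [e3, e4]
    ext i j
    fin_cases i <;> fin_cases j <;> simp [Matrix.mul_apply, Fin.sum_univ_two] <;> ring
  · have e1 : a + d = 0 := by nlinarith [sq_nonneg (a + d), sq_nonneg (b - c)]
    have e2 : b - c = 0 := by nlinarith [sq_nonneg (a + d), sq_nonneg (b - c)]
    have e3 : d = -a := by linarith
    have e4 : c = b := by linarith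
    refine ⟨1, 0, ?_⟩
    rw [e4] at h00
    rw [e3, e4]
    ext i j
    fin_cases i <;> fin_cases j <;> simp [Matrix.mul_apply, Fin.sum_univ_two] <;> linarith

theorem orthogonal_sq_mul_comm {A B : Matrix (Fin 2) (Fin 2) ℝ} (hA : A.transpose * A = 1)
    (hB : B.transpose * B = 1) : (A * A) * (B * B) = (B * B) * (A * A) := by
  obtain ⟨p, q, h1⟩ := exists_orthogonal_sq_eq hA
  obtain ⟨r, s, h2⟩ := exists_orthogonal_sq_eq hB
  rw [h1, h2]
  ext i j
  fin_cases i <;> fin_cases j <;> simp [Matrix.mul_apply, Fin.sum_univ_two] <;> ring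

theorem nullVec_ne_zero (ξ : Boundary) : nullVec ξ ≠ 0 := fun h => by
  simpa [nullVec] using congrArg Prod.fst h

/-- A pair of orthonormal vectors spanning a complement of `nullVec ξ` in its orthogonal. -/
structure NullFrame (ξ : Boundary) where
  /-- The vectors of the frame. -/
  vec : Fin 2 → ℝ × E3
  mink_vec : ∀ i j, mink (vec i) (vec j) = if i = j then (1 : ℝ) else 0
  mink_null : ∀ i, mink (vec i) (nullVec ξ) = 0
  decomp : ∀ z, mink z (nullVec ξ) = 0 → ∃ c : ℝ,
    z = ∑ i, mink (vec i) z • vec i + c • nullVec ξ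

theorem nonempty_nullFrame (ξ : Boundary) : Nonempty (NullFrame ξ) := by
  obtain ⟨u, hu, huξ, hdec⟩ := exists_orthonormal_pair ξ
  refine ⟨⟨fun i => (0, u i), fun i j => by simp [mink, hu], fun i => by simp [mink, nullVec, huξ],
    ?_⟩⟩
  rintro ⟨t, z⟩ hz
  have ht : inner ℝ z (ξ : E3) = t := by
    simp only [mink, nullVec] at hz; linarith
  refine ⟨t, ?_⟩
  ext1
  · simp [nullVec]
  · conv_lhs => rw [hdec z]
    simp [nullVec, mink, ht, add_comm]

theorem mink_nullStabilizer_apply {ξ : Boundary} {L : (ℝ × E3) ≃ₗ[ℝ] (ℝ × E3)}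
    (h : L ∈ nullStabilizer ξ) {z : ℝ × E3} (hz : mink z (nullVec ξ) = 0) :
    mink (L z) (nullVec ξ) = 0 := by
  obtain ⟨hL, μ, hμ⟩ := h
  have h1 := hL z (nullVec ξ)
  rw [hμ, mink_smul_right, hz] at h1
  rcases mul_eq_zero.1 h1 with h2 | h2
  · rw [h2, zero_smul, L.map_eq_zero_iff] at hμ
    exact absurd hμ (nullVec_ne_zero ξ)
  · exact h2

/-- An isometry that fixes the orthogonal of a lightlike vector is the identity. -/
theorem eq_one_of_fix_orthogonal {ξ : Boundary} {N : (ℝ × E3) ≃ₗ[ℝ] (ℝ × E3)}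
    (hN : ∀ u v, mink (N u) (N v) = mink u v)
    (hNz : ∀ z, mink z (nullVec ξ) = 0 → N z = z) : N = 1 := by
  obtain ⟨w⟩ := nonempty_nullFrame ξ
  have hξ : ‖(ξ : E3)‖ = 1 := by simp
  obtain ⟨m, hmm, hmn⟩ : ∃ m : ℝ × E3, mink m m = 0 ∧ mink m (nullVec ξ) = -2 := by
    refine ⟨(1, -(ξ : E3)), by simp [mink_self, hξ], ?_⟩
    simp only [mink, nullVec, inner_neg_left, real_inner_self_eq_norm_sq, hξ]; norm_num
  have hNn : N (nullVec ξ) = nullVec ξ := hNz _ (mink_nullVec_self ξ)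
  -- The difference `N m - m` is orthogonal to `nullVec ξ` and to the frame, so it is a multiple of
  -- `nullVec ξ`. As `N m` is again lightlike and `mink m (nullVec ξ) ≠ 0`, the multiple is zero.
  have hNm : N m = m := by
    have h1 : mink (N m + (-1 : ℝ) • m) (nullVec ξ) = 0 := by
      rw [mink_add_left, mink_smul_left]
      have := hN m (nullVec ξ)
      rw [hNn] at this
      rw [this]; ring
    obtain ⟨c, hc⟩ := w.decomp _ h1
    have h2 : ∀ i, mink (w.vec i) (N m + (-1 : ℝ) • m) = 0 := by
      intro i
      rw [mink_add_right, mink_smul_right]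
      have := hN (w.vec i) m
      rw [hNz _ (w.mink_null i)] at this
      rw [this]; ring
    simp only [h2, zero_smul, Finset.sum_const_zero, zero_add] at hc
    have h3 : N m = m + c • nullVec ξ := by
      rw [← hc]; simp
    have h4 := hN m m
    rw [h3] at h4
    simp only [mink_add_left, mink_add_right, mink_smul_left, mink_smul_right, hmm, hmn,
      mink_comm (nullVec ξ) m, mink_nullVec_self] at h4
    have h5 : c = 0 := by linarith
    rw [h3, h5, zero_smul, add_zero]
  refine LinearEquiv.ext fun z => ?_
  have h1 : mink (z + (mink z (nullVec ξ) / 2) • m) (nullVec ξ) = 0 := by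
    rw [mink_add_left, mink_smul_left, hmn]; ring
  have h2 := hNz _ h1
  rw [map_add, map_smul, hNm] at h2
  exact add_right_cancel h2

/-- The unipotent elements of the stabilizer commute. -/
theorem commute_unipotent {ξ : Boundary} (w : NullFrame ξ) {L M : (ℝ × E3) ≃ₗ[ℝ] (ℝ × E3)}
    (hL : L ∈ nullStabilizer ξ) (hM : M ∈ nullStabilizer ξ)
    (hLn : L (nullVec ξ) = nullVec ξ) (hMn : M (nullVec ξ) = nullVec ξ)
    (hLw : ∀ j, ∃ c : ℝ, L (w.vec j) = w.vec j + c • nullVec ξ)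
    (hMw : ∀ j, ∃ c : ℝ, M (w.vec j) = w.vec j + c • nullVec ξ) : Commute L M := by
  have hLMw : ∀ j, (L * M) (w.vec j) = (M * L) (w.vec j) := by
    intro j
    obtain ⟨c, hc⟩ := hLw j
    obtain ⟨d, hd⟩ := hMw j
    simp only [LinearEquiv.mul_apply, hc, hd, map_add, map_smul, hLn, hMn]
    abel
  have hLMn : (L * M) (nullVec ξ) = (M * L) (nullVec ξ) := by
    simp only [LinearEquiv.mul_apply, hLn, hMn]
  have hperpLM : ∀ z, mink z (nullVec ξ) = 0 → (L * M) z = (M * L) z := by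
    intro z hz
    obtain ⟨c, hc⟩ := w.decomp z hz
    rw [hc]
    simp only [Fin.sum_univ_two, map_add, map_smul, hLMw, hLMn]
  have hN1 : (M * L)⁻¹ * (L * M) = 1 := by
    refine eq_one_of_fix_orthogonal (ξ := ξ)
      (mul_mem (inv_mem (mul_mem hM hL)) (mul_mem hL hM)).1 fun z hz => ?_
    rw [LinearEquiv.mul_apply (M * L)⁻¹, hperpLM z hz, ← LinearEquiv.mul_apply, inv_mul_cancel,
      linearEquiv_one_apply]
  exact (inv_mul_eq_one.1 hN1).symm

/-- The action of the stabilizer on the orthogonal of `nullVec ξ` modulo `nullVec ξ`. -/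
def rotationPart {ξ : Boundary} (w : NullFrame ξ) (L : (ℝ × E3) ≃ₗ[ℝ] (ℝ × E3)) :
    Matrix (Fin 2) (Fin 2) ℝ :=
  Matrix.of fun i j => mink (w.vec i) (L (w.vec j))

theorem rotationPart_one {ξ : Boundary} (w : NullFrame ξ) : rotationPart w 1 = 1 := by
  ext i j
  simp [rotationPart, Matrix.one_apply, w.mink_vec]

/-- The component along `nullVec ξ` lost by the matrix is harmless: `L` preserves that line, and the
frame is orthogonal to it. -/
theorem rotationPart_mul {ξ : Boundary} (w : NullFrame ξ) {L M : (ℝ × E3) ≃ₗ[ℝ] (ℝ × E3)}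
    (hL : L ∈ nullStabilizer ξ) (hM : M ∈ nullStabilizer ξ) :
    rotationPart w (L * M) = rotationPart w L * rotationPart w M := by
  ext i j
  obtain ⟨c, hc⟩ := w.decomp _ (mink_nullStabilizer_apply hM (w.mink_null j))
  obtain ⟨-, μ, hμ⟩ := hL
  simp only [rotationPart, Matrix.of_apply, Matrix.mul_apply, LinearEquiv.mul_apply]
  conv_lhs => rw [hc]
  simp only [Fin.sum_univ_two, map_add, map_smul, hμ, mink_add_right, mink_smul_right, w.mink_null]
  ring

theorem rotationPart_mul_inv {ξ : Boundary} (w : NullFrame ξ) {L : (ℝ × E3) ≃ₗ[ℝ] (ℝ × E3)}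
    (hL : L ∈ nullStabilizer ξ) : rotationPart w L * rotationPart w L⁻¹ = 1 := by
  rw [← rotationPart_mul w hL (inv_mem hL), mul_inv_cancel, rotationPart_one]

theorem rotationPart_orthogonal {ξ : Boundary} (w : NullFrame ξ)
    {L : (ℝ × E3) ≃ₗ[ℝ] (ℝ × E3)} (hL : L ∈ nullStabilizer ξ) :
    (rotationPart w L).transpose * rotationPart w L = 1 := by
  ext i j
  obtain ⟨c, hc⟩ := w.decomp _ (mink_nullStabilizer_apply hL (w.mink_null j))
  have h1 := hL.1 (w.vec i) (w.vec j)
  have h2 := mink_nullStabilizer_apply hL (w.mink_null i)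
  rw [w.mink_vec] at h1
  rw [Matrix.one_apply, ← h1]
  conv_rhs => rw [hc]
  simp only [rotationPart, Matrix.of_apply, Matrix.mul_apply, Matrix.transpose_apply,
    Fin.sum_univ_two, mink_add_right, mink_smul_right, h2, mink_comm (L (w.vec i)) (w.vec _)]
  ring

theorem exists_of_rotationPart_eq_one {ξ : Boundary} (w : NullFrame ξ)
    {L : (ℝ × E3) ≃ₗ[ℝ] (ℝ × E3)} (hL : L ∈ nullStabilizer ξ) (h : rotationPart w L = 1)
    (j : Fin 2) : ∃ c : ℝ, L (w.vec j) = w.vec j + c • nullVec ξ := by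
  obtain ⟨c, hc⟩ := w.decomp _ (mink_nullStabilizer_apply hL (w.mink_null j))
  refine ⟨c, hc.trans ?_⟩
  have h1 : ∀ i, mink (w.vec i) (L (w.vec j)) = if i = j then (1 : ℝ) else 0 := by
    intro i
    have := congrFun (congrFun h i) j
    simpa [rotationPart, Matrix.one_apply] using this
  simp [h1]

/-- Elements of the stabilizer scale `nullVec ξ` by real numbers, and real scalars commute. -/
theorem commutator_apply_nullVec {ξ : Boundary} {L M : (ℝ × E3) ≃ₗ[ℝ] (ℝ × E3)}
    (hL : L ∈ nullStabilizer ξ) (hM : M ∈ nullStabilizer ξ) :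
    ⁅L, M⁆ (nullVec ξ) = nullVec ξ := by
  obtain ⟨μ, hμ⟩ := hL.2
  obtain ⟨ν, hν⟩ := hM.2
  obtain ⟨κ, hκ⟩ := (mul_mem hM hL).2
  have h1 : (L * M) (nullVec ξ) = (M * L) (nullVec ξ) := by
    simp only [LinearEquiv.mul_apply, hμ, hν, map_smul, smul_smul, mul_comm]
  have hκ0 : κ ≠ 0 := by
    rintro rfl
    rw [zero_smul, LinearEquiv.map_eq_zero_iff] at hκ
    exact nullVec_ne_zero ξ hκ
  have h4 : (M * L)⁻¹ (nullVec ξ) = κ⁻¹ • nullVec ξ := by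
    apply (M * L).injective
    rw [map_smul, hκ, smul_smul, inv_mul_cancel₀ hκ0, one_smul, ← LinearEquiv.mul_apply,
      mul_inv_cancel, linearEquiv_one_apply]
  have h3 : ⁅L, M⁆ = L * M * (M * L)⁻¹ := by
    rw [commutatorElement_def]; group
  rw [h3, LinearEquiv.mul_apply, h4, map_smul, h1, hκ, smul_smul, inv_mul_cancel₀ hκ0, one_smul]

/-- The squares of two elements of the stabilizer of a point at infinity generate a metabelian
group. -/
theorem commute_nullStabilizer {ξ : Boundary} {a b : (ℝ × E3) ≃ₗ[ℝ] (ℝ × E3)}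
    (ha : a ∈ nullStabilizer ξ) (hb : b ∈ nullStabilizer ξ) :
    Commute ⁅a ^ 2, b ^ 2⁆ (a ^ 2 * ⁅a ^ 2, b ^ 2⁆ * (a ^ 2)⁻¹) := by
  obtain ⟨w⟩ := nonempty_nullFrame ξ
  have ha2 := pow_mem ha 2
  have hb2 := pow_mem hb 2
  -- Only this step uses that the elements are squares; they are generalized right after it.
  have hcommA : rotationPart w (a ^ 2) * rotationPart w (b ^ 2) =
      rotationPart w (b ^ 2) * rotationPart w (a ^ 2) := by
    rw [pow_two, pow_two, rotationPart_mul w ha ha, rotationPart_mul w hb hb]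
    exact orthogonal_sq_mul_comm (rotationPart_orthogonal w ha) (rotationPart_orthogonal w hb)
  generalize a ^ 2 = a' at *
  generalize b ^ 2 = b' at *
  have hx : ⁅a', b'⁆ ∈ nullStabilizer ξ :=
    mul_mem (mul_mem (mul_mem ha2 hb2) (inv_mem ha2)) (inv_mem hb2)
  have hAx : rotationPart w ⁅a', b'⁆ = 1 := by
    rw [commutatorElement_def,
      rotationPart_mul w (mul_mem (mul_mem ha2 hb2) (inv_mem ha2)) (inv_mem hb2),
      rotationPart_mul w (mul_mem ha2 hb2) (inv_mem ha2), rotationPart_mul w ha2 hb2, hcommA,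
      mul_assoc (rotationPart w b'), rotationPart_mul_inv w ha2, mul_one,
      rotationPart_mul_inv w hb2]
  -- The conjugate is again a commutator inside the stabilizer, so it also fixes `nullVec ξ` itself
  -- and not only its line.
  have hy : a' * ⁅a', b'⁆ * a'⁻¹ = ⁅a', a' * b' * a'⁻¹⁆ := by
    simp only [commutatorElement_def]; group
  have hymem := mul_mem (mul_mem ha2 hx) (inv_mem ha2)
  refine commute_unipotent w hx hymem (commutator_apply_nullVec ha2 hb2) ?_
    (exists_of_rotationPart_eq_one w hx hAx) (exists_of_rotationPart_eq_one w hymem ?_)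
  · rw [hy]
    exact commutator_apply_nullVec ha2 (mul_mem (mul_mem ha2 hb2) (inv_mem ha2))
  · rw [rotationPart_mul w (mul_mem ha2 hx) (inv_mem ha2), rotationPart_mul w ha2 hx, hAx, mul_one,
      rotationPart_mul_inv w ha2]

/-- Linear extensions are chosen one isometry at a time, so the relation is transferred through `R`,
"`L` extends `g`", which is stable under products and inverses and determines `g` from `L`. -/
theorem commute_of_boundaryMaps {ξ : Boundary} {a b : IsomPlus}
    (ha : BoundaryMaps a.1 ξ ξ) (hb : BoundaryMaps b.1 ξ ξ) :
    Commute ⁅a ^ 2, b ^ 2⁆ (a ^ 2 * ⁅a ^ 2, b ^ 2⁆ * (a ^ 2)⁻¹) := by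
  let R : IsomPlus → ((ℝ × E3) ≃ₗ[ℝ] (ℝ × E3)) → Prop := fun g L => ∀ x : H3, L x.1 = (g.1 x).1
  have hmul : ∀ {g h L M}, R g L → R h M → R (g * h) (L * M) := by
    intro g h L M hg hh x
    rw [LinearEquiv.mul_apply, hh, hg]
    rfl
  have hinv : ∀ {g L}, R g L → R g⁻¹ L⁻¹ := by
    intro g L hg x
    apply L.injective
    rw [hg, ← LinearEquiv.mul_apply, mul_inv_cancel, linearEquiv_one_apply]
    simp
  have heq : ∀ {g h L}, R g L → R h L → g = h := by
    intro g h L hg hh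
    ext1
    ext1 x
    exact Subtype.ext ((hg x).symm.trans (hh x))
  obtain ⟨L, hL, hLa⟩ := exists_linearEquiv_of_isomPlus a
  obtain ⟨M, hM, hMb⟩ := exists_linearEquiv_of_isomPlus b
  obtain ⟨μ, -, hμ⟩ := exists_smul_nullVec hL hLa ha
  obtain ⟨ν, -, hν⟩ := exists_smul_nullVec hM hMb hb
  have h := commute_nullStabilizer (show L ∈ nullStabilizer ξ from ⟨hL, μ, hμ⟩)
    (show M ∈ nullStabilizer ξ from ⟨hM, ν, hν⟩)
  have ha' : R (a ^ 2) (L ^ 2) := by rw [pow_two, pow_two]; exact hmul hLa hLa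
  have hb' : R (b ^ 2) (M ^ 2) := by rw [pow_two, pow_two]; exact hmul hMb hMb
  have hx : R ⁅a ^ 2, b ^ 2⁆ ⁅L ^ 2, M ^ 2⁆ :=
    hmul (hmul (hmul ha' hb') (hinv ha')) (hinv hb')
  have hy := hmul (hmul ha' hx) (hinv ha')
  refine heq (hmul hx hy) ?_
  rw [h.eq]
  exact hmul hy hx

/-! ### The modular group -/

/-- The upper left entries already differ: for either sign `r`, equality would make a polynomial in
`n * m` with positive coefficients vanish. The scalar matrix allows for working modulo the centre of
SL₂(ℤ). -/
theorem commutator_entries_ne {n m r : ℤ} (hn : 0 < n) (hm : 0 < m) (hr : r ^ 2 = 1)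
    {A A' B B' : Matrix (Fin 2) (Fin 2) ℤ} (hA : A = !![1, n; 0, 1]) (hA' : A' = !![1, -n; 0, 1])
    (hB : B = !![1, 0; m, 1]) (hB' : B' = !![1, 0; -m, 1]) :
    (A * B * A' * B') * (A * (A * B * A' * B') * A') ≠
      (A * (A * B * A' * B') * A') * (A * B * A' * B') * !![r, 0; 0, r] := by
  intro h
  have hN : 0 < n * m := mul_pos hn hm
  have h00 := congrFun (congrFun h 0) 0
  rw [hA, hA', hB, hB'] at h00
  simp [Matrix.mul_apply, Fin.sum_univ_two] at h00
  obtain rfl | rfl : r = 1 ∨ r = -1 := by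
    have : (r - 1) * (r + 1) = 0 := by linear_combination hr
    rcases mul_eq_zero.1 this with h' | h'
    · left; linarith
    · right; linarith
  · have : (n * m) ^ 3 + (n * m) ^ 4 = 0 := by linarith
    have : 0 < (n * m) ^ 3 + (n * m) ^ 4 := by positivity
    linarith
  · have : 1 + 2 * (n * m) + 4 * (n * m) ^ 2 + (n * m) ^ 3 + (n * m) ^ 4 = 0 := by linarith
    have : 0 < 1 + 2 * (n * m) + 4 * (n * m) ^ 2 + (n * m) ^ 3 + (n * m) ^ 4 := by positivity
    linarith

/-- Two opposite parabolic elements of the modular group, given by turning left and right around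
the triangles of the Farey tessellation, do not generate a metabelian group. -/
theorem exists_modularGroup : ∃ (Γ : Type) (_ : Group Γ) (U S : Γ), U ^ 3 = 1 ∧ S * S = 1 ∧
    ∀ n m : ℕ, 0 < n → 0 < m →
      ¬ Commute ⁅((S * U) ^ n) ^ 2, ((S * U⁻¹) ^ m) ^ 2⁆
        (((S * U) ^ n) ^ 2 * ⁅((S * U) ^ n) ^ 2, ((S * U⁻¹) ^ m) ^ 2⁆ * (((S * U) ^ n) ^ 2)⁻¹) := by
  -- With these generators `S * U` is upper and `S * U⁻¹` lower triangular: parabolics fixing the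
  -- two ends `∞` and `0` of one Farey edge.
  let S : Matrix.SpecialLinearGroup (Fin 2) ℤ := ⟨!![0, -1; 1, 0], by simp [Matrix.det_fin_two_of]⟩
  let U : Matrix.SpecialLinearGroup (Fin 2) ℤ := ⟨!![0, 1; -1, -1], by simp [Matrix.det_fin_two_of]⟩
  let A : ℤ → Matrix.SpecialLinearGroup (Fin 2) ℤ := fun n => ⟨!![1, n; 0, 1], by simp [Matrix.det_fin_two_of]⟩
  let B : ℤ → Matrix.SpecialLinearGroup (Fin 2) ℤ := fun n => ⟨!![1, 0; n, 1], by simp [Matrix.det_fin_two_of]⟩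
  have hAadd : ∀ m n, A m * A n = A (m + n) := by
    intro m n
    apply Subtype.ext
    change !![1, m; 0, 1] * !![1, n; 0, 1] = !![1, m + n; 0, 1]
    simp [add_comm]
  have hBadd : ∀ m n, B m * B n = B (m + n) := by
    intro m n
    apply Subtype.ext
    change !![1, 0; m, 1] * !![1, 0; n, 1] = !![1, 0; m + n, 1]
    simp
  have hA0 : A 0 = 1 := by
    ext i j
    fin_cases i <;> fin_cases j <;> simp [A]
  have hB0 : B 0 = 1 := by
    ext i j
    fin_cases i <;> fin_cases j <;> simp [B]
  have hApow : ∀ (n : ℕ) (k : ℤ), A k ^ n = A (n * k) := by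
    intro n k
    induction n with
    | zero => simp [hA0]
    | succ n ih => rw [pow_succ, ih, hAadd]; congr 1; push_cast; ring
  have hBpow : ∀ (n : ℕ) (k : ℤ), B k ^ n = B (n * k) := by
    intro n k
    induction n with
    | zero => simp [hB0]
    | succ n ih => rw [pow_succ, ih, hBadd]; congr 1; push_cast; ring
  have hAinv : ∀ n, (A n)⁻¹ = A (-n) := by
    intro n
    rw [inv_eq_iff_mul_eq_one, hAadd, add_neg_cancel, hA0]
  have hBinv : ∀ n, (B n)⁻¹ = B (-n) := by
    intro n
    rw [inv_eq_iff_mul_eq_one, hBadd, add_neg_cancel, hB0]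
  have hSU : S * U = A 1 := by
    apply Subtype.ext
    change !![0, -1; 1, 0] * !![0, 1; -1, -1] = !![1, 1; 0, 1]
    simp
  have hU3 : U ^ 3 = 1 := by
    rw [pow_succ, pow_two]
    apply Subtype.ext
    change !![0, 1; -1, -1] * !![0, 1; -1, -1] * !![0, 1; -1, -1] = 1
    simp [Matrix.one_fin_two]
  -- The matrix `S * U⁻¹` is `-B 1`; the sign disappears in the square, and only even powers occur
  -- in the claim.
  have hSU' : (S * U⁻¹) ^ 2 = B 2 := by
    have : U⁻¹ = U ^ 2 := by
      rw [inv_eq_iff_mul_eq_one, ← pow_succ', hU3]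
    rw [this, pow_two, pow_two]
    apply Subtype.ext
    change (!![0, -1; 1, 0] * (!![0, 1; -1, -1] * !![0, 1; -1, -1])) *
      (!![0, -1; 1, 0] * (!![0, 1; -1, -1] * !![0, 1; -1, -1])) = !![1, 0; 2, 1]
    simp
  have hS2 : S * S ∈ Subgroup.center (Matrix.SpecialLinearGroup (Fin 2) ℤ) := by
    rw [Matrix.SpecialLinearGroup.mem_center_iff]
    refine ⟨-1, by simp, ?_⟩
    change _ = !![0, -1; 1, 0] * !![0, -1; 1, 0]
    rw [Matrix.scalar_apply, Matrix.mul_fin_two]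
    ext i j
    fin_cases i <;> fin_cases j <;> rfl
  -- In SL₂(ℤ) one has `S * S = -1`, so the quotient by the centre is needed to make `S` an
  -- involution.
  let q : Matrix.SpecialLinearGroup (Fin 2) ℤ →* Matrix.SpecialLinearGroup (Fin 2) ℤ ⧸ Subgroup.center (Matrix.SpecialLinearGroup (Fin 2) ℤ) :=
    QuotientGroup.mk' _
  refine ⟨_, inferInstance, q U, q S, ?_, ?_, ?_⟩
  · rw [← map_pow, hU3, map_one]
  · rw [← map_mul]
    exact (QuotientGroup.eq_one_iff _).2 hS2
  intro n m hn hm h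
  have h1 : ((S * U) ^ n) ^ 2 = A (2 * n) := by
    rw [hSU, hApow, hApow]; congr 1; push_cast; ring
  have h2 : ((S * U⁻¹) ^ m) ^ 2 = B (2 * m) := by
    rw [← pow_mul, mul_comm, pow_mul, hSU', hBpow]; congr 1; ring
  simp only [← map_mul, ← map_inv, ← map_pow, h1, h2, commutatorElement_def, hAinv, hBinv] at h
  have h3 := (QuotientGroup.eq.1 h.eq.symm)
  obtain ⟨r, hr, hr'⟩ := Matrix.SpecialLinearGroup.mem_center_iff.1 h3
  refine commutator_entries_ne (n := 2 * n) (m := 2 * m) (r := r) (by positivity) (by positivity)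
    (by simpa using hr) (A := A (2 * n)) (A' := A (-(2 * n))) (B := B (2 * m))
    (B' := B (-(2 * m))) rfl rfl rfl rfl ?_
  have h4 : (!![r, 0; 0, r] : Matrix (Fin 2) (Fin 2) ℤ) = Matrix.scalar (Fin 2) r := by
    rw [Matrix.scalar_apply]
    ext i j
    fin_cases i <;> fin_cases j <;> rfl
  rw [h4, hr']
  simp only [← Matrix.SpecialLinearGroup.coe_mul]
  rw [mul_inv_cancel_left]

/-! ### The standard triangle without its vertices -/

/-- The standard triangle without its vertices. -/
abbrev IdealSimplex : Type := {x : Fin 3 → ℝ // x ∈ stdSimplex ℝ (Fin 3) ∧ ∀ k, x k ≠ 1}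

namespace IdealSimplex

theorem nonneg (x : IdealSimplex) (k : Fin 3) : 0 ≤ x.1 k := x.2.1.1 k

theorem sum_eq (x : IdealSimplex) (i : Fin 3) : x.1 i + x.1 (i + 1) + x.1 (i + 2) = 1 := by
  have h := x.2.1.2
  rw [Fin.sum_univ_three] at h
  fin_cases i
  · exact h
  · change x.1 1 + x.1 2 + x.1 0 = 1
    linarith
  · change x.1 2 + x.1 0 + x.1 1 = 1
    linarith

theorem lt_one (x : IdealSimplex) (k : Fin 3) : x.1 k < 1 :=
  lt_of_le_of_ne (by linarith [x.sum_eq k, x.nonneg (k + 1), x.nonneg (k + 2)]) (x.2.2 k)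

theorem eq_or_eq_or_eq (i k : Fin 3) : k = i ∨ k = i + 1 ∨ k = i + 2 := by
  revert i k; decide

theorem ext_of {x y : IdealSimplex} (i : Fin 3) (h1 : x.1 i = y.1 i)
    (h2 : x.1 (i + 1) = y.1 (i + 1)) : x = y := by
  apply Subtype.ext
  funext k
  rcases eq_or_eq_or_eq i k with rfl | rfl | rfl
  · exact h1
  · exact h2
  · linarith [x.sum_eq i, y.sum_eq i]

theorem convex_carrier :
    Convex ℝ {x : Fin 3 → ℝ | x ∈ stdSimplex ℝ (Fin 3) ∧ ∀ k, x k ≠ 1} := by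
  have h : {x : Fin 3 → ℝ | x ∈ stdSimplex ℝ (Fin 3) ∧ ∀ k, x k ≠ 1} =
      stdSimplex ℝ (Fin 3) ∩ ⋂ k, {x | x k < 1} := by
    ext x
    simp only [Set.mem_ofPred_eq, Set.mem_inter_iff, Set.mem_iInter]
    refine and_congr_right fun hx => forall_congr' fun k => ?_
    exact ⟨fun hk => lt_of_le_of_ne (mem_Icc_of_mem_stdSimplex hx k).2 hk, ne_of_lt⟩
  rw [h]
  refine (convex_stdSimplex ℝ (Fin 3)).inter (convex_iInter fun k => ?_)
  exact convex_halfSpace_lt (LinearMap.proj (R := ℝ) (φ := fun _ : Fin 3 => ℝ) k).isLinear 1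

/-- The point of the triangle with two given barycentric coordinates. -/
def mk' (i : Fin 3) (a b c : ℝ) (ha : 0 ≤ a) (hb : 0 ≤ b) (hc : 0 ≤ c) (h : a + b + c = 1)
    (ha' : a ≠ 1) (hb' : b ≠ 1) (hc' : c ≠ 1) : IdealSimplex :=
  ⟨fun k => if k = i then a else if k = i + 1 then b else c, by
    refine ⟨⟨fun k => ?_, ?_⟩, fun k => ?_⟩
    · dsimp only
      split_ifs <;> assumption
    · rw [Fin.sum_univ_three]
      fin_cases i <;> simp <;> linarith
    · dsimp only
      split_ifs <;> assumption⟩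

theorem mk'_apply_self {i : Fin 3} {a b c : ℝ} {ha hb hc h ha' hb' hc'} :
    (mk' i a b c ha hb hc h ha' hb' hc').1 i = a := by simp [mk']

theorem mk'_apply_one {i : Fin 3} {a b c : ℝ} {ha hb hc h ha' hb' hc'} :
    (mk' i a b c ha hb hc h ha' hb' hc').1 (i + 1) = b := by
  fin_cases i <;> simp [mk']

theorem mk'_apply_two {i : Fin 3} {a b c : ℝ} {ha hb hc h ha' hb' hc'} :
    (mk' i a b c ha hb hc h ha' hb' hc').1 (i + 2) = c := by
  fin_cases i <;> simp [mk']

/-- The barycenter. -/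
def center : IdealSimplex :=
  mk' 0 (1 / 3) (1 / 3) (1 / 3) (by norm_num) (by norm_num) (by norm_num) (by norm_num)
    (by norm_num) (by norm_num) (by norm_num)

/-- The midpoints of the sides. -/
def mid (i : Fin 3) : IdealSimplex :=
  mk' i 0 (1 / 2) (1 / 2) (by norm_num) (by norm_num) (by norm_num) (by norm_num)
    (by norm_num) (by norm_num) (by norm_num)

theorem mid_apply (i : Fin 3) : (mid i).1 i = 0 := mk'_apply_self

instance : ContractibleSpace IdealSimplex :=
  convex_carrier.contractibleSpace ⟨_, center.2⟩

theorem isPreconnected_of_convex {s : Set (Fin 3 → ℝ)} (hs : Convex ℝ s) :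
    IsPreconnected {x : IdealSimplex | x.1 ∈ s} := by
  have hind : IsInducing (Subtype.val : IdealSimplex → Fin 3 → ℝ) := IsInducing.subtypeVal
  rw [← hind.isPreconnected_image]
  have : Subtype.val '' {x : IdealSimplex | x.1 ∈ s} =
      {x : Fin 3 → ℝ | x ∈ stdSimplex ℝ (Fin 3) ∧ ∀ k, x k ≠ 1} ∩ s := by
    ext x
    constructor
    · rintro ⟨y, hy, rfl⟩
      exact ⟨y.2, hy⟩
    · rintro ⟨h1, h2⟩
      exact ⟨⟨x, h1⟩, h2, rfl⟩
  rw [this]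
  exact (convex_carrier.inter hs).isPreconnected

instance : LocallyPathConnectedSpace IdealSimplex := by
  refine LocallyPathConnectedSpace.of_bases
    (p := fun _ ε => 0 < ε) (s := fun x ε => Metric.ball x ε) (fun x => Metric.nhds_basis_ball) ?_
  intro x ε hε
  have himg : Subtype.val '' (Metric.ball x ε) =
      {x : Fin 3 → ℝ | x ∈ stdSimplex ℝ (Fin 3) ∧ ∀ k, x k ≠ 1} ∩ Metric.ball x.1 ε := by
    ext y
    constructor
    · rintro ⟨y, hy, rfl⟩
      exact ⟨y.2, hy⟩
    · rintro ⟨h1, h2⟩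
      exact ⟨⟨y, h1⟩, h2, rfl⟩
  have hind : IsInducing (Subtype.val : IdealSimplex → Fin 3 → ℝ) := IsInducing.subtypeVal
  rw [hind.isPathConnected_iff, himg]
  exact (convex_carrier.inter (convex_ball _ _)).isPathConnected
    ⟨x.1, x.2, Metric.mem_ball_self hε⟩

theorem continuous_apply' (k : Fin 3) : Continuous fun x : IdealSimplex => x.1 k :=
  (continuous_apply k).comp continuous_subtype_val

/-- The inclusion of the triangle without its vertices into the triangle. -/
def toSimplex (x : IdealSimplex) : stdSimplex ℝ (Fin 3) := ⟨x.1, x.2.1⟩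

theorem isOpenEmbedding_toSimplex : IsOpenEmbedding toSimplex := by
  have h1 : IsEmbedding toSimplex := by
    refine IsEmbedding.of_comp (by unfold toSimplex; fun_prop) continuous_subtype_val ?_
    exact IsEmbedding.subtypeVal
  refine ⟨h1, ?_⟩
  have : Set.range toSimplex = ⋂ k, {x : stdSimplex ℝ (Fin 3) | x.1 k ≠ 1} := by
    ext x
    simp only [Set.mem_range, Set.mem_iInter, Set.mem_ofPred_eq]
    constructor
    · rintro ⟨y, rfl⟩ k
      exact y.2.2 k
    · intro h
      exact ⟨⟨x.1, x.2, h⟩, rfl⟩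
  rw [this]
  refine isOpen_iInter_of_finite fun k => ?_
  exact isOpen_ne.preimage ((continuous_apply k).comp continuous_subtype_val)

/-- The map between triangles that sends the side `i` to the side `j`, exchanging its end
points. -/
def flip (i j : Fin 3) (x : IdealSimplex) : IdealSimplex :=
  -- The reflection `k ↦ i + j - k` of ℤ/3 sends `j` to `i`, `j + 1` to `i + 2` and `j + 2` to `i +
  -- 1`, as an orientation-reversing gluing requires.
  ⟨fun k => x.1 (i + j - k), by
    refine ⟨⟨fun k => x.nonneg _, ?_⟩, fun k => x.2.2 _⟩
    exact (Equiv.sum_comp (Equiv.subLeft (i + j)) x.1).trans x.2.1.2⟩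

theorem flip_self (i j : Fin 3) (x : IdealSimplex) : (flip i j x).1 j = x.1 i := by
  simp [flip]

theorem flip_one (i j : Fin 3) (x : IdealSimplex) : (flip i j x).1 (j + 1) = x.1 (i + 2) := by
  change x.1 (i + j - (j + 1)) = _
  have h : ∀ i j : Fin 3, i + j - (j + 1) = i + 2 := by decide
  rw [h]

theorem flip_two (i j : Fin 3) (x : IdealSimplex) : (flip i j x).1 (j + 2) = x.1 (i + 1) := by
  change x.1 (i + j - (j + 2)) = _
  have h : ∀ i j : Fin 3, i + j - (j + 2) = i + 1 := by decide
  rw [h]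

theorem flip_flip (i j : Fin 3) (x : IdealSimplex) : flip j i (flip i j x) = x := by
  apply ext_of i
  · rw [flip_self, flip_self]
  · rw [flip_one, flip_two]

theorem continuous_flip (i j : Fin 3) : Continuous (flip i j) := by
  refine Continuous.subtype_mk ?_ _
  exact continuous_pi fun k => continuous_apply' _

/-- The neighborhoods of the ideal vertices. -/
def nhdsVertex (k : Fin 3) : Filter IdealSimplex := comap (fun x => x.1 k) (𝓝 1)

theorem tendsto_nhdsVertex (k : Fin 3) :
    Tendsto (fun x : IdealSimplex => x.1) (nhdsVertex k) (𝓝 (Pi.single k 1)) := by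
  have h0 : Tendsto (fun x : IdealSimplex => x.1 k) (nhdsVertex k) (𝓝 1) := tendsto_comap
  have h0' : Tendsto (fun x : IdealSimplex => 1 - x.1 k) (nhdsVertex k) (𝓝 0) := by
    simpa using h0.const_sub 1
  rw [tendsto_pi_nhds]
  intro j
  rcases eq_or_eq_or_eq k j with rfl | rfl | rfl
  · simpa using h0
  · have : (Pi.single k 1 : Fin 3 → ℝ) (k + 1) = 0 := by
      apply Pi.single_eq_of_ne; clear * -; revert k; decide
    rw [this]
    exact squeeze_zero (fun x => x.nonneg _) (fun x => by linarith [x.sum_eq k, x.nonneg (k + 2)]) h0'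
  · have : (Pi.single k 1 : Fin 3 → ℝ) (k + 2) = 0 := by
      apply Pi.single_eq_of_ne; clear * -; revert k; decide
    rw [this]
    exact squeeze_zero (fun x => x.nonneg _) (fun x => by linarith [x.sum_eq k, x.nonneg (k + 1)]) h0'

theorem exists_mem_nhdsVertex {k : Fin 3} {s : Set IdealSimplex} (hs : s ∈ nhdsVertex k) :
    ∃ ε > 0, ∀ x : IdealSimplex, 1 - ε < x.1 k → x ∈ s := by
  obtain ⟨t, ht, hts⟩ := mem_comap.1 hs
  obtain ⟨ε, hε, hball⟩ := Metric.mem_nhds_iff.1 ht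
  refine ⟨ε, hε, fun x hx => hts (hball ?_)⟩
  rw [Metric.mem_ball, Real.dist_eq, abs_lt]
  constructor <;> linarith [x.lt_one k]

theorem lt_mem_nhdsVertex {k : Fin 3} {ε : ℝ} (hε : 0 < ε) :
    {x : IdealSimplex | 1 - ε < x.1 k} ∈ nhdsVertex k :=
  preimage_mem_comap (Ioi_mem_nhds (by linarith))

theorem exists_side_mem_nhdsVertex (k i : Fin 3) (hik : i ≠ k) {s : Set IdealSimplex}
    (hs : s ∈ nhdsVertex k) : ∃ x ∈ s, x.1 i = 0 := by
  obtain ⟨ε, hε, h⟩ := exists_mem_nhdsVertex hs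
  obtain ⟨δ, hδ0, hδ1, hδ⟩ : ∃ δ : ℝ, 0 < δ ∧ δ < 1 ∧ δ < ε :=
    ⟨min ε 1 / 2, by positivity, by linarith [min_le_right ε 1, lt_min hε one_pos],
      by linarith [min_le_left ε 1, lt_min hε one_pos]⟩
  rcases eq_or_eq_or_eq i k with rfl | rfl | rfl
  · exact absurd rfl hik
  · refine ⟨mk' i 0 (1 - δ) δ le_rfl (by linarith) hδ0.le (by ring) (by norm_num)
      (by linarith) (by linarith), h _ ?_, mk'_apply_self⟩
    rw [mk'_apply_one]; linarith
  · refine ⟨mk' i 0 δ (1 - δ) le_rfl hδ0.le (by linarith) (by ring) (by norm_num)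
      (by linarith) (by linarith), h _ ?_, mk'_apply_self⟩
    rw [mk'_apply_two]; linarith

/-! ### Shears along the sides -/

/-- The shear along the side `i`, multiplying the ratio of the two other coordinates by `τ`. -/
def shearFun (i : Fin 3) {τ : ℝ} (hτ : 0 < τ) (x : IdealSimplex) : IdealSimplex :=
  have h0 := x.nonneg i
  have h1 := x.nonneg (i + 1)
  have h2 := x.nonneg (i + 2)
  have h3 := x.sum_eq i
  have h4 := x.lt_one i
  have hd : 0 < τ * x.1 (i + 1) + x.1 (i + 2) := by
    rcases h1.eq_or_lt with h | h
    · rw [← h]; linarith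
    · positivity
  -- The coordinate `i` is kept, hence so is the sum of the other two; only the ratio of those
  -- changes.
  mk' i (x.1 i) ((x.1 (i + 1) + x.1 (i + 2)) * (τ * x.1 (i + 1)) / (τ * x.1 (i + 1) + x.1 (i + 2)))
    ((x.1 (i + 1) + x.1 (i + 2)) * x.1 (i + 2) / (τ * x.1 (i + 1) + x.1 (i + 2)))
    h0 (by positivity) (by positivity)
    (by
      have e : x.1 (i + 1) + x.1 (i + 2) = 1 - x.1 i := by linarith
      rw [add_assoc, ← add_div, ← mul_add, mul_div_assoc, div_self hd.ne', e]; ring) h4.ne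
    (fun h => by
      rw [div_eq_one_iff_eq hd.ne'] at h
      have h5 : x.1 (i + 2) = 0 := by
        have : 0 ≤ τ * x.1 (i + 1) := by positivity
        nlinarith
      have h6 : x.1 (i + 1) < 1 := x.lt_one _
      rw [h5] at h hd
      nlinarith)
    (fun h => by
      rw [div_eq_one_iff_eq hd.ne'] at h
      have h5 : x.1 (i + 1) = 0 := by
        have h6 : x.1 (i + 2) < 1 := x.lt_one _
        have : 0 ≤ τ * x.1 (i + 1) := by positivity
        have : τ * x.1 (i + 1) ≤ 0 := by nlinarith
        nlinarith
      have h6 : x.1 (i + 2) < 1 := x.lt_one _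
      rw [h5] at h hd
      nlinarith)

variable {i : Fin 3} {τ : ℝ} (hτ : 0 < τ) (x : IdealSimplex)

theorem shear_denom_pos {i : Fin 3} {τ : ℝ} (hτ : 0 < τ) (x : IdealSimplex) :
    0 < τ * x.1 (i + 1) + x.1 (i + 2) := by
  rcases (x.nonneg (i + 1)).eq_or_lt with h | h
  · rw [← h]; linarith [x.sum_eq i, x.lt_one i]
  · have := x.nonneg (i + 2)
    have := mul_pos hτ h
    linarith

theorem shearFun_self : (shearFun i hτ x).1 i = x.1 i := by
  rw [shearFun, mk'_apply_self]

theorem shearFun_one : (shearFun i hτ x).1 (i + 1) =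
    (x.1 (i + 1) + x.1 (i + 2)) * (τ * x.1 (i + 1)) / (τ * x.1 (i + 1) + x.1 (i + 2)) := by
  rw [shearFun, mk'_apply_one]

theorem shearFun_two : (shearFun i hτ x).1 (i + 2) =
    (x.1 (i + 1) + x.1 (i + 2)) * x.1 (i + 2) / (τ * x.1 (i + 1) + x.1 (i + 2)) := by
  rw [shearFun, mk'_apply_two]

theorem shearFun_ratio : (shearFun i hτ x).1 (i + 1) * x.1 (i + 2) =
    τ * x.1 (i + 1) * (shearFun i hτ x).1 (i + 2) := by
  rw [shearFun_one, shearFun_two]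
  ring

theorem shearFun_eq_zero_iff (k : Fin 3) : (shearFun i hτ x).1 k = 0 ↔ x.1 k = 0 := by
  have hd := shear_denom_pos (i := i) hτ x
  have hs : x.1 (i + 1) + x.1 (i + 2) ≠ 0 := by linarith [x.sum_eq i, x.lt_one i]
  rcases eq_or_eq_or_eq i k with rfl | rfl | rfl
  · rw [shearFun_self]
  · rw [shearFun_one]
    simp [hd.ne', hτ.ne', hs]
  · rw [shearFun_two]
    simp [hd.ne', hs]

theorem eq_of_ratio {y : IdealSimplex} (h0 : y.1 i = x.1 i)
    (h : y.1 (i + 1) * x.1 (i + 2) = x.1 (i + 1) * y.1 (i + 2)) : y = x := by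
  apply ext_of i h0
  have h1 := x.sum_eq i
  have h2 := y.sum_eq i
  have h3 := x.lt_one i
  have h4 : x.1 (i + 2) = 1 - x.1 i - x.1 (i + 1) := by linarith
  have h5 : y.1 (i + 2) = 1 - x.1 i - y.1 (i + 1) := by linarith
  rw [h4, h5] at h
  have h6 : (1 - x.1 i) * (y.1 (i + 1) - x.1 (i + 1)) = 0 := by linarith
  rcases mul_eq_zero.1 h6 with h7 | h7 <;> linarith

/-- On another side one of the two rescaled coordinates vanishes, so their ratio is zero or infinite
and cannot change. Thus the three sides can be corrected independently by composing shears. -/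
theorem shearFun_eq_of_side {k : Fin 3} (hk : k ≠ i) (hx : x.1 k = 0) : shearFun i hτ x = x := by
  refine eq_of_ratio (i := i) x (shearFun_self hτ x) ?_
  have h1 := (shearFun_eq_zero_iff hτ x k (i := i)).2 hx
  rcases eq_or_eq_or_eq i k with rfl | rfl | rfl
  · exact absurd rfl hk
  · rw [h1, hx]; ring
  · rw [h1, hx]; ring

theorem shearFun_shearFun {σ : ℝ} (hσ : 0 < σ) (h : σ * τ = 1) :
    shearFun i hσ (shearFun i hτ x) = x := by
  refine eq_of_ratio (i := i) x (by rw [shearFun_self, shearFun_self]) ?_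
  have h1 := shearFun_ratio (i := i) hτ x
  have h2 := shearFun_ratio (i := i) hσ (shearFun i hτ x)
  have h3 := (shearFun_eq_zero_iff hτ x (i + 2) (i := i))
  set y := shearFun i hτ x
  set z := shearFun i hσ y
  by_cases hy : y.1 (i + 2) = 0
  · have hz : z.1 (i + 2) = 0 := (shearFun_eq_zero_iff hσ y (i + 2) (i := i)).2 hy
    rw [hz, h3.1 hy]; ring
  · have h4 : (z.1 (i + 1) * x.1 (i + 2)) * y.1 (i + 2) =
        (x.1 (i + 1) * z.1 (i + 2)) * y.1 (i + 2) := by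
      linear_combination x.1 (i + 2) * h2 + σ * z.1 (i + 2) * h1 +
        z.1 (i + 2) * x.1 (i + 1) * y.1 (i + 2) * h
    exact mul_right_cancel₀ hy h4

theorem continuous_shearFun : Continuous (shearFun i hτ) := by
  refine Continuous.subtype_mk (continuous_pi fun k => ?_) _
  have h1 := continuous_apply' (i + 1)
  have h2 := continuous_apply' (i + 2)
  split_ifs
  · exact continuous_apply' _
  · exact ((h1.add h2).mul (continuous_const.mul h1)).div ((continuous_const.mul h1).add h2) fun x => (shear_denom_pos hτ x).ne'
  · exact ((h1.add h2).mul h2).div ((continuous_const.mul h1).add h2) fun x => (shear_denom_pos hτ x).ne'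

theorem tendsto_shearFun (k : Fin 3) :
    Tendsto (shearFun i hτ) (nhdsVertex k) (nhdsVertex k) := by
  have h := tendsto_pi_nhds.1 (tendsto_nhdsVertex k)
  refine tendsto_comap_iff.2 ?_
  have hk : ∀ j, j ≠ k → (Pi.single k 1 : Fin 3 → ℝ) j = 0 := fun j hj => Pi.single_eq_of_ne hj _
  rcases eq_or_eq_or_eq i k with rfl | rfl | rfl
  · refine (h k).congr' ?_ |>.trans_eq (by simp)
    exact Eventually.of_forall fun x => (shearFun_self hτ x).symm
  · have h1 := h (i + 1)
    have h2 := h (i + 2)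
    rw [Pi.single_eq_same] at h1
    rw [hk (i + 2) (by clear * -; revert i; decide)] at h2
    have h3 := ((h1.add h2).mul (h1.const_mul τ)).div ((h1.const_mul τ).add h2) (by simp [hτ.ne'])
    have e : ((1 : ℝ) + 0) * (τ * 1) / (τ * 1 + 0) = 1 := by field_simp; ring
    rw [e] at h3
    exact h3.congr fun x => (shearFun_one hτ x).symm
  · have h1 := h (i + 1)
    have h2 := h (i + 2)
    rw [Pi.single_eq_same] at h2
    rw [hk (i + 1) (by clear * -; revert i; decide)] at h1
    have h3 := ((h1.add h2).mul h2).div ((h1.const_mul τ).add h2) (by simp)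
    have e : ((0 : ℝ) + 1) * 1 / (τ * 0 + 1) = 1 := by norm_num
    rw [e] at h3
    exact h3.congr fun x => (shearFun_two hτ x).symm

/-- The shear along the side `i`, as a homeomorphism. -/
def shear (i : Fin 3) {τ : ℝ} (hτ : 0 < τ) : IdealSimplex ≃ₜ IdealSimplex where
  toFun := shearFun i hτ
  invFun := shearFun i (inv_pos.2 hτ)
  left_inv x := shearFun_shearFun hτ x (inv_pos.2 hτ) (inv_mul_cancel₀ hτ.ne')
  right_inv x := shearFun_shearFun (inv_pos.2 hτ) x hτ (mul_inv_cancel₀ hτ.ne')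
  continuous_toFun := continuous_shearFun hτ
  continuous_invFun := continuous_shearFun (inv_pos.2 hτ)

/-- The composition of shears along the three sides. -/
def shears {τ : Fin 3 → ℝ} (hτ : ∀ i, 0 < τ i) : IdealSimplex ≃ₜ IdealSimplex :=
  ((shear 0 (hτ 0)).trans (shear 1 (hτ 1))).trans (shear 2 (hτ 2))

theorem shears_apply {τ : Fin 3 → ℝ} (hτ : ∀ i, 0 < τ i) (x : IdealSimplex) :
    shears hτ x = shearFun 2 (hτ 2) (shearFun 1 (hτ 1) (shearFun 0 (hτ 0) x)) := rfl

theorem shears_eq_zero_iff {τ : Fin 3 → ℝ} (hτ : ∀ i, 0 < τ i) (x : IdealSimplex) (k : Fin 3) :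
    (shears hτ x).1 k = 0 ↔ x.1 k = 0 := by
  rw [shears_apply, shearFun_eq_zero_iff, shearFun_eq_zero_iff, shearFun_eq_zero_iff]

theorem shears_of_side {τ : Fin 3 → ℝ} (hτ : ∀ i, 0 < τ i) (x : IdealSimplex) {i : Fin 3}
    (hx : x.1 i = 0) : shears hτ x = shearFun i (hτ i) x := by
  have h := fun j : Fin 3 => (shearFun_eq_zero_iff (i := j) (hτ j) x i).2 hx
  rw [shears_apply]
  fin_cases i
  · rw [shearFun_eq_of_side (i := 1) (k := 0) (hτ 1) _ (by decide) (h 0),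
      shearFun_eq_of_side (i := 2) (k := 0) (hτ 2) _ (by decide) (h 0)]
    rfl
  · rw [shearFun_eq_of_side (i := 0) (k := 1) (hτ 0) _ (by decide) hx,
      shearFun_eq_of_side (i := 2) (k := 1) (hτ 2) _ (by decide) (h 1)]
    rfl
  · rw [shearFun_eq_of_side (i := 0) (k := 2) (hτ 0) _ (by decide) hx,
      shearFun_eq_of_side (i := 1) (k := 2) (hτ 1) _ (by decide) hx]
    rfl

theorem tendsto_shears {τ : Fin 3 → ℝ} (hτ : ∀ i, 0 < τ i) (k : Fin 3) :
    Tendsto (shears hτ) (nhdsVertex k) (nhdsVertex k) :=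
  (tendsto_shearFun (hτ 2) k).comp ((tendsto_shearFun (hτ 1) k).comp (tendsto_shearFun (hτ 0) k))

end IdealSimplex

/-! ### Parametrized ideal triangles -/

theorem mem_convexHull_range_iff (v : Fin 3 → E3) (z : E3) :
    z ∈ convexHull ℝ (Set.range v) ↔ ∃ w ∈ stdSimplex ℝ (Fin 3), ∑ k, w k • v k = z := by
  have h : Set.range v = Fintype.linearCombination ℝ v ''
      Set.range fun i : Fin 3 => Pi.single i (1 : ℝ) := by
    rw [← Set.range_comp]
    congr 1
    ext1 i
    simp [Fintype.linearCombination_apply_single]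
  rw [h, ← LinearMap.image_convexHull, convexHull_rangle_single_eq_stdSimplex]
  rfl

/-- A line meets a sphere in at most two points, so three distinct points at infinity are affinely
independent. -/
theorem eq_zero_of_boundary_combination {ξ : Fin 3 → Boundary} (hξ : Function.Injective ξ)
    {w : Fin 3 → ℝ} (h0 : ∑ k, w k = 0) (h1 : ∑ k, w k • (ξ k : E3) = 0) : w = 0 := by
  have hc : EuclideanGeometry.Cospherical (Metric.sphere (0 : E3) 1) :=
    ⟨0, 1, fun x hx => hx⟩
  have h := hc.affineIndependent (p := fun k => (ξ k : E3))
    (by rintro _ ⟨k, rfl⟩; exact (ξ k).2) (Subtype.val_injective.comp hξ)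
  funext k
  exact affineIndependent_iff.1 h Finset.univ w h0 h1 k (Finset.mem_univ k)

/-- The normalization factors of an ideal triangle. -/
def idealWeight (ξ : Fin 3 → Boundary) (k : Fin 3) : ℝ :=
  -mink (nullVec (ξ (k + 1))) (nullVec (ξ (k + 2)))

theorem idealWeight_pos {ξ : Fin 3 → Boundary} (hξ : Function.Injective ξ) (k : Fin 3) :
    0 < idealWeight ξ k := by
  have : ξ (k + 1) ≠ ξ (k + 2) := fun h => by
    have h' := hξ h
    clear * - h'
    revert k; decide
  unfold idealWeight
  linarith [mink_nullVec_neg this]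

/-- A timelike vector with given barycentric coordinates in an ideal triangle. -/
def idealVec (ξ : Fin 3 → Boundary) (y : IdealSimplex) : ℝ × E3 :=
  ∑ k, (y.1 k * idealWeight ξ k) • nullVec (ξ k)

theorem idealVec_fst (ξ : Fin 3 → Boundary) (y : IdealSimplex) :
    (idealVec ξ y).1 = ∑ k, y.1 k * idealWeight ξ k := by
  simp [idealVec, nullVec, Prod.fst_sum]

theorem idealVec_snd (ξ : Fin 3 → Boundary) (y : IdealSimplex) :
    (idealVec ξ y).2 = ∑ k, (y.1 k * idealWeight ξ k) • (ξ k : E3) := by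
  simp [idealVec, nullVec, Prod.snd_sum]

theorem sum_mul_pos {a d : Fin 3 → ℝ} (ha : a ∈ stdSimplex ℝ (Fin 3)) (hd : ∀ k, 0 < d k) :
    0 < ∑ k, a k * d k := by
  refine lt_of_le_of_ne (Finset.sum_nonneg fun k _ => mul_nonneg (ha.1 k) (hd k).le) fun h => ?_
  have h2 := (Finset.sum_eq_zero_iff_of_nonneg
    fun k _ => mul_nonneg (ha.1 k) (hd k).le).1 h.symm
  have h3 : ∀ k, a k = 0 := fun k => by simpa [(hd k).ne'] using h2 k (Finset.mem_univ k)
  simpa [h3] using ha.2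

/-- The diagonal terms vanish and the off-diagonal products are nonpositive. One of them is strictly
negative because, away from the vertices, at least two coordinates are positive. -/
theorem idealVec_timelike {ξ : Fin 3 → Boundary} (hξ : Function.Injective ξ) (y : IdealSimplex) :
    mink (idealVec ξ y) (idealVec ξ y) < 0 ∧ 0 < (idealVec ξ y).1 := by
  have hw := idealWeight_pos hξ
  constructor
  · have h01 := mink_nullVec_neg (hξ.ne (show (0 : Fin 3) ≠ 1 by decide))
    have h02 := mink_nullVec_neg (hξ.ne (show (0 : Fin 3) ≠ 2 by decide))
    have h12 := mink_nullVec_neg (hξ.ne (show (1 : Fin 3) ≠ 2 by decide))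
    simp only [idealVec, Fin.sum_univ_three, mink_add_left, mink_add_right, mink_smul_left,
      mink_smul_right, mink_nullVec_self, mink_comm (nullVec (ξ 1)) (nullVec (ξ 0)),
      mink_comm (nullVec (ξ 2)) (nullVec (ξ 0)), mink_comm (nullVec (ξ 2)) (nullVec (ξ 1))]
    have h0 := y.nonneg 0
    have h1 := y.nonneg 1
    have h2 := y.nonneg 2
    have hs : y.1 0 + y.1 1 + y.1 2 = 1 := y.sum_eq 0
    have e0 := y.lt_one 0
    have e1 := y.lt_one 1
    have e2 := y.lt_one 2
    have w0 := hw 0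
    have w1 := hw 1
    have w2 := hw 2
    generalize idealWeight ξ 0 = d0 at *
    generalize idealWeight ξ 1 = d1 at *
    generalize idealWeight ξ 2 = d2 at *
    generalize mink (nullVec (ξ 0)) (nullVec (ξ 1)) = m01 at *
    generalize mink (nullVec (ξ 0)) (nullVec (ξ 2)) = m02 at *
    generalize mink (nullVec (ξ 1)) (nullVec (ξ 2)) = m12 at *
    generalize y.1 0 = a at *
    generalize y.1 1 = b at *
    generalize y.1 2 = c at *
    have n01 : 0 ≤ (a * d0) * (b * d1) * (-m01) := by
      have : 0 ≤ -m01 := by linarith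
      positivity
    have n02 : 0 ≤ (a * d0) * (c * d2) * (-m02) := by
      have : 0 ≤ -m02 := by linarith
      positivity
    have n12 : 0 ≤ (b * d1) * (c * d2) * (-m12) := by
      have : 0 ≤ -m12 := by linarith
      positivity
    have hpos : 0 < (a * d0) * (b * d1) * (-m01) ∨ 0 < (a * d0) * (c * d2) * (-m02) ∨
        0 < (b * d1) * (c * d2) * (-m12) := by
      have p01 : 0 < -m01 := by linarith
      have p02 : 0 < -m02 := by linarith
      have p12 : 0 < -m12 := by linarith
      rcases h0.eq_or_lt with ha | ha
      · have : 0 < b := by linarith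
        have : 0 < c := by linarith
        right; right; positivity
      · rcases h1.eq_or_lt with hb | hb
        · have : 0 < c := by linarith
          right; left; positivity
        · left; positivity
    rcases hpos with h | h | h <;> linarith
  · rw [idealVec_fst]
    exact sum_mul_pos y.2.1 hw

/-- The parametrization of an ideal triangle with given ideal vertices. -/
def idealPoint {ξ : Fin 3 → Boundary} (hξ : Function.Injective ξ) (y : IdealSimplex) : H3 :=
  toH3 (idealVec ξ y) (idealVec_timelike hξ y)

theorem klein_idealPoint {ξ : Fin 3 → Boundary} (hξ : Function.Injective ξ) (y : IdealSimplex) :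
    klein (idealPoint hξ y) = (∑ k, y.1 k * idealWeight ξ k)⁻¹ •
      ∑ k, (y.1 k * idealWeight ξ k) • (ξ k : E3) := by
  rw [idealPoint, klein_toH3, idealVec_fst, idealVec_snd]

theorem continuous_idealPoint {ξ : Fin 3 → Boundary} (hξ : Function.Injective ξ) :
    Continuous (idealPoint hξ) := by
  have h1 : Continuous fun y : IdealSimplex => idealVec ξ y := by
    unfold idealVec
    exact continuous_finsetSum _ fun k _ =>
      ((IdealSimplex.continuous_apply' k).mul continuous_const).smul continuous_const
  have h2 : Continuous fun y : IdealSimplex => mink (idealVec ξ y) (idealVec ξ y) := by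
    simp only [mink]
    exact (h1.snd.inner h1.snd).sub (h1.fst.mul h1.fst)
  refine Continuous.subtype_mk (((Real.continuous_sqrt.comp h2.neg).inv₀ fun y => ?_).smul h1) _
  exact (Real.sqrt_pos.2 (neg_pos.2 (idealVec_timelike hξ y).1)).ne'

/-- The extension of the parametrization of an ideal triangle to the vertices, in the projective
model. -/
def closedIdeal (ξ : Fin 3 → Boundary) (w : stdSimplex ℝ (Fin 3)) : E3 :=
  (∑ k, w.1 k * idealWeight ξ k)⁻¹ • ∑ k, (w.1 k * idealWeight ξ k) • (ξ k : E3)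

theorem continuous_closedIdeal {ξ : Fin 3 → Boundary} (hξ : Function.Injective ξ) :
    Continuous (closedIdeal ξ) := by
  have h : ∀ k, Continuous fun w : stdSimplex ℝ (Fin 3) => w.1 k :=
    fun k => (continuous_apply k).comp continuous_subtype_val
  have h1 : Continuous fun w : stdSimplex ℝ (Fin 3) => ∑ k, w.1 k * idealWeight ξ k :=
    continuous_finsetSum _ fun k _ => (h k).mul continuous_const
  have h2 : Continuous fun w : stdSimplex ℝ (Fin 3) =>
      ∑ k, (w.1 k * idealWeight ξ k) • (ξ k : E3) :=
    continuous_finsetSum _ fun k _ => ((h k).mul continuous_const).smul continuous_const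
  exact (h1.inv₀ fun w => (sum_mul_pos w.2 (idealWeight_pos hξ)).ne').smul h2

theorem closedIdeal_injective {ξ : Fin 3 → Boundary} (hξ : Function.Injective ξ) :
    Function.Injective (closedIdeal ξ) := by
  intro a b hab
  have hd := idealWeight_pos hξ
  have ha := sum_mul_pos a.2 hd
  have hb := sum_mul_pos b.2 hd
  simp only [closedIdeal] at hab
  set A := ∑ k, a.1 k * idealWeight ξ k
  set B := ∑ k, b.1 k * idealWeight ξ k
  have hw := eq_zero_of_boundary_combination hξ
    (w := fun k => A⁻¹ * (a.1 k * idealWeight ξ k) - B⁻¹ * (b.1 k * idealWeight ξ k))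
    (by rw [Finset.sum_sub_distrib, ← Finset.mul_sum, ← Finset.mul_sum,
          inv_mul_cancel₀ ha.ne', inv_mul_cancel₀ hb.ne', sub_self])
    (by
      simp only [sub_smul, Finset.sum_sub_distrib]
      simp only [mul_smul A⁻¹, mul_smul B⁻¹, ← Finset.smul_sum]
      rw [hab, sub_self])
  have hk : ∀ k, A⁻¹ * a.1 k = B⁻¹ * b.1 k := by
    intro k
    have := congrFun hw k
    simp only [Pi.zero_apply] at this
    have h2 : (A⁻¹ * a.1 k - B⁻¹ * b.1 k) * idealWeight ξ k = 0 := by linarith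
    rcases mul_eq_zero.1 h2 with h3 | h3
    · linarith
    · exact absurd h3 (hd k).ne'
  have hAB : A⁻¹ = B⁻¹ := by
    have h1 : ∑ k, A⁻¹ * a.1 k = ∑ k, B⁻¹ * b.1 k := Finset.sum_congr rfl fun k _ => hk k
    rwa [← Finset.mul_sum, ← Finset.mul_sum, a.2.2, b.2.2, mul_one, mul_one] at h1
  apply Subtype.ext
  funext k
  have := hk k
  rw [hAB] at this
  exact mul_left_cancel₀ (inv_pos.2 hb).ne' this

/-- In the projective model the parametrization extends to the compact triangle, where a continuous
injection is automatically an embedding; the claim follows by restriction. -/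
theorem isEmbedding_idealPoint {ξ : Fin 3 → Boundary} (hξ : Function.Injective ξ) :
    IsEmbedding (idealPoint hξ) := by
  have h1 : klein ∘ idealPoint hξ = closedIdeal ξ ∘ IdealSimplex.toSimplex := by
    ext1 y
    exact klein_idealPoint hξ y
  refine IsEmbedding.of_comp (continuous_idealPoint hξ) continuous_klein ?_
  rw [h1]
  exact ((continuous_closedIdeal hξ).isClosedEmbedding (closedIdeal_injective hξ)).isEmbedding.comp
    IdealSimplex.isOpenEmbedding_toSimplex.isEmbedding

theorem tendsto_idealPoint {ξ : Fin 3 → Boundary} (hξ : Function.Injective ξ) (k : Fin 3) :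
    TendstoBoundary (idealPoint hξ) (IdealSimplex.nhdsVertex k) (ξ k) := by
  let v : stdSimplex ℝ (Fin 3) := ⟨Pi.single k 1, single_mem_stdSimplex ℝ k⟩
  have h1 : Tendsto IdealSimplex.toSimplex (IdealSimplex.nhdsVertex k) (𝓝 v) :=
    tendsto_subtype_rng.2 (IdealSimplex.tendsto_nhdsVertex k)
  have h2 := ((continuous_closedIdeal hξ).tendsto v).comp h1
  have h3 : closedIdeal ξ v = ξ k := by
    have hd := (idealWeight_pos hξ k).ne'
    simp only [closedIdeal, v, Pi.single_apply, ite_mul, one_mul, zero_mul, ite_smul, zero_smul,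
      Finset.sum_ite_eq', Finset.mem_univ, if_true, smul_smul, inv_mul_cancel₀ hd, one_smul]
  rw [h3] at h2
  refine h2.congr fun y => ?_
  exact (klein_idealPoint hξ y).symm

theorem norm_boundary (ξ : Boundary) : ‖(ξ : E3)‖ = 1 := by simp

/-- Dividing the barycentric coordinates by the weights and renormalizing inverts the
parametrization. The result is not a vertex, since `klein z` lies strictly inside the ball. -/
theorem exists_idealPoint_eq {ξ : Fin 3 → Boundary} (hξ : Function.Injective ξ) (z : H3)
    {w : Fin 3 → ℝ} (hw : w ∈ stdSimplex ℝ (Fin 3)) (hz : ∑ k, w k • (ξ k : E3) = klein z) :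
    ∃ y : IdealSimplex, idealPoint hξ y = z ∧ ∀ k, y.1 k = 0 ↔ w k = 0 := by
  have hd := idealWeight_pos hξ
  have hs := sum_mul_pos (d := fun k => (idealWeight ξ k)⁻¹) hw fun k => inv_pos.2 (hd k)
  have hw1 : ∀ k, w k ≠ 1 := by
    intro k hk
    have h0 : ∀ j, j ≠ k → w j = 0 := by
      intro j hj
      have h2 := hw.2
      rw [← Finset.add_sum_erase _ _ (Finset.mem_univ k), hk] at h2
      have h3 : ∑ x ∈ Finset.univ.erase k, w x = 0 := by linarith
      exact (Finset.sum_eq_zero_iff_of_nonneg fun x _ => hw.1 x).1 h3 j (by simp [hj])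
    have h4 : klein z = ξ k := by
      rw [← hz, Finset.sum_eq_single k (fun j _ hj => by rw [h0 j hj, zero_smul]) (by simp), hk,
        one_smul]
    have h5 := norm_klein_lt_one z
    rw [h4, norm_boundary] at h5
    exact lt_irrefl _ h5
  set s := ∑ k, w k * (idealWeight ξ k)⁻¹ with hsdef
  have hsum : ∑ k, s⁻¹ * (w k * (idealWeight ξ k)⁻¹) = 1 := by
    rw [← Finset.mul_sum, inv_mul_cancel₀ hs.ne']
  have hnn : ∀ k, 0 ≤ s⁻¹ * (w k * (idealWeight ξ k)⁻¹) := fun k => by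
    have := hw.1 k
    have := (hd k)
    positivity
  have hne : ∀ k, s⁻¹ * (w k * (idealWeight ξ k)⁻¹) = 0 ↔ w k = 0 := fun k => by
    simp [hs.ne', (hd k).ne']
  let y : IdealSimplex := ⟨fun k => s⁻¹ * (w k * (idealWeight ξ k)⁻¹), ⟨hnn, hsum⟩, by
    intro k hk
    apply hw1 k
    dsimp only at hk
    have h0 : ∀ j, j ≠ k → w j = 0 := by
      intro j hj
      have h2 := hsum
      rw [← Finset.add_sum_erase _ _ (Finset.mem_univ k), hk] at h2
      have h3 : ∑ x ∈ Finset.univ.erase k, s⁻¹ * (w x * (idealWeight ξ x)⁻¹) = 0 := by linarith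
      exact (hne j).1
        ((Finset.sum_eq_zero_iff_of_nonneg fun x _ => hnn x).1 h3 j (by simp [hj]))
    have := hw.2
    rwa [Finset.sum_eq_single k (fun j _ hj => h0 j hj) (by simp)] at this⟩
  refine ⟨y, ?_, hne⟩
  apply klein_injective
  have hyk : ∀ k, y.1 k * idealWeight ξ k = s⁻¹ * w k := fun k => by
    change s⁻¹ * (w k * (idealWeight ξ k)⁻¹) * idealWeight ξ k = _
    have := (hd k).ne'
    field_simp
  rw [klein_idealPoint, ← hz]
  simp only [hyk, ← Finset.mul_sum, hw.2, mul_smul, ← Finset.smul_sum, mul_one, inv_inv]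
  rw [smul_smul, mul_inv_cancel₀ hs.ne', one_smul]

theorem range_idealPoint {ξ : Fin 3 → Boundary} (hξ : Function.Injective ξ) :
    Set.range (idealPoint hξ) = klein ⁻¹' convexHull ℝ (Set.range fun k => (ξ k : E3)) := by
  ext z
  rw [Set.mem_preimage, mem_convexHull_range_iff]
  constructor
  · rintro ⟨y, rfl⟩
    have hs := sum_mul_pos y.2.1 (idealWeight_pos hξ)
    refine ⟨fun k => (∑ k, y.1 k * idealWeight ξ k)⁻¹ * (y.1 k * idealWeight ξ k),
      ⟨fun k => ?_, ?_⟩, ?_⟩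
    · have := y.nonneg k
      have := idealWeight_pos hξ k
      positivity
    · rw [← Finset.mul_sum, inv_mul_cancel₀ hs.ne']
    · rw [klein_idealPoint]
      simp only [mul_smul _ (_ * _), Finset.smul_sum]
  · rintro ⟨w, hw, hz⟩
    obtain ⟨y, hy, -⟩ := exists_idealPoint_eq hξ z hw hz
    exact ⟨y, hy⟩

theorem sum_eq_cyclic {M : Type*} [AddCommMonoid M] (f : Fin 3 → M) (i : Fin 3) :
    ∑ k, f k = f i + f (i + 1) + f (i + 2) := by
  rw [Fin.sum_univ_three]
  fin_cases i
  · rfl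
  · change f 0 + f 1 + f 2 = f 1 + f 2 + f 0
    abel
  · change f 0 + f 1 + f 2 = f 2 + f 0 + f 1
    abel

theorem idealPoint_image_side {ξ : Fin 3 → Boundary} (hξ : Function.Injective ξ) (i : Fin 3) :
    idealPoint hξ '' {y | y.1 i = 0} =
      klein ⁻¹' segment ℝ (ξ (i + 1) : E3) (ξ (i + 2) : E3) := by
  ext z
  constructor
  · rintro ⟨y, hy, rfl⟩
    have hs := sum_mul_pos y.2.1 (idealWeight_pos hξ)
    have hy0 : y.1 i = 0 := hy
    rw [Set.mem_preimage, klein_idealPoint]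
    rw [sum_eq_cyclic _ i, hy0, zero_mul, zero_add] at hs ⊢
    rw [sum_eq_cyclic _ i, hy0, zero_mul, zero_smul, zero_add, smul_add, smul_smul, smul_smul]
    have h1 := y.nonneg (i + 1)
    have h2 := y.nonneg (i + 2)
    have h3 := idealWeight_pos hξ (i + 1)
    have h4 := idealWeight_pos hξ (i + 2)
    refine ⟨_, _, by positivity, by positivity, ?_, rfl⟩
    rw [← mul_add, inv_mul_cancel₀ hs.ne']
  · rintro ⟨a, b, ha, hb, hab, hz⟩
    have h12 : i + 1 ≠ i ∧ i + 2 ≠ i ∧ i + 2 ≠ i + 1 := by clear * -; revert i; decide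
    obtain ⟨y, hy, hy0⟩ := exists_idealPoint_eq hξ z
      (w := fun k => if k = i then 0 else if k = i + 1 then a else b)
      ⟨fun k => by dsimp only; split_ifs <;> simp [ha, hb], by
        rw [sum_eq_cyclic _ i]; simp [h12, hab]⟩
      (by rw [sum_eq_cyclic _ i]; simpa [h12] using hz)
    exact ⟨y, (hy0 i).2 (by simp), hy⟩

/-- Adjacent ideal triangles match along their common side when the shears do. -/
theorem idealPoint_eq_of_side {ξ η : Fin 3 → Boundary} (hξ : Function.Injective ξ)
    (hη : Function.Injective η) {i j : Fin 3} (h1 : ξ (i + 1) = η (j + 2))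
    (h2 : ξ (i + 2) = η (j + 1)) {x y : IdealSimplex} (hx : x.1 i = 0) (hy : y.1 j = 0)
    (h : (x.1 (i + 1) * idealWeight ξ (i + 1)) * (y.1 (j + 1) * idealWeight η (j + 1)) =
      (x.1 (i + 2) * idealWeight ξ (i + 2)) * (y.1 (j + 2) * idealWeight η (j + 2))) :
    idealPoint hξ x = idealPoint hη y := by
  apply klein_injective
  have hX := sum_mul_pos x.2.1 (idealWeight_pos hξ)
  have hY := sum_mul_pos y.2.1 (idealWeight_pos hη)
  rw [klein_idealPoint, klein_idealPoint]
  rw [sum_eq_cyclic _ i, hx, zero_mul, zero_add] at hX ⊢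
  rw [sum_eq_cyclic _ i, hx, zero_mul, zero_smul, zero_add]
  rw [sum_eq_cyclic _ j, hy, zero_mul, zero_add] at hY ⊢
  rw [sum_eq_cyclic _ j, hy, zero_mul, zero_smul, zero_add, h1, h2]
  generalize x.1 (i + 1) * idealWeight ξ (i + 1) = a at *
  generalize x.1 (i + 2) * idealWeight ξ (i + 2) = b at *
  generalize y.1 (j + 1) * idealWeight η (j + 1) = c at *
  generalize y.1 (j + 2) * idealWeight η (j + 2) = d at *
  simp only [smul_add, smul_smul]
  rw [add_comm]
  congr 2
  · field_simp
    linear_combination -h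
  · field_simp
    linear_combination h

/-- If the null vectors are rescaled by `μ k`, the weight `k` contributes the other two factors, so
every term of `idealVec` acquires the same factor `μ 0 * μ 1 * μ 2`, which projection forgets. This
naturality is what dictates `idealWeight`. -/
theorem apply_idealPoint {g : IsomPlus} {ξ η : Fin 3 → Boundary} (hξ : Function.Injective ξ)
    (hη : Function.Injective η) (h : ∀ k, BoundaryMaps g.1 (ξ k) (η k)) (y : IdealSimplex) :
    g.1 (idealPoint hξ y) = idealPoint hη y := by
  obtain ⟨L, hL, hLg⟩ := exists_linearEquiv_of_isomPlus g
  choose μ hμ0 hμ using fun k => exists_smul_nullVec hL hLg (h k)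
  have hw : ∀ k, idealWeight ξ k = μ (k + 1) * μ (k + 2) * idealWeight η k := by
    intro k
    unfold idealWeight
    rw [← hL, hμ, hμ, mink_smul_left, mink_smul_right]
    ring
  have hv : L (idealVec ξ y) = (μ 0 * μ 1 * μ 2) • idealVec η y := by
    simp only [idealVec, map_sum, map_smul, hμ, Finset.smul_sum, smul_smul, hw]
    refine Finset.sum_congr rfl fun k _ => ?_
    congr 1
    fin_cases k
    · change y.1 0 * (μ 1 * μ 2 * idealWeight η 0) * μ 0 = _ * (y.1 0 * idealWeight η 0)
      ring
    · change y.1 1 * (μ 2 * μ 0 * idealWeight η 1) * μ 1 = _ * (y.1 1 * idealWeight η 1)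
      ring
    · change y.1 2 * (μ 0 * μ 1 * idealWeight η 2) * μ 2 = _ * (y.1 2 * idealWeight η 2)
      ring
  have hc : μ 0 * μ 1 * μ 2 ≠ 0 := by
    have := hμ0 0
    have := hμ0 1
    have := hμ0 2
    positivity
  rw [idealPoint, apply_toH3 hL hLg]
  apply klein_injective
  rw [klein_toH3, idealPoint, klein_toH3, hv]
  simp only [Prod.smul_fst, Prod.smul_snd, smul_eq_mul, smul_smul]
  congr 1
  rw [mul_inv, mul_right_comm, inv_mul_cancel₀ hc, one_mul]

/-- The shear parameter along the common side of two ideal triangles. -/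
def shearRatio (ξ η : Fin 3 → Boundary) (i j : Fin 3) : ℝ :=
  √(idealWeight ξ (i + 2) * idealWeight η (j + 2) /
    (idealWeight ξ (i + 1) * idealWeight η (j + 1)))

theorem shearRatio_pos {ξ η : Fin 3 → Boundary} (hξ : Function.Injective ξ)
    (hη : Function.Injective η) (i j : Fin 3) : 0 < shearRatio ξ η i j := by
  have := idealWeight_pos hξ
  have := idealWeight_pos hη
  unfold shearRatio
  refine Real.sqrt_pos.2 (div_pos (mul_pos ?_ ?_) (mul_pos ?_ ?_)) <;> simp [*]

/-- The square root is symmetric in the two triangles, so each side contributes the same factor and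
the product is the full correction across the edge. -/
theorem shearRatio_mul {ξ η : Fin 3 → Boundary} (hξ : Function.Injective ξ)
    (hη : Function.Injective η) (i j : Fin 3) :
    shearRatio ξ η i j * shearRatio η ξ j i * (idealWeight ξ (i + 1) * idealWeight η (j + 1)) =
      idealWeight ξ (i + 2) * idealWeight η (j + 2) := by
  have h1 := idealWeight_pos hξ (i + 1)
  have h2 := idealWeight_pos hξ (i + 2)
  have h3 := idealWeight_pos hη (j + 1)
  have h4 := idealWeight_pos hη (j + 2)
  unfold shearRatio
  rw [mul_comm (idealWeight η (j + 2)), mul_comm (idealWeight η (j + 1)),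
    Real.mul_self_sqrt (by positivity)]
  field_simp

/-- Under the root stands an expression of cross-ratio type in four lightlike vectors. An isometry
rescales these vectors, with the same factors at the shared ends for both triangles, and all factors
cancel. -/
theorem shearRatio_map {g : IsomPlus} {ξ η ξ' η' : Fin 3 → Boundary} {i j : Fin 3}
    (h1 : ξ (i + 1) = η (j + 2)) (h2 : ξ (i + 2) = η (j + 1))
    (h1' : ξ' (i + 1) = η' (j + 2)) (h2' : ξ' (i + 2) = η' (j + 1))
    (h : ∀ k, BoundaryMaps g.1 (ξ k) (ξ' k)) (h' : ∀ k, BoundaryMaps g.1 (η k) (η' k)) :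
    shearRatio ξ η i j = shearRatio ξ' η' i j := by
  obtain ⟨L, hL, hLg⟩ := exists_linearEquiv_of_isomPlus g
  choose μ hμ0 hμ using fun k => exists_smul_nullVec hL hLg (h k)
  choose ν hν0 hν using fun k => exists_smul_nullVec hL hLg (h' k)
  have hw : ∀ k, idealWeight ξ k = μ (k + 1) * μ (k + 2) * idealWeight ξ' k := by
    intro k
    unfold idealWeight
    rw [← hL, hμ, hμ, mink_smul_left, mink_smul_right]
    ring
  have hw' : ∀ k, idealWeight η k = ν (k + 1) * ν (k + 2) * idealWeight η' k := by
    intro k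
    unfold idealWeight
    rw [← hL, hν, hν, mink_smul_left, mink_smul_right]
    ring
  have e1 : μ (i + 1) = ν (j + 2) := by
    have a := hμ (i + 1)
    rw [h1, hν, ← h1'] at a
    simpa [nullVec] using (congrArg Prod.fst a).symm
  have e2 : μ (i + 2) = ν (j + 1) := by
    have a := hμ (i + 2)
    rw [h2, hν, ← h2'] at a
    simpa [nullVec] using (congrArg Prod.fst a).symm
  have c1 : ∀ i : Fin 3, i + 1 + 1 = i + 2 ∧ i + 1 + 2 = i ∧ i + 2 + 1 = i ∧ i + 2 + 2 = i + 1 := by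
    decide
  unfold shearRatio
  rw [hw, hw, hw', hw']
  simp only [c1, e1, e2]
  congr 1
  have := (hμ0 i).ne'
  have := (hν0 j).ne'
  have := (hν0 (j + 1)).ne'
  have := (hν0 (j + 2)).ne'
  field_simp

/-! ### The lifted triangulation -/

section Lifts

open IdealSimplex

variable {Sbar : Type u} [TopologicalSpace Sbar] {V : Set Sbar}

/-- The parametrization of a face, without its vertices. -/
def IdealTriangulation.faceMap (lam : IdealTriangulation V) (f : lam.Face) (x : IdealSimplex) :
    Sbar := lam.param f x.toSimplex

namespace IdealTriangulation

variable (lam : IdealTriangulation V)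

theorem faceMap_notMem (f : lam.Face) (x : IdealSimplex) : lam.faceMap f x ∉ V := by
  intro h
  obtain ⟨k, hk⟩ := (lam.param_mem_iff f _).1 h
  exact x.2.2 k hk

theorem continuous_faceMap (f : lam.Face) : Continuous (lam.faceMap f) :=
  (lam.continuous_param f).comp isOpenEmbedding_toSimplex.continuous

theorem faceMap_eq_iff (f g : lam.Face) (x y : IdealSimplex) :
    lam.faceMap f x = lam.faceMap g y ↔ (f = g ∧ x = y) ∨
      ∃ i j, lam.pair (f, i) = (g, j) ∧ x.1 i = 0 ∧ y = flip i j x := by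
  refine (lam.param_eq_iff f _ g _ (lam.faceMap_notMem f x)).trans ?_
  refine or_congr (and_congr_right fun _ => isOpenEmbedding_toSimplex.injective.eq_iff)
    (exists_congr fun i => exists_congr fun j => and_congr_right fun _ => and_congr_right fun h => ?_)
  replace h : x.1 i = 0 := h
  change (y.1 j = 0 ∧ x.1 (i + 1) = y.1 (j + 2) ∧ x.1 (i + 2) = y.1 (j + 1)) ↔ _
  constructor
  · rintro ⟨h1, -, h3⟩
    exact ext_of j (by rw [h1, flip_self, h]) (by rw [flip_one, h3])
  · rintro rfl
    exact ⟨by rw [flip_self, h], (flip_two i j x).symm, (flip_one i j x).symm⟩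

theorem exists_faceMap_eq {s : Sbar} (hs : s ∉ V) : ∃ f x, lam.faceMap f x = s := by
  obtain ⟨f, x, rfl⟩ := lam.surjective_param s
  exact ⟨f, ⟨x.1, x.2, fun k hk => hs ((lam.param_mem_iff f x).2 ⟨k, hk⟩)⟩, rfl⟩

/-- A finite union of continuous images of compact triangles maps closedly to a Hausdorff space, so
the surface carries the quotient topology of its faces. -/
theorem isOpen_of_preimage [T2Space Sbar] {W : Set Sbar}
    (h : ∀ f, IsOpen (lam.param f ⁻¹' W)) : IsOpen W := by
  have := lam.finite_face
  have hW : Wᶜ = ⋃ f, lam.param f '' (lam.param f ⁻¹' W)ᶜ := by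
    ext s
    simp only [Set.mem_iUnion, Set.mem_image, Set.mem_compl_iff, Set.mem_preimage]
    constructor
    · intro hs
      obtain ⟨f, x, rfl⟩ := lam.surjective_param s
      exact ⟨f, x, hs, rfl⟩
    · rintro ⟨f, x, hx, rfl⟩
      exact hx
  rw [← isClosed_compl_iff, hW]
  exact isClosed_iUnion_of_finite fun f =>
    ((h f).isClosed_compl.isCompact.image (lam.continuous_param f)).isClosed

end IdealTriangulation

variable {E : Type w} [TopologicalSpace E]

/-- The lifts of the faces of an ideal triangulation to a covering. -/
structure Tri (p : E → ↥(Vᶜ)) (lam : IdealTriangulation V) where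
  /-- The face of the triangulation. -/
  face : lam.Face
  /-- The lift of its parametrization. -/
  map : C(IdealSimplex, E)
  lift : ∀ x, (p (map x) : Sbar) = lam.faceMap face x

variable {p : E → ↥(Vᶜ)} {lam : IdealTriangulation V}

namespace Tri

theorem ext_of_apply (hp : IsCoveringMap p) {t s : Tri p lam} (hf : t.face = s.face)
    (x : IdealSimplex) (h : t.map x = s.map x) : t = s := by
  obtain ⟨f, m, hm⟩ := t
  obtain ⟨g, n, hn⟩ := s
  obtain rfl : f = g := hf
  have : m = n := by
    ext1 y
    refine congrFun (hp.eq_of_comp_eq m.continuous n.continuous ?_ x h) y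
    ext z
    exact (hm z).trans (hn z).symm
  subst this
  rfl

/-- The triangle without vertices is contractible and locally path connected, so its parametrization
lifts with any prescribed starting point. -/
theorem exists_of_lift (hp : IsCoveringMap p) (f : lam.Face) (x : IdealSimplex) (e : E)
    (h : (p e : Sbar) = lam.faceMap f x) : ∃ t : Tri p lam, t.face = f ∧ t.map x = e := by
  obtain ⟨F, ⟨hF, hpF⟩, -⟩ := hp.existsUnique_continuousMap_lifts
    ⟨fun x => (⟨lam.faceMap f x, lam.faceMap_notMem f x⟩ : ↥(Vᶜ)),
      (lam.continuous_faceMap f).subtype_mk _⟩ x e (Subtype.ext h)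
  exact ⟨⟨f, F, fun y => congrArg Subtype.val (congrFun hpF y)⟩, rfl, hF⟩

theorem exists_map_eq (hp : IsCoveringMap p) (lam : IdealTriangulation V) (e : E) :
    ∃ (t : Tri p lam) (x : IdealSimplex), t.map x = e := by
  obtain ⟨f, x, hx⟩ := lam.exists_faceMap_eq (p e).2
  obtain ⟨t, -, ht⟩ := exists_of_lift hp f x e hx.symm
  exact ⟨t, x, ht⟩

/-- The position of the side `i` of a triangle in the adjacent triangle. -/
def idx (t : Tri p lam) (i : Fin 3) : Fin 3 := (lam.pair (t.face, i)).2

theorem exists_nbr (hp : IsCoveringMap p) (t : Tri p lam) (i : Fin 3) :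
    ∃ s : Tri p lam, s.face = (lam.pair (t.face, i)).1 ∧
      s.map (flip i (t.idx i) (mid i)) = t.map (mid i) := by
  refine exists_of_lift hp _ _ _ ?_
  rw [t.lift, lam.faceMap_eq_iff]
  exact Or.inr ⟨i, _, rfl, mid_apply i, rfl⟩

/-- The triangle adjacent along the side `i`. -/
def nbr (hp : IsCoveringMap p) (t : Tri p lam) (i : Fin 3) : Tri p lam := (exists_nbr hp t i).choose

theorem face_nbr (hp : IsCoveringMap p) (t : Tri p lam) (i : Fin 3) :
    (t.nbr hp i).face = (lam.pair (t.face, i)).1 := (exists_nbr hp t i).choose_spec.1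

theorem pair_nbr (hp : IsCoveringMap p) (t : Tri p lam) (i : Fin 3) :
    lam.pair ((t.nbr hp i).face, t.idx i) = (t.face, i) := by
  rw [face_nbr]
  exact lam.pair_pair _

theorem idx_nbr (hp : IsCoveringMap p) (t : Tri p lam) (i : Fin 3) :
    (t.nbr hp i).idx (t.idx i) = i := by
  rw [idx, pair_nbr]

theorem isPreconnected_side (i : Fin 3) : IsPreconnected {x : IdealSimplex | x.1 i = 0} :=
  isPreconnected_of_convex (s := {x | x i = 0})
    (convex_hyperplane (LinearMap.proj (R := ℝ) (φ := fun _ : Fin 3 => ℝ) i).isLinear 0)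

/-- The neighbour was fixed by its value at the midpoint only; both maps lift the same map on the
connected side, so they agree along all of it. -/
theorem nbr_map (hp : IsCoveringMap p) (t : Tri p lam) {i : Fin 3} {x : IdealSimplex}
    (hx : x.1 i = 0) : (t.nbr hp i).map (flip i (t.idx i) x) = t.map x := by
  refine hp.eqOn_of_comp_eqOn (isPreconnected_side i)
    ((t.nbr hp i).map.continuous.comp (continuous_flip _ _)).continuousOn t.map.continuous.continuousOn
    ?_ (mid_apply i) (exists_nbr hp t i).choose_spec.2 hx
  intro y hy
  apply Subtype.ext
  simp only [Function.comp_apply]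
  rw [(t.nbr hp i).lift, t.lift, eq_comm, lam.faceMap_eq_iff, face_nbr]
  exact Or.inr ⟨i, _, rfl, hy, rfl⟩

theorem nbr_nbr (hp : IsCoveringMap p) (t : Tri p lam) (i : Fin 3) :
    (t.nbr hp i).nbr hp (t.idx i) = t := by
  refine ext_of_apply hp ?_ (mid i) ?_
  · rw [face_nbr, pair_nbr]
  · have h1 := nbr_map hp (t.nbr hp i) (i := t.idx i) (x := flip i (t.idx i) (mid i))
      (by rw [flip_self, mid_apply])
    rw [idx_nbr, IdealSimplex.flip_flip] at h1
    rw [h1, nbr_map hp t (mid_apply i)]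

/-- The gluing relation of the surface lifts, because a lifted triangle is determined by its face
and a single value. This presents `E` as triangles glued along their sides. -/
theorem map_eq_iff (hp : IsCoveringMap p) (t s : Tri p lam) (x y : IdealSimplex) :
    t.map x = s.map y ↔ (t = s ∧ x = y) ∨
      ∃ i, x.1 i = 0 ∧ s = t.nbr hp i ∧ y = flip i (t.idx i) x := by
  constructor
  · intro h
    have h1 := congrArg (fun e => (p e : Sbar)) h
    simp only [t.lift, s.lift] at h1
    rcases (lam.faceMap_eq_iff _ _ _ _).1 h1 with ⟨hf, rfl⟩ | ⟨i, j, hij, hx, rfl⟩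
    · exact Or.inl ⟨ext_of_apply hp hf x h, rfl⟩
    · have hj : t.idx i = j := by rw [idx, hij]
      refine Or.inr ⟨i, hx, ?_, by rw [hj]⟩
      refine ext_of_apply hp ?_ (flip i j x) ?_
      · rw [face_nbr, hij]
      · rw [← h, ← nbr_map hp t hx, hj]
  · rintro (⟨rfl, rfl⟩ | ⟨i, hx, rfl, rfl⟩)
    · rfl
    · exact (nbr_map hp t hx).symm

/-- The pairing has no fixed point. This keeps the two halves of `LocalSol.side` disjoint without
excluding that a triangle is its own neighbour. -/
theorem nbr_ne (hp : IsCoveringMap p) (t : Tri p lam) {i : Fin 3} (h : t.nbr hp i = t) :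
    t.idx i ≠ i := by
  intro h2
  have h1 := t.pair_nbr hp i
  rw [h, h2] at h1
  exact lam.pair_ne _ h1

/-- The topology of the covering is determined by the triangles. -/
theorem isOpen_iff [T2Space Sbar] (hp : IsCoveringMap p) (lam : IdealTriangulation V) {O : Set E} :
    IsOpen O ↔ ∀ t : Tri p lam, IsOpen (t.map ⁻¹' O) := by
  refine ⟨fun h t => h.preimage t.map.continuous, fun h => ?_⟩
  rw [isOpen_iff_mem_nhds]
  intro e he
  obtain ⟨φ, heφ, hφ⟩ := hp.isLocalHomeomorph e
  have hφ' : ∀ a, φ a = p a := fun a => by rw [hφ]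
  -- Push the part of `O` in one local sheet down to the surface, where openness can be tested on
  -- the closed faces.
  let W : Set Sbar := Subtype.val '' {s | s ∈ φ.target ∧ φ.symm s ∈ O}
  have hW : IsOpen W := by
    refine lam.isOpen_of_preimage fun f => ?_
    rw [isOpen_iff_mem_nhds]
    rintro x ⟨s, ⟨hs1, hs2⟩, hsx⟩
    have hxV : lam.param f x ∉ V := hsx ▸ s.2
    let y : IdealSimplex := ⟨x.1, x.2, fun k hk => hxV ((lam.param_mem_iff f x).2 ⟨k, hk⟩)⟩
    have hps : p (φ.symm s) = s := by rw [← hφ', φ.right_inv hs1]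
    obtain ⟨t, rfl, ht⟩ := exists_of_lift (lam := lam) hp f y (φ.symm s) (by rw [hps, hsx]; rfl)
    have hopen : IsOpen (toSimplex '' (t.map ⁻¹' O ∩ t.map ⁻¹' φ.source)) :=
      isOpenEmbedding_toSimplex.isOpenMap _
        ((h t).inter (φ.open_source.preimage t.map.continuous))
    refine mem_of_superset (hopen.mem_nhds ⟨y, ⟨?_, ?_⟩, rfl⟩) ?_
    · rw [Set.mem_preimage, ht]; exact hs2
    · rw [Set.mem_preimage, ht]; exact φ.map_target hs1
    · rintro _ ⟨z, ⟨hz1, hz2⟩, rfl⟩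
      have hz3 : φ (t.map z) ∈ φ.target := φ.map_source hz2
      refine ⟨φ (t.map z), ⟨hz3, ?_⟩, ?_⟩
      · rw [φ.left_inv hz2]; exact hz1
      · rw [hφ', t.lift]; rfl
  have hO : φ.source ∩ (fun a => (p a : Sbar)) ⁻¹' W ⊆ O := by
    rintro a ⟨ha, s, ⟨hs1, hs2⟩, hsa⟩
    have : s = φ a := by rw [hφ']; exact Subtype.ext hsa
    rw [this, φ.left_inv ha] at hs2
    exact hs2
  refine mem_of_superset (IsOpen.mem_nhds
    (φ.open_source.inter (hW.preimage (continuous_subtype_val.comp hp.continuous))) ⟨heφ, ?_⟩) hO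
  refine ⟨φ e, ⟨φ.map_source heφ, ?_⟩, by rw [hφ']; rfl⟩
  rw [φ.left_inv heφ]; exact he

theorem isClosed_iff [T2Space Sbar] (hp : IsCoveringMap p) (lam : IdealTriangulation V) {O : Set E} :
    IsClosed O ↔ ∀ t : Tri p lam, IsClosed (t.map ⁻¹' O) := by
  simp only [← isOpen_compl_iff, isOpen_iff hp lam, Set.preimage_compl]

theorem continuous_iff [T2Space Sbar] (hp : IsCoveringMap p) (lam : IdealTriangulation V)
    {Y : Type*} [TopologicalSpace Y] {f : E → Y} :
    Continuous f ↔ ∀ t : Tri p lam, Continuous fun x => f (t.map x) := by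
  refine ⟨fun h t => h.comp t.map.continuous, fun h => ?_⟩
  rw [continuous_def]
  intro O hO
  rw [isOpen_iff hp lam]
  exact fun t => hO.preimage (h t)

/-- A function that is constant on adjacent triangles is constant. -/
theorem eq_of_nbr_eq [T2Space Sbar] [PreconnectedSpace E] (hp : IsCoveringMap p) {α : Type*}
    {k : Tri p lam → α} (hk : ∀ t i, k (t.nbr hp i) = k t) (t s : Tri p lam) : k t = k s := by
  let F : E → α := fun e => k (exists_map_eq hp lam e).choose
  have hF : ∀ (t : Tri p lam) x, F (t.map x) = k t := by
    intro t x
    obtain ⟨y, hy⟩ := (exists_map_eq hp lam (t.map x)).choose_spec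
    rcases (map_eq_iff hp _ _ _ _).1 hy.symm with ⟨h, -⟩ | ⟨i, -, h, -⟩
    · exact congrArg k h.symm
    · exact (congrArg k h).trans (hk _ _)
  let _ : TopologicalSpace α := ⊥
  have : DiscreteTopology α := ⟨rfl⟩
  have hc : Continuous F := by
    rw [continuous_iff hp lam]
    intro t
    simp only [hF]
    exact continuous_const
  rw [← hF t center, ← hF s center]
  exact PreconnectedSpace.constant inferInstance hc

/-- The action of the deck transformations on the triangles. -/
def smul (γ : Deck p) (t : Tri p lam) : Tri p lam where
  face := t.face
  map := ⟨fun x => γ.1 (t.map x), γ.1.continuous.comp t.map.continuous⟩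
  lift x := by
    have := γ.2 (t.map x)
    rw [ContinuousMap.coe_mk, this, t.lift]

theorem smul_map (γ : Deck p) (t : Tri p lam) (x : IdealSimplex) :
    (t.smul γ).map x = γ.1 (t.map x) := rfl

theorem smul_mul (γ δ : Deck p) (t : Tri p lam) : t.smul (γ * δ) = (t.smul δ).smul γ := rfl

theorem smul_nbr (hp : IsCoveringMap p) (γ : Deck p) (t : Tri p lam) (i : Fin 3) :
    (t.smul γ).nbr hp i = (t.nbr hp i).smul γ := by
  refine ext_of_apply hp ?_ (flip i (t.idx i) (mid i)) ?_
  · rw [face_nbr]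
    exact (face_nbr hp t i).symm
  · rw [smul_map, nbr_map hp t (mid_apply i)]
    exact nbr_map hp (t.smul γ) (mid_apply i)

/-- The universal covering is normal: lifts of `p` through itself in the two directions are mutually
inverse by uniqueness. Hence the triangles over one face form a single orbit. -/
theorem exists_smul_eq [SimplyConnectedSpace E] [LocallyPathConnectedSpace E]
    (hp : IsCoveringMap p) (t s : Tri p lam) (h : t.face = s.face) :
    ∃ γ : Deck p, t.smul γ = s := by
  have key : ∀ e e' : E, p e' = p e → ∃ F : C(E, E), F e = e' ∧ ∀ a, p (F a) = p a := by
    intro e e' he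
    obtain ⟨F, ⟨hF, hpF⟩, -⟩ := hp.existsUnique_continuousMap_lifts ⟨p, hp.continuous⟩ e e' he
    exact ⟨F, hF, fun a => congrFun hpF a⟩
  have hts : p (t.map center) = p (s.map center) := by
    apply Subtype.ext
    rw [t.lift, s.lift, h]
  obtain ⟨F, hF, hpF⟩ := key (t.map center) (s.map center) hts.symm
  obtain ⟨G, hG, hpG⟩ := key (s.map center) (t.map center) hts
  have hGF : ∀ a, G (F a) = a := by
    refine congrFun (hp.eq_of_comp_eq (G.continuous.comp F.continuous) continuous_id ?_
      (t.map center) ?_)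
    · ext a; simp [hpG, hpF]
    · simp [hF, hG]
  have hFG : ∀ a, F (G a) = a := by
    refine congrFun (hp.eq_of_comp_eq (F.continuous.comp G.continuous) continuous_id ?_
      (s.map center) ?_)
    · ext a; simp [hpG, hpF]
    · simp [hF, hG]
  exact ⟨⟨⟨⟨F, G, hGF, hFG⟩, F.continuous, G.continuous⟩, hpF⟩, ext_of_apply hp h center hF⟩

end Tri

end Lifts

theorem locallyPathConnectedSpace_of_isLocalHomeomorph {X Y : Type*} [TopologicalSpace X]
    [TopologicalSpace Y] [LocallyPathConnectedSpace Y] {f : X → Y} (hf : IsLocalHomeomorph f) :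
    LocallyPathConnectedSpace X := by
  let _ : ChartedSpace Y X :=
    { atlas := Set.univ
      chartAt := fun x => (hf x).choose
      mem_chart_source := fun x => (hf x).choose_spec.1
      chart_mem_atlas := fun _ => trivial }
  exact ChartedSpace.locallyPathConnectedSpace Y X

/-! ### Cocycles on simply connected spaces -/

/-- Locally constant cocycles on a simply connected space are trivial. -/
theorem exists_of_cocycle {B ι Γ : Type*} [TopologicalSpace B] [SimplyConnectedSpace B]
    [LocallyPathConnectedSpace B] [Group Γ] [TopologicalSpace Γ] [DiscreteTopology Γ]
    {U : ι → Set B} (hU : ∀ i, IsOpen (U i)) (hcover : ∀ x, ∃ i, x ∈ U i) {c : ι → ι → B → Γ}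
    (hself : ∀ i, ∀ x ∈ U i, c i i x = 1)
    (hcont : ∀ i j, ContinuousOn (c i j) (U i ∩ U j))
    (hcomp : ∀ i j k, ∀ x ∈ U i ∩ U j ∩ U k, c i j x * c j k x = c i k x) :
    ∃ s : ι → B → Γ, (∀ i, ContinuousOn (s i) (U i)) ∧
      ∀ i j, ∀ x ∈ U i ∩ U j, s j x = s i x * c i j x := by
  choose ind hind using hcover
  -- The cocycle glues copies of the discrete group `Γ` into a principal bundle. It is a covering of
  -- `B`, so it has a global section, whose local coordinates are the required `s i`.
  let Z : FiberBundleCore ι B Γ :=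
    { baseSet := U
      isOpen_baseSet := hU
      indexAt := ind
      mem_baseSet_at := hind
      coordChange := fun i j x v => v * c i j x
      coordChange_self := fun i x hx v => by rw [hself i x hx, mul_one]
      continuousOn_coordChange := fun i j => by
        refine continuousOn_snd.mul ?_
        exact (hcont i j).comp continuousOn_fst fun q hq => hq.1
      coordChange_comp := fun i j k x hx v => by rw [mul_assoc, hcomp i j k x hx] }
  have hcov : IsCoveringMap Z.proj := FiberBundle.isCoveringMap (F := Γ) (E := Z.Fiber)
  obtain ⟨b⟩ : Nonempty B := inferInstance
  obtain ⟨F, ⟨-, hF⟩, -⟩ := hcov.existsUnique_continuousMap_lifts (ContinuousMap.id B) b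
    (⟨b, (1 : Γ)⟩ : Z.TotalSpace) rfl
  have hF' : ∀ x, (F x).1 = x := fun x => congrFun hF x
  refine ⟨fun i x => (Z.localTriv i (F x)).2, fun i => ?_, fun i j x hx => ?_⟩
  · refine continuous_snd.comp_continuousOn ?_
    refine (Z.localTriv i).continuousOn.comp F.continuous.continuousOn fun x hx => ?_
    rw [Z.mem_localTriv_source, ← Z.baseSet_at, hF']
    exact hx
  · have key : ∀ v : Γ, v * c (ind (F x).1) j (F x).1 = v * c (ind (F x).1) i (F x).1 * c i j x := by
      intro v
      rw [mul_assoc, hF', hcomp _ i j x ⟨⟨hind x, hx.1⟩, hx.2⟩]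
    exact key (F x).2

/-! ### Cocycle equations on the lifted triangles and their monodromy -/

section Lifts

open IdealSimplex

variable {Sbar : Type u} [TopologicalSpace Sbar] {V : Set Sbar} {E : Type w} [TopologicalSpace E]
  {p : E → ↥(Vᶜ)} {lam : IdealTriangulation V}

namespace Tri

/-- Local solutions of the cocycle equation on the triangles of a covering. -/
structure LocalSol (hp : IsCoveringMap p) {Γ : Type*} [Group Γ] (c : lam.Face → Fin 3 → Γ) where
  /-- The domain, in the coordinates of the triangles. -/
  dom : Tri p lam → Set IdealSimplex
  /-- The solution. -/
  val : Tri p lam → IdealSimplex → Γ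
  isOpen_dom : ∀ t, IsOpen (dom t)
  flip_mem : ∀ t i x, x.1 i = 0 → x ∈ dom t → flip i (t.idx i) x ∈ dom (t.nbr hp i)
  val_flip : ∀ t i x, x.1 i = 0 → x ∈ dom t →
    val (t.nbr hp i) (flip i (t.idx i) x) = val t x * c t.face i
  eventually_eq : ∀ t, ∀ x ∈ dom t, ∀ᶠ y in 𝓝 x, val t y = val t x

namespace LocalSol

variable {hp : IsCoveringMap p} {Γ : Type*} [Group Γ] {c : lam.Face → Fin 3 → Γ}

/-- The domain of a local solution. -/
def carrier (l : LocalSol hp c) : Set E := {e | ∃ t : Tri p lam, ∃ x ∈ l.dom t, t.map x = e}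

theorem map_mem_carrier (l : LocalSol hp c) (t : Tri p lam) (x : IdealSimplex) :
    t.map x ∈ l.carrier ↔ x ∈ l.dom t := by
  refine ⟨?_, fun h => ⟨t, x, h, rfl⟩⟩
  rintro ⟨s, y, hy, h⟩
  rcases (map_eq_iff hp _ _ _ _).1 h with ⟨rfl, rfl⟩ | ⟨i, hi, rfl, rfl⟩
  · exact hy
  · exact l.flip_mem _ _ _ hi hy

theorem isOpen_carrier [T2Space Sbar] (l : LocalSol hp c) : IsOpen l.carrier := by
  rw [isOpen_iff hp lam]
  intro t
  have : t.map ⁻¹' l.carrier = l.dom t := Set.ext fun x => l.map_mem_carrier t x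
  rw [this]
  exact l.isOpen_dom t

/-- The solution near an interior point of a triangle. -/
def interior (hp : IsCoveringMap p) (c : lam.Face → Fin 3 → Γ) : LocalSol hp c where
  dom _ := {x | ∀ k, x.1 k ≠ 0}
  val _ _ := 1
  isOpen_dom t := by
    simp only [Set.ofPred_forall]
    exact isOpen_iInter_of_finite fun k => isOpen_ne_fun (continuous_apply' k) continuous_const
  flip_mem t i x h hx := absurd h (hx i)
  val_flip t i x h hx := absurd h (hx i)
  eventually_eq _ _ _ := Eventually.of_forall fun _ => rfl

/-- A neighborhood of the side `i`. -/
def sideNhd (i : Fin 3) : Set IdealSimplex := {x | x.1 i < x.1 (i + 1) ∧ x.1 i < x.1 (i + 2)}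

theorem isOpen_sideNhd (i : Fin 3) : IsOpen (sideNhd i) :=
  (isOpen_lt (continuous_apply' _) (continuous_apply' _)).inter
    (isOpen_lt (continuous_apply' _) (continuous_apply' _))

theorem eq_of_mem_sideNhd {i k : Fin 3} {x : IdealSimplex} (hx : x ∈ sideNhd i)
    (hk : x.1 k = 0) : k = i := by
  have h0 := x.nonneg i
  rcases eq_or_eq_or_eq i k with h | rfl | rfl
  · exact h
  · exact absurd hx.1 (by rw [hk]; exact h0.not_gt)
  · exact absurd hx.2 (by rw [hk]; exact h0.not_gt)

theorem eq_of_mem_sideNhd_of_mem {i j : Fin 3} {x : IdealSimplex} (hi : x ∈ sideNhd i)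
    (hj : x ∈ sideNhd j) : i = j := by
  have hlt : ∀ {a b : Fin 3}, x ∈ sideNhd a → b ≠ a → x.1 a < x.1 b := by
    intro a b ha hab
    rcases eq_or_eq_or_eq a b with h | rfl | rfl
    · exact absurd h hab
    · exact ha.1
    · exact ha.2
  by_contra hij
  exact (hlt hi (Ne.symm hij)).not_gt (hlt hj hij)

theorem flip_mem_sideNhd {i j : Fin 3} {x : IdealSimplex} (hx : x ∈ sideNhd i) :
    flip i j x ∈ sideNhd j := by
  refine ⟨?_, ?_⟩
  · rw [flip_self, flip_one]; exact hx.2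
  · rw [flip_self, flip_two]; exact hx.1

theorem mem_sideNhd_of_apply_eq_zero {i : Fin 3} {x : IdealSimplex} (hx : x.1 i = 0) :
    x ∈ sideNhd i := by
  have h := x.sum_eq i
  have h1 := x.lt_one (i + 1)
  have h2 := x.lt_one (i + 2)
  constructor <;> linarith

open Classical in
/-- The solution near a point of a side. -/
def side (hp : IsCoveringMap p) {c : lam.Face → Fin 3 → Γ}
    (hc : ∀ f i, c (lam.pair (f, i)).1 (lam.pair (f, i)).2 = (c f i)⁻¹)
    (t : Tri p lam) (i : Fin 3) : LocalSol hp c where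
  dom q := {y | (q = t ∧ y ∈ sideNhd i) ∨ (q = t.nbr hp i ∧ y ∈ sideNhd (t.idx i))}
  val q y := if q = t ∧ y ∈ sideNhd i then 1 else c t.face i
  isOpen_dom q := by
    refine IsOpen.union ?_ ?_
    · by_cases h : q = t
      · simp only [h, true_and]; exact isOpen_sideNhd i
      · simp only [h, false_and]; exact isOpen_empty
    · by_cases h : q = t.nbr hp i
      · simp only [h, true_and]; exact isOpen_sideNhd (t.idx i)
      · simp only [h, false_and]; exact isOpen_empty
  flip_mem q k x hx h := by
    rcases h with ⟨rfl, h⟩ | ⟨rfl, h⟩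
    · obtain rfl := eq_of_mem_sideNhd h hx
      exact Or.inr ⟨rfl, flip_mem_sideNhd h⟩
    · obtain rfl := eq_of_mem_sideNhd h hx
      refine Or.inl ⟨nbr_nbr hp t i, ?_⟩
      rw [idx_nbr]
      exact flip_mem_sideNhd h
  val_flip q k x hx h := by
    have hdisj : ∀ z, z ∈ sideNhd (t.idx i) → ¬ (t.nbr hp i = t ∧ z ∈ sideNhd i) :=
      fun z hz h => nbr_ne hp t h.1 (eq_of_mem_sideNhd_of_mem hz h.2)
    rcases h with ⟨rfl, h⟩ | ⟨rfl, h⟩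
    · obtain rfl := eq_of_mem_sideNhd h hx
      rw [if_neg (hdisj _ (flip_mem_sideNhd h)), if_pos ⟨rfl, h⟩, one_mul]
    · obtain rfl := eq_of_mem_sideNhd h hx
      have h1 := hc t.face i
      rw [← face_nbr hp] at h1
      change c _ (t.idx i) = _ at h1
      have h2 := flip_mem_sideNhd (j := i) h
      rw [← idx_nbr hp t i] at h2
      rw [if_neg (hdisj _ h), if_pos ⟨nbr_nbr hp t i, by simpa only [idx_nbr] using h2⟩, h1,
        mul_inv_cancel]
  eventually_eq q x h := by
    have hdisj : ∀ z, z ∈ sideNhd (t.idx i) → ¬ (t.nbr hp i = t ∧ z ∈ sideNhd i) :=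
      fun z hz h => nbr_ne hp t h.1 (eq_of_mem_sideNhd_of_mem hz h.2)
    rcases h with ⟨rfl, h⟩ | ⟨rfl, h⟩
    · filter_upwards [(isOpen_sideNhd i).mem_nhds h] with y hy
      rw [if_pos ⟨rfl, hy⟩, if_pos ⟨rfl, h⟩]
    · filter_upwards [(isOpen_sideNhd _).mem_nhds h] with y hy
      rw [if_neg (hdisj _ h), if_neg (hdisj _ hy)]

theorem exists_mem_carrier (hc : ∀ f i, c (lam.pair (f, i)).1 (lam.pair (f, i)).2 = (c f i)⁻¹)
    (e : E) : ∃ l : LocalSol hp c, e ∈ l.carrier := by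
  obtain ⟨t, x, rfl⟩ := exists_map_eq hp lam e
  by_cases h : ∀ k, x.1 k ≠ 0
  · exact ⟨interior hp c, (map_mem_carrier _ _ _).2 h⟩
  · push Not at h
    obtain ⟨i, hi⟩ := h
    exact ⟨side hp hc t i, (map_mem_carrier _ _ _).2
      (Or.inl ⟨rfl, mem_sideNhd_of_apply_eq_zero hi⟩)⟩

/-- The ratio of two local solutions only depends on the point of the covering. -/
theorem val_mul_inv_val (l m : LocalSol hp c) {t s : Tri p lam} {x y : IdealSimplex}
    (h : t.map x = s.map y) (hl : x ∈ l.dom t) (hm : x ∈ m.dom t) :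
    l.val s y * (m.val s y)⁻¹ = l.val t x * (m.val t x)⁻¹ := by
  rcases (map_eq_iff hp _ _ _ _).1 h with ⟨rfl, rfl⟩ | ⟨i, hi, rfl, rfl⟩
  · rfl
  · rw [l.val_flip _ _ _ hi hl, m.val_flip _ _ _ hi hm]
    group

end LocalSol

/-- Local solutions exist, constant inside a triangle and jumping by `c` across a side. The jump
acts on the right, so two of them differ by a left factor that is a locally constant function on
`E`. These factors form a cocycle, which `exists_of_cocycle` trivializes, and the corrected local
solutions agree. The inverse condition on `c` makes crossing a side back and forth consistent. -/
theorem exists_nbr_eq_mul [T2Space Sbar] [SimplyConnectedSpace E] [LocallyPathConnectedSpace E]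
    (hp : IsCoveringMap p) {Γ : Type*} [Group Γ] {c : lam.Face → Fin 3 → Γ}
    (hc : ∀ f i, c (lam.pair (f, i)).1 (lam.pair (f, i)).2 = (c f i)⁻¹) :
    ∃ h : Tri p lam → Γ, ∀ t i, h (t.nbr hp i) = h t * c t.face i := by
  let _ : TopologicalSpace Γ := ⊥
  have : DiscreteTopology Γ := ⟨rfl⟩
  choose tri pos hpos using exists_map_eq hp lam
  let d : LocalSol hp c → LocalSol hp c → E → Γ := fun l m e =>
    l.val (tri e) (pos e) * (m.val (tri e) (pos e))⁻¹
  have hd : ∀ l m : LocalSol hp c, ∀ t x, x ∈ l.dom t → x ∈ m.dom t →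
      d l m (t.map x) = l.val t x * (m.val t x)⁻¹ := fun l m t x hl hm =>
    l.val_mul_inv_val m (hpos (t.map x)).symm hl hm
  obtain ⟨s, hs, hsd⟩ := exists_of_cocycle (U := fun l : LocalSol hp c => l.carrier) (c := d)
    (fun l => l.isOpen_carrier) (LocalSol.exists_mem_carrier hc)
    (fun l x _ => mul_inv_cancel _)
    (fun l m => by
      rw [continuousOn_open_iff (l.isOpen_carrier.inter m.isOpen_carrier)]
      intro O _
      rw [isOpen_iff hp lam]
      intro t
      rw [isOpen_iff_mem_nhds]
      rintro x ⟨⟨hl, hm⟩, hx⟩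
      rw [LocalSol.map_mem_carrier] at hl hm
      rw [Set.mem_preimage, hd l m t x hl hm] at hx
      filter_upwards [(l.isOpen_dom t).mem_nhds hl, (m.isOpen_dom t).mem_nhds hm,
        l.eventually_eq t x hl, m.eventually_eq t x hm] with y hyl hym h1 h2
      refine ⟨⟨(l.map_mem_carrier _ _).2 hyl, (m.map_mem_carrier _ _).2 hym⟩, ?_⟩
      rw [Set.mem_preimage, hd l m t y hyl hym, h1, h2]
      exact hx)
    (fun l m k x _ => by simp only [d]; group)
  choose loc hloc using LocalSol.exists_mem_carrier (hp := hp) hc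
  let F : Tri p lam → IdealSimplex → Γ := fun t x => s (loc (t.map x)) (t.map x) *
    (loc (t.map x)).val t x
  have hF : ∀ (l : LocalSol hp c) t x, x ∈ l.dom t → F t x = s l (t.map x) * l.val t x := by
    intro l t x hl
    have hm := hloc (t.map x)
    have h1 := hsd (loc (t.map x)) l (t.map x) ⟨hm, (l.map_mem_carrier _ _).2 hl⟩
    rw [LocalSol.map_mem_carrier] at hm
    rw [h1, hd _ _ t x hm hl]
    simp only [F]
    group
  have hFc : ∀ t, Continuous (F t) := by
    intro t
    rw [continuous_iff_continuousAt]
    intro x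
    have hl := hloc (t.map x)
    set l := loc (t.map x)
    have h1 : ContinuousAt (fun y => s l (t.map y)) x :=
      ((hs l).continuousAt (l.isOpen_carrier.mem_nhds hl)).comp t.map.continuous.continuousAt
    rw [LocalSol.map_mem_carrier] at hl
    have h2 : ContinuousAt (fun y => s l (t.map y) * l.val t x) x := h1.mul continuousAt_const
    refine h2.congr ?_
    filter_upwards [(l.isOpen_dom t).mem_nhds hl, l.eventually_eq t x hl] with y hy h3
    rw [hF l t y hy, h3]
  have hconst : ∀ t x y, F t x = F t y := fun t x y =>
    PreconnectedSpace.constant inferInstance (hFc t)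
  refine ⟨fun t => F t center, fun t i => ?_⟩
  have hl := hloc (t.map (mid i))
  set l := loc (t.map (mid i))
  rw [LocalSol.map_mem_carrier] at hl
  have hl' := l.flip_mem t i _ (mid_apply i) hl
  change F _ center = F t center * _
  rw [hconst _ _ (flip i (t.idx i) (mid i)), hF l _ _ hl', hconst t _ (mid i), hF l _ _ hl,
    nbr_map hp t (mid_apply i), l.val_flip _ _ _ (mid_apply i) hl, mul_assoc]

/-- The solutions of a cocycle equation on the triangles are equivariant. -/
theorem exists_monodromy [T2Space Sbar] [PreconnectedSpace E] (hp : IsCoveringMap p) [Nonempty (Tri p lam)]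
    {Γ : Type*} [Group Γ] {c : lam.Face → Fin 3 → Γ} {h : Tri p lam → Γ}
    (hh : ∀ t i, h (t.nbr hp i) = h t * c t.face i) :
    ∃ φ : Deck p →* Γ, ∀ γ t, h (t.smul γ) = φ γ * h t := by
  obtain ⟨t₀⟩ : Nonempty (Tri p lam) := inferInstance
  -- Since `γ` preserves faces and adjacency, `h (t.smul γ) * (h t)⁻¹` does not change when passing
  -- to a neighbour, and is therefore independent of `t`.
  have key : ∀ γ (t : Tri p lam), h (t.smul γ) = h (t₀.smul γ) * (h t₀)⁻¹ * h t := by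
    intro γ t
    have h1 := eq_of_nbr_eq hp (k := fun t : Tri p lam => h (t.smul γ) * (h t)⁻¹) (by
      intro t i
      rw [← smul_nbr, hh, hh]
      change h (t.smul γ) * c t.face i * _ = _
      group) t t₀
    rw [← h1]
    group
  refine ⟨MonoidHom.mk' (fun γ => h (t₀.smul γ) * (h t₀)⁻¹) fun γ δ => ?_, key⟩
  rw [smul_mul, key γ (t₀.smul δ)]
  group

end Tri

end Lifts

section Lifts

open IdealSimplex

variable {Sbar : Type u} [TopologicalSpace Sbar] {V : Set Sbar} {E : Type w} [TopologicalSpace E]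
  {p : E → ↥(Vᶜ)} {lam : IdealTriangulation V}

/-! ### Deck transformations rotating around the vertices of a triangle -/

/-- Crossing a side and then turning permutes the finite set of faces with a marked side, so some
positive power is the identity. -/
theorem exists_iterate_pair_eq (lam : IdealTriangulation V) (d : Fin 3) (a : lam.Face × Fin 3) :
    ∃ n > 0, (fun b => ((lam.pair b).1, (lam.pair b).2 + d))^[n] a = a := by
  have := lam.finite_face
  let σ : Equiv.Perm (lam.Face × Fin 3) :=
    (Function.Involutive.toPerm lam.pair lam.pair_pair).trans
      ((Equiv.refl _).prodCongr (Equiv.addRight d))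
  refine ⟨orderOf σ, orderOf_pos σ, ?_⟩
  have h : (fun b => ((lam.pair b).1, (lam.pair b).2 + d)) = σ := rfl
  rw [h, Equiv.Perm.iterate_eq_pow, pow_orderOf_eq_one]
  rfl

namespace Tri

/-- The flag adjacent to a triangle with a distinguished side, turned by `d`. -/
def rot (hp : IsCoveringMap p) (d : Fin 3) (a : Tri p lam × Fin 3) : Tri p lam × Fin 3 :=
  (a.1.nbr hp a.2, a.1.idx a.2 + d)

/-- Below, turning returns to the initial flag; above, it ends at a triangle over the same face,
which a deck transformation identifies with the initial one. For `d = 1` or `2` this is an element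
going around a vertex. -/
theorem exists_iterate_rot [SimplyConnectedSpace E] [LocallyPathConnectedSpace E]
    (hp : IsCoveringMap p) (d : Fin 3) (t : Tri p lam) (i : Fin 3) :
    ∃ n > 0, ∃ γ : Deck p, (rot hp d)^[n] (t, i) = (t.smul γ, i) := by
  obtain ⟨n, hn, h⟩ := exists_iterate_pair_eq lam d (t.face, i)
  have hs : Function.Semiconj (fun a : Tri p lam × Fin 3 => (a.1.face, a.2)) (rot hp d)
      (fun b => ((lam.pair b).1, (lam.pair b).2 + d)) := by
    intro a
    simp only [rot, face_nbr, idx]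
  have h1 := (hs.iterate_right n) (t, i)
  rw [h] at h1
  obtain ⟨γ, hγ⟩ := exists_smul_eq hp t ((rot hp d)^[n] (t, i)).1 (congrArg Prod.fst h1).symm
  exact ⟨n, hn, γ, Prod.ext hγ.symm (congrArg (fun b : lam.Face × Fin 3 => b.2) h1)⟩

/-- Deck transformations fixing the first and the second end of a side, which are in general
position. -/
theorem exists_rotations [T2Space Sbar] [SimplyConnectedSpace E] [LocallyPathConnectedSpace E]
    (hp : IsCoveringMap p) (t : Tri p lam) (i : Fin 3) {α : Type*} {K : Tri p lam → Fin 3 → α}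
    (h1 : ∀ t i, K (t.nbr hp i) (t.idx i + 2) = K t (i + 1))
    (h2 : ∀ t i, K (t.nbr hp i) (t.idx i + 1) = K t (i + 2)) :
    ∃ a b : Deck p, K (t.smul a) (i + 1) = K t (i + 1) ∧ K (t.smul b) (i + 2) = K t (i + 2) ∧
      ¬ Commute ⁅a ^ 2, b ^ 2⁆ (a ^ 2 * ⁅a ^ 2, b ^ 2⁆ * (a ^ 2)⁻¹) := by
  obtain ⟨Γ, _, U, S, hU, hS, hcomm⟩ := exists_modularGroup
  -- Development onto the Farey tessellation: move the side `i` to the reference side, cross it by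
  -- `S`, and undo the marking in the adjacent triangle.
  let c : lam.Face → Fin 3 → Γ := fun f i => U ^ i.1 * S * (U ^ (lam.pair (f, i)).2.1)⁻¹
  have hSinv : S⁻¹ = S := inv_eq_of_mul_eq_one_left hS
  obtain ⟨h, hh⟩ := exists_nbr_eq_mul hp (c := c) (by
    intro f i
    simp only [c, Prod.mk.eta, lam.pair_pair, mul_inv_rev, inv_inv, hSinv, mul_assoc])
  have : Nonempty (Tri p lam) := ⟨t⟩
  obtain ⟨φ, hφ⟩ := exists_monodromy hp hh
  have hUadd : ∀ j d : Fin 3, U ^ (j + d).1 = U ^ j.1 * U ^ d.1 := by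
    intro j d
    rw [Fin.val_add, ← pow_add, ← pow_mod_orderOf, Nat.mod_mod_of_dvd _ (orderOf_dvd_of_pow_eq_one hU),
      pow_mod_orderOf]
  -- The position of a triangle with a marked side. A step of `rot` multiplies it on the right by `S
  -- * U ^ d`, whatever the triangle.
  let H : Tri p lam × Fin 3 → Γ := fun a => h a.1 * U ^ a.2.1
  have hH : ∀ d n a, H ((rot hp d)^[n] a) = H a * (S * U ^ d.1) ^ n := by
    intro d n a
    induction n generalizing a with
    | zero => simp
    | succ n ih =>
      rw [Function.iterate_succ_apply, ih, pow_succ', ← mul_assoc]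
      congr 1
      simp only [H, rot, hh, c, hUadd]
      change h a.1 * (_ * _ * (U ^ (a.1.idx a.2).1)⁻¹) * _ = _
      group
  have hφH : ∀ d n γ, (rot hp d)^[n] (t, i) = (t.smul γ, i) →
      φ γ = H (t, i) * (S * U ^ d.1) ^ n * (H (t, i))⁻¹ := by
    intro d n γ hγ
    rw [← hH, hγ]
    simp only [H, hφ]
    group
  have hK1 : ∀ n a, K ((rot hp 1)^[n] a).1 (((rot hp 1)^[n] a).2 + 1) = K a.1 (a.2 + 1) := by
    intro n a
    induction n generalizing a with
    | zero => rfl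
    | succ n ih =>
      rw [Function.iterate_succ_apply, ih, rot, add_assoc]
      exact h1 a.1 a.2
  have hK2 : ∀ n a, K ((rot hp 2)^[n] a).1 (((rot hp 2)^[n] a).2 + 2) = K a.1 (a.2 + 2) := by
    intro n a
    induction n generalizing a with
    | zero => rfl
    | succ n ih =>
      rw [Function.iterate_succ_apply, ih, rot, add_assoc]
      exact h2 a.1 a.2
  -- Turning by `1` keeps the vertex `i + 1`, and turning by `2` keeps the vertex `i + 2`; the
  -- latter gives `S * U ^ 2 = S * U⁻¹`.
  obtain ⟨n, hn, a, ha⟩ := exists_iterate_rot hp 1 t i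
  obtain ⟨m, hm, b, hb⟩ := exists_iterate_rot hp 2 t i
  refine ⟨a, b, ?_, ?_, fun hab => ?_⟩
  · simpa only [ha] using hK1 n (t, i)
  · simpa only [hb] using hK2 m (t, i)
  · let ψ : Deck p →* Γ := (MulAut.conj (H (t, i))⁻¹).toMonoidHom.comp φ
    have hψa : ψ a = (S * U) ^ n := by
      change (H (t, i))⁻¹ * φ a * ((H (t, i))⁻¹)⁻¹ = _
      rw [hφH 1 n a ha, Fin.val_one, pow_one]
      group
    have hψb : ψ b = (S * U⁻¹) ^ m := by
      have hU2 : U ^ 2 = U⁻¹ := by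
        rw [eq_comm, inv_eq_iff_mul_eq_one, ← pow_succ']
        exact hU
      change (H (t, i))⁻¹ * φ b * ((H (t, i))⁻¹)⁻¹ = _
      rw [hφH 2 m b hb, Fin.val_two, hU2]
      group
    refine hcomm n m hn hm ?_
    have h3 := hab.map ψ
    simpa only [map_mul, map_inv, map_pow, map_commutatorElement, hψa, hψb] using h3

end Tri

end Lifts

section Cusps

open IdealSimplex

variable {Sbar : Type u} [TopologicalSpace Sbar] {V : Set Sbar} {E : Type w} [TopologicalSpace E]
  {p : E → ↥(Vᶜ)} {lam : IdealTriangulation V}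

/-! ### Vertices and punctures -/

namespace IdealTriangulation

/-- The vertices of a face. -/
def vertex (lam : IdealTriangulation V) (f : lam.Face) (k : Fin 3) : V :=
  ⟨lam.param f ⟨Pi.single k 1, single_mem_stdSimplex ℝ k⟩,
    (lam.param_mem_iff f _).2 ⟨k, Pi.single_eq_same k 1⟩⟩

theorem tendsto_faceMap (lam : IdealTriangulation V) (f : lam.Face) (k : Fin 3) :
    Tendsto (lam.faceMap f) (nhdsVertex k) (𝓝 (lam.vertex f k : Sbar)) := by
  refine (lam.continuous_param f).continuousAt.tendsto.comp ?_
  rw [tendsto_subtype_rng]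
  exact tendsto_nhdsVertex k

theorem eq_single_of_apply_eq_one {x : Fin 3 → ℝ} (hx : x ∈ stdSimplex ℝ (Fin 3)) {k : Fin 3}
    (h : x k = 1) : x = Pi.single k 1 := by
  have h1 := hx.2
  rw [← Finset.add_sum_erase _ _ (Finset.mem_univ k), h] at h1
  have h2 : ∀ j ∈ Finset.univ.erase k, x j = 0 :=
    (Finset.sum_eq_zero_iff_of_nonneg fun j _ => hx.1 j).1 (by linarith)
  funext j
  rcases eq_or_ne j k with rfl | hj
  · rw [h, Pi.single_eq_same]
  · rw [h2 j (Finset.mem_erase.2 ⟨hj, Finset.mem_univ j⟩), Pi.single_eq_of_ne hj]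

/-- In a face, the points near a puncture are the points near the vertices of this face that are
mapped to the puncture. -/
theorem mem_comap_faceMap [T2Space Sbar] (lam : IdealTriangulation V) (f : lam.Face) (v : V)
    {s : Set IdealSimplex} (hs : ∀ k, lam.vertex f k = v → s ∈ nhdsVertex k) :
    s ∈ comap (lam.faceMap f) (𝓝 (v : Sbar)) := by
  have h1 : ∀ k, ∃ ε > 0, lam.vertex f k = v → ∀ x : IdealSimplex, 1 - ε < x.1 k → x ∈ s := by
    intro k
    by_cases h : lam.vertex f k = v
    · obtain ⟨ε, hε, h2⟩ := exists_mem_nhdsVertex (hs k h)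
      exact ⟨ε, hε, fun _ => h2⟩
    · exact ⟨1, one_pos, fun h' => absurd h' h⟩
  choose ε hε h2 using h1
  let K : Set (stdSimplex ℝ (Fin 3)) := {x | ∀ k, lam.vertex f k = v → x.1 k ≤ 1 - ε k}
  have hK : IsClosed K := by
    simp only [K, Set.ofPred_forall]
    exact isClosed_iInter fun k => isClosed_iInter fun _ =>
      isClosed_le ((continuous_apply k).comp continuous_subtype_val) continuous_const
  have hK2 : IsClosed (lam.param f '' K) := (hK.isCompact.image (lam.continuous_param f)).isClosed
  refine mem_comap.2 ⟨(lam.param f '' K)ᶜ, hK2.isOpen_compl.mem_nhds ?_, ?_⟩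
  · rintro ⟨x, hx, hxv⟩
    obtain ⟨k, hk⟩ := (lam.param_mem_iff f x).1 (hxv ▸ v.2)
    have h3 : lam.vertex f k = v := by
      apply Subtype.ext
      rw [← hxv]
      exact congrArg (lam.param f) (Subtype.ext (eq_single_of_apply_eq_one x.2 hk).symm)
    have h4 := hx k h3
    have h5 : x.1 k = 1 := hk
    linarith [hε k]
  · intro x hx
    by_contra hxs
    refine hx ⟨x.toSimplex, fun k hk => ?_, rfl⟩
    by_contra h6
    exact hxs (h2 k hk x (not_le.1 h6))

/-- A corner of a face that is contained in the disc around the vertex. -/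
theorem exists_corner (A : PunctureDiscs V) (lam : IdealTriangulation V) (f : lam.Face)
    (k : Fin 3) : ∃ ε > 0, ∀ x : IdealSimplex, 1 - ε < x.1 k →
      lam.faceMap f x ∈ A.disc (lam.vertex f k) :=
  exists_mem_nhdsVertex (lam.tendsto_faceMap f k ((A.isOpen_disc _).mem_nhds (A.mem_disc _)))

/-- A corner of a face that is contained in the disc around the vertex. -/
def corner (A : PunctureDiscs V) (lam : IdealTriangulation V) (f : lam.Face) (k : Fin 3) :
    Set IdealSimplex := {x | 1 - (exists_corner A lam f k).choose < x.1 k}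

theorem corner_mem (A : PunctureDiscs V) (lam : IdealTriangulation V) (f : lam.Face) (k : Fin 3) :
    lam.corner A f k ∈ nhdsVertex k := lt_mem_nhdsVertex (exists_corner A lam f k).choose_spec.1

theorem faceMap_mem_disc (A : PunctureDiscs V) (lam : IdealTriangulation V) (f : lam.Face)
    (k : Fin 3) {x : IdealSimplex} (hx : x ∈ lam.corner A f k) :
    lam.faceMap f x ∈ A.disc (lam.vertex f k) := (exists_corner A lam f k).choose_spec.2 x hx

theorem isPreconnected_corner (A : PunctureDiscs V) (lam : IdealTriangulation V) (f : lam.Face)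
    (k : Fin 3) : IsPreconnected (lam.corner A f k) :=
  isPreconnected_of_convex (s := {x | _ < x k})
    (convex_halfSpace_gt (LinearMap.proj (R := ℝ) (φ := fun _ : Fin 3 => ℝ) k).isLinear _)

theorem nonempty_corner (A : PunctureDiscs V) (lam : IdealTriangulation V) (f : lam.Face)
    (k : Fin 3) : (lam.corner A f k).Nonempty := by
  obtain ⟨x, hx, -⟩ := exists_side_mem_nhdsVertex k (k + 1) (by revert k; decide)
    (lam.corner_mem A f k)
  exact ⟨x, hx⟩

end IdealTriangulation

/-! ### The components of the preimage of the annuli -/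

theorem annulusComponent_eq_of_mem {A : PunctureDiscs V} {v v' : V} {a b e : E}
    (h : e ∈ annulusComponent A p v a) (h' : e ∈ annulusComponent A p v' b) :
    annulusComponent A p v a = annulusComponent A p v' b := by
  have h1 : e ∈ liftAnnulus A p v := connectedComponentIn_subset _ _ h
  have h2 : e ∈ liftAnnulus A p v' := connectedComponentIn_subset _ _ h'
  obtain rfl : v = v' := by
    by_contra hv
    exact Set.disjoint_left.1 (A.disjoint_disc v v' hv) h1 h2
  exact (connectedComponentIn_eq h).trans (connectedComponentIn_eq h').symm

theorem image_annulusComponent (A : PunctureDiscs V) {v : V} (γ : Deck p) {e : E}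
    (he : e ∈ liftAnnulus A p v) :
    γ.1 '' annulusComponent A p v e = annulusComponent A p v (γ.1 e) := by
  have hpre : γ.1 '' liftAnnulus A p v = liftAnnulus A p v := by
    ext x
    constructor
    · rintro ⟨y, hy, rfl⟩
      have h1 : p (γ.1 y) = p y := γ.2 y
      simpa only [liftAnnulus, Set.mem_ofPred_eq, h1] using hy
    · intro hx
      refine ⟨γ.1.symm x, ?_, γ.1.apply_symm_apply x⟩
      have h1 : p (γ.1.symm x) = p x := (γ⁻¹).2 x
      simpa only [liftAnnulus, Set.mem_ofPred_eq, h1] using hx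
  have h1 := γ.1.image_connectedComponentIn he
  rwa [hpre] at h1

theorem conj_setStabilizer (γ : Deck p) (C : Set E) :
    conj γ (setStabilizer p C) = setStabilizer p (γ.1 '' C) := by
  have hle : ∀ (γ : Deck p) (C : Set E),
      conj γ (setStabilizer p C) ≤ setStabilizer p (γ.1 '' C) := by
    rintro γ C _ ⟨q, hq, rfl⟩
    change (fun x => γ.1 (q.1 (γ.1.symm x))) '' (γ.1 '' C) = γ.1 '' C
    rw [Set.image_image]
    simp only [Homeomorph.symm_apply_apply]
    rw [← Set.image_image (fun x => γ.1 x) (fun x => q.1 x)]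
    exact congrArg _ hq
  refine le_antisymm (hle γ C) fun g hg => ?_
  have h1 := hle γ⁻¹ (γ.1 '' C) ⟨g, hg, rfl⟩
  have h2 : (γ⁻¹).1 '' (γ.1 '' C) = C := by
    change γ.1.symm '' _ = _
    rw [Set.image_image]
    simp
  rw [h2] at h1
  refine ⟨_, h1, ?_⟩
  change γ * (γ⁻¹ * g * (γ⁻¹)⁻¹) * γ⁻¹ = g
  group

namespace Tri

/-- The component of the preimage of the annuli at a vertex of a triangle. -/
def cusp (A : PunctureDiscs V) (t : Tri p lam) (k : Fin 3) : Set E :=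
  annulusComponent A p (lam.vertex t.face k) (t.map (lam.nonempty_corner A t.face k).choose)

theorem map_mem_liftAnnulus (A : PunctureDiscs V) (t : Tri p lam) {k : Fin 3} {x : IdealSimplex}
    (hx : x ∈ lam.corner A t.face k) : t.map x ∈ liftAnnulus A p (lam.vertex t.face k) := by
  rw [liftAnnulus, Set.mem_ofPred_eq, t.lift]
  exact lam.faceMap_mem_disc A t.face k hx

theorem map_mem_cusp (A : PunctureDiscs V) (t : Tri p lam) {k : Fin 3} {x : IdealSimplex}
    (hx : x ∈ lam.corner A t.face k) : t.map x ∈ t.cusp A k := by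
  have h1 : IsPreconnected (t.map '' lam.corner A t.face k) :=
    (lam.isPreconnected_corner A t.face k).image _ t.map.continuous.continuousOn
  refine h1.subset_connectedComponentIn
    (Set.mem_image_of_mem _ (lam.nonempty_corner A t.face k).choose_spec) ?_
    (Set.mem_image_of_mem _ hx)
  rintro _ ⟨y, hy, rfl⟩
  exact t.map_mem_liftAnnulus A hy

/-- Points of the common side near its end lie in corners of both triangles, so the two components
meet and coincide. -/
theorem cusp_eq_of_tendsto_flip (hp : IsCoveringMap p) (A : PunctureDiscs V) (t : Tri p lam)
    (i k l : Fin 3) (hik : i ≠ k)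
    (h : Tendsto (flip i (t.idx i)) (nhdsVertex k) (nhdsVertex l)) :
    (t.nbr hp i).cusp A l = t.cusp A k := by
  obtain ⟨x, ⟨hx1, hx2⟩, hx⟩ := exists_side_mem_nhdsVertex k i hik
    (inter_mem (lam.corner_mem A t.face k) (h (lam.corner_mem A (t.nbr hp i).face l)))
  have h1 := (t.nbr hp i).map_mem_cusp A hx2
  rw [nbr_map hp t hx] at h1
  exact annulusComponent_eq_of_mem h1 (t.map_mem_cusp A hx1)

theorem cusp_nbr_two (hp : IsCoveringMap p) (A : PunctureDiscs V) (t : Tri p lam) (i : Fin 3) :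
    (t.nbr hp i).cusp A (t.idx i + 2) = t.cusp A (i + 1) := by
  refine cusp_eq_of_tendsto_flip hp A t i _ _ (by clear * -; revert i; decide) (tendsto_comap_iff.2 ?_)
  simp only [Function.comp_def, flip_two]
  exact tendsto_comap

theorem cusp_nbr_one (hp : IsCoveringMap p) (A : PunctureDiscs V) (t : Tri p lam) (i : Fin 3) :
    (t.nbr hp i).cusp A (t.idx i + 1) = t.cusp A (i + 2) := by
  refine cusp_eq_of_tendsto_flip hp A t i _ _ (by clear * -; revert i; decide) (tendsto_comap_iff.2 ?_)
  simp only [Function.comp_def, flip_one]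
  exact tendsto_comap

theorem cusp_smul (A : PunctureDiscs V) (γ : Deck p) (t : Tri p lam) (k : Fin 3) :
    (t.smul γ).cusp A k = γ.1 '' t.cusp A k :=
  (image_annulusComponent A γ
    (t.map_mem_liftAnnulus A (lam.nonempty_corner A t.face k).choose_spec)).symm

theorem isPeripheral_cusp (A : PunctureDiscs V) (t : Tri p lam) (k : Fin 3) :
    IsPeripheral A p (setStabilizer p (t.cusp A k)) :=
  ⟨_, _, t.map_mem_liftAnnulus A (lam.nonempty_corner A t.face k).choose_spec, rfl⟩

end Tri

/-! ### The points at infinity assigned to the vertices of the triangles -/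

section EnhancedHom

variable {A : PunctureDiscs V} (ρ : EnhancedHom A p)

namespace EnhancedHom

/-- The point at infinity assigned to a vertex of a triangle. -/
def vert (t : Tri p lam) (k : Fin 3) : Boundary := ρ.pt ⟨_, t.isPeripheral_cusp A k⟩

theorem pt_eq {C D : Set E} (hC : IsPeripheral A p (setStabilizer p C))
    (hD : IsPeripheral A p (setStabilizer p D)) (h : C = D) : ρ.pt ⟨_, hC⟩ = ρ.pt ⟨_, hD⟩ := by
  subst h
  rfl

theorem vert_nbr_two (hp : IsCoveringMap p) (t : Tri p lam) (i : Fin 3) :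
    ρ.vert (t.nbr hp i) (t.idx i + 2) = ρ.vert t (i + 1) := ρ.pt_eq _ _ (t.cusp_nbr_two hp A i)

theorem vert_nbr_one (hp : IsCoveringMap p) (t : Tri p lam) (i : Fin 3) :
    ρ.vert (t.nbr hp i) (t.idx i + 1) = ρ.vert t (i + 2) := ρ.pt_eq _ _ (t.cusp_nbr_one hp A i)

theorem boundaryMaps_vert (γ : Deck p) (t : Tri p lam) (k : Fin 3) :
    BoundaryMaps (ρ.hom γ).1 (ρ.vert t k) (ρ.vert (t.smul γ) k) := by
  have h := ρ.equivariant γ ⟨_, t.isPeripheral_cusp A k⟩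
  have h1 : ρ.pt ⟨_, (t.isPeripheral_cusp A k).conj γ⟩ = ρ.vert (t.smul γ) k := by
    refine congrArg ρ.pt (Subtype.ext ?_)
    simp only [conj_setStabilizer, Tri.cusp_smul]
  rw [← h1]
  exact h

theorem boundaryMaps_vert_self {γ : Deck p} {t : Tri p lam} {k : Fin 3}
    (h : (t.smul γ).cusp A k = t.cusp A k) :
    BoundaryMaps (ρ.hom γ).1 (ρ.vert t k) (ρ.vert t k) := by
  refine ρ.fixed ⟨_, t.isPeripheral_cusp A k⟩ γ ?_
  rw [Tri.cusp_smul] at h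
  exact h

/-- When the homomorphism is injective, the points assigned to the vertices of a triangle are
distinct. -/
theorem injective_vert [T2Space Sbar] [SimplyConnectedSpace E] [LocallyPathConnectedSpace E]
    (hp : IsCoveringMap p) (hinj : Function.Injective ρ.hom) (t : Tri p lam) :
    Function.Injective (ρ.vert t) := by
  have key : ∀ i, ρ.vert t (i + 1) ≠ ρ.vert t (i + 2) := by
    intro i h
    obtain ⟨a, b, ha, hb, hab⟩ := Tri.exists_rotations hp t i (K := Tri.cusp A)
      (Tri.cusp_nbr_two hp A) (Tri.cusp_nbr_one hp A)
    -- Injectivity moves the forbidden relation to `IsomPlus`. There `h` says that the images of `a`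
    -- and `b`, which fix the points at the two ends of the side, fix one common point.
    refine hab (hinj ?_)
    have h1 := ρ.boundaryMaps_vert_self hb
    rw [← h] at h1
    have h2 := (commute_of_boundaryMaps (ρ.boundaryMaps_vert_self ha) h1).eq
    simpa only [map_mul, map_inv, map_pow, map_commutatorElement] using h2
  have hfin : ∀ k l : Fin 3, k ≠ l → ∃ i, (k = i + 1 ∧ l = i + 2) ∨ (k = i + 2 ∧ l = i + 1) := by
    decide
  intro k l h
  by_contra hkl
  obtain ⟨i, ⟨rfl, rfl⟩ | ⟨rfl, rfl⟩⟩ := hfin k l hkl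
  · exact key i h
  · exact key i h.symm

end EnhancedHom

end EnhancedHom

end Cusps

/-! ### The components of the lifted edges and of their complement -/

theorem IdealSimplex.dense_interior : Dense {x : IdealSimplex | ∀ k, x.1 k ≠ 0} := by
  intro x
  let δ : ℕ → ℝ := fun n => 1 / ((n : ℝ) + 1)
  have hδ0 : ∀ n, 0 < δ n := fun n => by positivity
  have hδ1 : ∀ n, δ n ≤ 1 := fun n => by
    rw [div_le_one (by positivity)]
    linarith [n.cast_nonneg (α := ℝ)]
  have hδ : Tendsto δ atTop (𝓝 0) := tendsto_one_div_add_atTop_nhds_zero_nat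
  have hc : ∀ k, 0 < center.1 k := by
    intro k
    simp only [center, mk']
    split_ifs <;> norm_num
  refine mem_closure_of_tendsto (f := fun n => (⟨(1 - δ n) • x.1 + δ n • center.1,
    convex_carrier x.2 center.2 (by linarith [hδ1 n]) (hδ0 n).le (by ring)⟩ : IdealSimplex))
    (b := atTop) ?_ (Eventually.of_forall fun n k => ?_)
  · rw [tendsto_subtype_rng]
    have h1 : Tendsto (fun n => (1 - δ n) • x.1 + δ n • center.1) atTop
        (𝓝 ((1 - (0 : ℝ)) • x.1 + (0 : ℝ) • center.1)) :=
      ((tendsto_const_nhds.sub hδ).smul tendsto_const_nhds).add (hδ.smul tendsto_const_nhds)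
    simpa using h1
  · have h1 : 0 ≤ (1 - δ n) * x.1 k := mul_nonneg (by linarith [hδ1 n]) (x.nonneg k)
    have h2 := mul_pos (hδ0 n) (hc k)
    change (1 - δ n) * x.1 k + δ n * center.1 k ≠ 0
    exact (add_pos_of_nonneg_of_pos h1 h2).ne'

/-- A section `r` of `m` over the image is continuous, because its composite with the embedding `f ∘
m` is the restriction of `f`. That restriction is then a composite of embeddings. -/
theorem isEmbedding_domRestrict_image {X Y Z : Type*} [TopologicalSpace X] [TopologicalSpace Y]
    [TopologicalSpace Z] {m : X → Y} {f : Y → Z} (hm : Continuous m) (hf : Continuous f)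
    (h : IsEmbedding fun x => f (m x)) (s : Set X) : IsEmbedding ((m '' s).domRestrict f) := by
  choose r hr using fun c : m '' s => (Set.image_subset_range m s c.2 : ∃ x, m x = c)
  have h1 : (fun x => f (m x)) ∘ r = (m '' s).domRestrict f := by
    ext1 c
    exact congrArg f (hr c)
  have hr' : Continuous r := by
    rw [h.continuous_iff, h1]
    exact hf.comp continuous_subtype_val
  rw [← h1]
  refine h.comp (IsEmbedding.of_comp hr' hm ?_)
  have h2 : m ∘ r = Subtype.val := funext hr
  rw [h2]
  exact IsEmbedding.subtypeVal

section Lifts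

open IdealSimplex

variable {Sbar : Type u} [TopologicalSpace Sbar] {V : Set Sbar} {E : Type w} [TopologicalSpace E]
  {p : E → ↥(Vᶜ)} {lam : IdealTriangulation V}

namespace Tri

theorem map_mem_edges_iff (t : Tri p lam) (x : IdealSimplex) :
    t.map x ∈ p ⁻¹' lam.edges ↔ ∃ i, x.1 i = 0 := by
  constructor
  · rintro ⟨f, y, i, hy, h⟩
    rw [t.lift] at h
    rcases (lam.param_eq_iff _ _ _ _ (lam.faceMap_notMem t.face x)).1 h.symm with
      ⟨-, h1⟩ | ⟨j, -, -, hj, -⟩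
    · exact ⟨i, by rw [← hy, ← h1]; rfl⟩
    · exact ⟨j, hj⟩
  · rintro ⟨i, hi⟩
    exact ⟨t.face, x.toSimplex, i, hi, (t.lift x).symm⟩

theorem eq_of_apply_eq_zero {x : IdealSimplex} {i j : Fin 3} (hi : x.1 i = 0) (hj : x.1 j = 0) :
    i = j := LocalSol.eq_of_mem_sideNhd (LocalSol.mem_sideNhd_of_apply_eq_zero hj) hi

/-- Any union of open lifted triangles is open in `E`. The open triangle of `t` and the union of all
the others thus separate the complement of the edges, and each open triangle is connected. -/
theorem connectedComponentIn_compl_edges [T2Space Sbar] (hp : IsCoveringMap p) (t : Tri p lam)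
    {x : IdealSimplex} (hx : ∀ k, x.1 k ≠ 0) :
    connectedComponentIn (p ⁻¹' lam.edges)ᶜ (t.map x) = t.map '' {y | ∀ k, y.1 k ≠ 0} := by
  have hO : IsOpen {y : IdealSimplex | ∀ k, y.1 k ≠ 0} := by
    simp only [Set.ofPred_forall]
    exact isOpen_iInter_of_finite fun k => isOpen_ne_fun (continuous_apply' k) continuous_const
  have hxm : t.map x ∈ (p ⁻¹' lam.edges)ᶜ := by
    rw [Set.mem_compl_iff, map_mem_edges_iff]
    exact fun ⟨i, hi⟩ => hx i hi
  have hpre : ∀ (P : Tri p lam → Prop) (s : Tri p lam) (y : IdealSimplex),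
      (∃ q : Tri p lam, P q ∧ ∃ z : IdealSimplex, (∀ k, z.1 k ≠ 0) ∧ q.map z = s.map y) ↔
        P s ∧ ∀ k, y.1 k ≠ 0 := by
    intro P s y
    constructor
    · rintro ⟨q, hq, z, hz, h⟩
      rcases (map_eq_iff hp _ _ _ _).1 h with ⟨rfl, rfl⟩ | ⟨i, hi, -⟩
      · exact ⟨hq, hz⟩
      · exact absurd hi (hz i)
    · rintro ⟨h1, h2⟩
      exact ⟨s, h1, y, h2, rfl⟩
  have hopen : ∀ P : Tri p lam → Prop, IsOpen
      {e : E | ∃ q : Tri p lam, P q ∧ ∃ z : IdealSimplex, (∀ k, z.1 k ≠ 0) ∧ q.map z = e} := by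
    intro P
    rw [isOpen_iff hp lam]
    intro s
    have : s.map ⁻¹' {e : E | ∃ q : Tri p lam, P q ∧
        ∃ z : IdealSimplex, (∀ k, z.1 k ≠ 0) ∧ q.map z = e} =
          {y | P s ∧ ∀ k, y.1 k ≠ 0} := Set.ext fun y => hpre P s y
    rw [this]
    exact isOpen_const.inter hO
  refine Set.Subset.antisymm ?_ ?_
  · have h1 := isPreconnected_connectedComponentIn (F := (p ⁻¹' lam.edges)ᶜ) (x := t.map x)
    refine (h1.subset_left_of_subset_union (hopen (· = t)) (hopen (· ≠ t)) ?_ ?_ ?_).trans ?_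
    · rw [Set.disjoint_left]
      rintro _ ⟨q, hq, z, hz, rfl⟩ h
      exact ((hpre (· ≠ t) q z).1 h).1 hq
    · intro e he
      obtain ⟨s, y, rfl⟩ := exists_map_eq hp lam e
      have h2 := connectedComponentIn_subset _ _ he
      rw [Set.mem_compl_iff, map_mem_edges_iff] at h2
      push Not at h2
      by_cases hs : s = t
      · exact Or.inl ⟨s, hs, y, h2, rfl⟩
      · exact Or.inr ⟨s, hs, y, h2, rfl⟩
    · exact ⟨t.map x, mem_connectedComponentIn hxm, t, rfl, x, hx, rfl⟩
    · rintro _ ⟨q, rfl, z, hz, rfl⟩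
      exact ⟨z, hz, rfl⟩
  · have hconv : IsPreconnected {y : IdealSimplex | ∀ k, y.1 k ≠ 0} := by
      have : {y : IdealSimplex | ∀ k, y.1 k ≠ 0} = {y : IdealSimplex | y.1 ∈ {z | ∀ k, 0 < z k}} := by
        ext y
        exact forall_congr' fun k => ⟨fun h => lt_of_le_of_ne (y.nonneg k) (Ne.symm h), fun h => h.ne'⟩
      rw [this]
      refine isPreconnected_of_convex ?_
      simp only [Set.ofPred_forall]
      exact convex_iInter fun k =>
        convex_halfSpace_gt (LinearMap.proj (R := ℝ) (φ := fun _ : Fin 3 => ℝ) k).isLinear 0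
    refine (hconv.image _ t.map.continuous.continuousOn).subset_connectedComponentIn
      (Set.mem_image_of_mem _ hx) ?_
    rintro _ ⟨y, hy, rfl⟩
    rw [Set.mem_compl_iff, map_mem_edges_iff]
    exact fun ⟨i, hi⟩ => hy i hi

theorem isClosed_range_map [T2Space Sbar] (hp : IsCoveringMap p) (t : Tri p lam) :
    IsClosed (Set.range t.map) := by
  rw [isClosed_iff hp lam]
  intro s
  have : s.map ⁻¹' Set.range t.map =
      {y | s = t} ∪ ⋃ i, {y | y.1 i = 0 ∧ t = s.nbr hp i} := by
    ext y
    simp only [Set.mem_preimage, Set.mem_range, Set.mem_union, Set.mem_iUnion, Set.mem_ofPred_eq]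
    constructor
    · rintro ⟨x, hx⟩
      rcases (map_eq_iff hp _ _ _ _).1 hx.symm with ⟨h, -⟩ | ⟨i, hi, h, -⟩
      · exact Or.inl h
      · exact Or.inr ⟨i, hi, h⟩
    · rintro (rfl | ⟨i, hi, rfl⟩)
      · exact ⟨y, rfl⟩
      · exact ⟨_, nbr_map hp s hi⟩
  rw [this]
  exact isClosed_const.union (isClosed_iUnion_of_finite fun i =>
    (isClosed_eq (continuous_apply' i) continuous_const).inter isClosed_const)

theorem closure_connectedComponentIn [T2Space Sbar] (hp : IsCoveringMap p) (t : Tri p lam)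
    {x : IdealSimplex} (hx : ∀ k, x.1 k ≠ 0) :
    closure (connectedComponentIn (p ⁻¹' lam.edges)ᶜ (t.map x)) = Set.range t.map := by
  rw [connectedComponentIn_compl_edges hp t hx]
  refine Set.Subset.antisymm
    (closure_minimal (Set.image_subset_range _ _) (isClosed_range_map hp t)) ?_
  rintro _ ⟨y, rfl⟩
  exact image_closure_subset_closure_image t.map.continuous
    (Set.mem_image_of_mem _ (dense_interior y))

/-- The edges form a locally finite family in the triangle coordinates, so any union of them is
closed; one edge and the union of the others separate the preimage into two closed parts. -/
theorem connectedComponentIn_edges [T2Space Sbar] (hp : IsCoveringMap p) (t : Tri p lam)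
    {x : IdealSimplex} {i : Fin 3} (hx : x.1 i = 0) :
    connectedComponentIn (p ⁻¹' lam.edges) (t.map x) = t.map '' {y | y.1 i = 0} := by
  -- The two descriptions of the same edge, one from each adjacent triangle; stability of `Z` and of
  -- its complement under adjacency makes `sides` well behaved.
  let Z : Set (Tri p lam × Fin 3) := {(t, i), (t.nbr hp i, t.idx i)}
  have hZ : ∀ s j, (s, j) ∈ Z → (s.nbr hp j, s.idx j) ∈ Z := by
    rintro s j (h | h)
    · obtain ⟨rfl, rfl⟩ := Prod.mk.inj h
      exact Or.inr rfl
    · obtain ⟨rfl, rfl⟩ := Prod.mk.inj h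
      rw [nbr_nbr, idx_nbr]
      exact Or.inl rfl
  have hZ' : ∀ s j, (s, j) ∈ Zᶜ → (s.nbr hp j, s.idx j) ∈ Zᶜ := by
    intro s j h h'
    have := hZ _ _ h'
    rw [nbr_nbr, idx_nbr] at this
    exact h this
  let sides : Set (Tri p lam × Fin 3) → Set E := fun W =>
    {e | ∃ s j, (s, j) ∈ W ∧ ∃ y : IdealSimplex, y.1 j = 0 ∧ s.map y = e}
  have hpre : ∀ W : Set (Tri p lam × Fin 3), (∀ s j, (s, j) ∈ W → (s.nbr hp j, s.idx j) ∈ W) →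
      ∀ (s : Tri p lam) y, s.map y ∈ sides W ↔ ∃ j, (s, j) ∈ W ∧ y.1 j = 0 := by
    intro W hW s y
    constructor
    · rintro ⟨q, j, hq, z, hz, h⟩
      rcases (map_eq_iff hp _ _ _ _).1 h with ⟨rfl, rfl⟩ | ⟨l, hl, rfl, rfl⟩
      · exact ⟨j, hq, hz⟩
      · obtain rfl := eq_of_apply_eq_zero hz hl
        exact ⟨_, hW _ _ hq, by rw [flip_self, hz]⟩
    · rintro ⟨j, h1, h2⟩
      exact ⟨s, j, h1, y, h2, rfl⟩
  have hclosed : ∀ W : Set (Tri p lam × Fin 3),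
      (∀ s j, (s, j) ∈ W → (s.nbr hp j, s.idx j) ∈ W) → IsClosed (sides W) := by
    intro W hW
    rw [isClosed_iff hp lam]
    intro s
    have : s.map ⁻¹' sides W = ⋃ j, {y | (s, j) ∈ W ∧ y.1 j = 0} := by
      ext y
      rw [Set.mem_preimage, hpre W hW, Set.mem_iUnion]
      rfl
    rw [this]
    exact isClosed_iUnion_of_finite fun j =>
      isClosed_const.inter (isClosed_eq (continuous_apply' j) continuous_const)
  have hsub : sides Z ⊆ t.map '' {y | y.1 i = 0} := by
    rintro _ ⟨s, j, h | h, y, hy, rfl⟩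
    · obtain ⟨rfl, rfl⟩ := Prod.mk.inj h
      exact ⟨y, hy, rfl⟩
    · obtain ⟨rfl, rfl⟩ := Prod.mk.inj h
      have h1 := nbr_map hp (t.nbr hp i) hy
      rw [nbr_nbr, idx_nbr] at h1
      exact ⟨_, by rw [Set.mem_ofPred_eq, flip_self, hy], h1⟩
  have hxm : t.map x ∈ p ⁻¹' lam.edges := (map_mem_edges_iff t x).2 ⟨i, hx⟩
  refine Set.Subset.antisymm ?_ ?_
  · refine Set.Subset.trans ?_ hsub
    intro e he
    by_contra hne
    have hcov : connectedComponentIn (p ⁻¹' lam.edges) (t.map x) ⊆ sides Z ∪ sides Zᶜ := by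
      intro e' he'
      obtain ⟨s, y, rfl⟩ := exists_map_eq hp lam e'
      obtain ⟨j, hj⟩ := (map_mem_edges_iff s y).1 (connectedComponentIn_subset _ _ he')
      by_cases hs : (s, j) ∈ Z
      · exact Or.inl ⟨s, j, hs, y, hj, rfl⟩
      · exact Or.inr ⟨s, j, hs, y, hj, rfl⟩
    obtain ⟨e', -, ⟨s, j, hs, y, hy, rfl⟩, h2⟩ := isPreconnected_closed_iff.1
      (isPreconnected_connectedComponentIn (F := p ⁻¹' lam.edges) (x := t.map x)) _ _
      (hclosed Z hZ) (hclosed Zᶜ hZ') hcov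
      ⟨_, mem_connectedComponentIn hxm, t, i, Or.inl rfl, x, hx, rfl⟩
      ⟨e, he, (hcov he).resolve_left hne⟩
    obtain ⟨l, hl, hyl⟩ := (hpre _ hZ' s y).1 h2
    obtain rfl := eq_of_apply_eq_zero hy hyl
    exact hl hs
  · refine ((isPreconnected_side i).image _ t.map.continuous.continuousOn).subset_connectedComponentIn
      (Set.mem_image_of_mem _ hx) ?_
    rintro _ ⟨y, hy, rfl⟩
    exact (map_mem_edges_iff t y).2 ⟨i, hy⟩

end Tri

end Lifts

/-! ### The pleated surface -/

section Pleated

open IdealSimplex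

variable {Sbar : Type u} [TopologicalSpace Sbar] {V : Set Sbar} {E : Type w} [TopologicalSpace E]
  {p : E → ↥(Vᶜ)} {lam : IdealTriangulation V} {A : PunctureDiscs V} (ρ : EnhancedHom A p)

namespace EnhancedHom

/-- The shears that have to be applied to the standard parametrization of the ideal triangles in
order to make them agree along the sides. -/
def shearAt (hp : IsCoveringMap p) (t : Tri p lam) (i : Fin 3) : ℝ :=
  shearRatio (ρ.vert t) (ρ.vert (t.nbr hp i)) i (t.idx i)

theorem shearAt_pos (hp : IsCoveringMap p)
    (hρ : ∀ t : Tri p lam, Function.Injective (ρ.vert t)) (t : Tri p lam) (i : Fin 3) : 0 < ρ.shearAt hp t i :=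
  shearRatio_pos (hρ _) (hρ _) _ _

theorem shearAt_smul (hp : IsCoveringMap p) (γ : Deck p) (t : Tri p lam) :
    ρ.shearAt hp (t.smul γ) = ρ.shearAt hp t := by
  funext i
  refine (shearRatio_map (g := ρ.hom γ) (ρ.vert_nbr_two hp t i).symm (ρ.vert_nbr_one hp t i).symm
    (ρ.vert_nbr_two hp (t.smul γ) i).symm (ρ.vert_nbr_one hp (t.smul γ) i).symm
    (ρ.boundaryMaps_vert γ t) fun k => ?_).symm
  rw [Tri.smul_nbr]
  exact ρ.boundaryMaps_vert γ (t.nbr hp i) k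

/-- The restriction of the pleated surface to a triangle. -/
def pleat (hp : IsCoveringMap p)
    (hρ : ∀ t : Tri p lam, Function.Injective (ρ.vert t)) (t : Tri p lam) (x : IdealSimplex) : H3 :=
  idealPoint (hρ t) (shears (ρ.shearAt_pos hp hρ t) x)

/-- On the side `i` only the shear along that side acts, so the matching condition of
`idealPoint_eq_of_side` becomes the identity `shearRatio_mul`. -/
theorem pleat_flip (hp : IsCoveringMap p)
    (hρ : ∀ t : Tri p lam, Function.Injective (ρ.vert t)) (t : Tri p lam) {i : Fin 3} {x : IdealSimplex} (hx : x.1 i = 0) :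
    ρ.pleat hp hρ (t.nbr hp i) (flip i (t.idx i) x) = ρ.pleat hp hρ t x := by
  have hy : (flip i (t.idx i) x).1 (t.idx i) = 0 := by rw [flip_self, hx]
  refine (idealPoint_eq_of_side (hρ t) (hρ (t.nbr hp i)) (ρ.vert_nbr_two hp t i).symm
    (ρ.vert_nbr_one hp t i).symm ((shears_eq_zero_iff _ _ _).2 hx)
    ((shears_eq_zero_iff _ _ _).2 hy) ?_).symm
  rw [shears_of_side _ _ hx, shears_of_side _ _ hy]
  have h1 := shearFun_ratio (i := i) (ρ.shearAt_pos hp hρ t i) x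
  have h2 := shearFun_ratio (i := t.idx i) (ρ.shearAt_pos hp hρ (t.nbr hp i) (t.idx i))
    (flip i (t.idx i) x)
  rw [flip_one, flip_two] at h2
  have h3 := shearRatio_mul (hρ t) (hρ (t.nbr hp i)) i (t.idx i)
  have h6 : shearRatio (ρ.vert (t.nbr hp i)) (ρ.vert t) (t.idx i) i =
      ρ.shearAt hp (t.nbr hp i) (t.idx i) := by
    rw [shearAt, Tri.nbr_nbr, Tri.idx_nbr]
  rw [h6, ← shearAt] at h3
  have h4 : x.1 (i + 1) ≠ 0 := by
    intro h
    exact x.2.2 (i + 2) (by linarith [x.sum_eq i])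
  have h5 : x.1 (i + 2) ≠ 0 := by
    intro h
    exact x.2.2 (i + 1) (by linarith [x.sum_eq i])
  generalize shearFun i (ρ.shearAt_pos hp hρ t i) x = X at *
  generalize shearFun (t.idx i) (ρ.shearAt_pos hp hρ (t.nbr hp i) (t.idx i))
    (flip i (t.idx i) x) = Y at *
  -- Both end coordinates are nonzero on a side without its vertices; multiplying by them allows the
  -- ratio identities to be combined without division.
  refine mul_left_cancel₀ (mul_ne_zero h4 h5) ?_
  generalize ρ.shearAt hp t i = τ at *
  generalize ρ.shearAt hp (t.nbr hp i) (t.idx i) = σ at *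
  generalize idealWeight (ρ.vert t) (i + 1) = a at *
  generalize idealWeight (ρ.vert t) (i + 2) = b at *
  generalize idealWeight (ρ.vert (t.nbr hp i)) (t.idx i + 1) = c at *
  generalize idealWeight (ρ.vert (t.nbr hp i)) (t.idx i + 2) = d at *
  linear_combination (a * c * Y.1 (t.idx i + 1) * x.1 (i + 1)) * h1 +
    (a * c * τ * x.1 (i + 1) * X.1 (i + 2)) * h2 +
    (x.1 (i + 1) * x.1 (i + 2) * X.1 (i + 2) * Y.1 (t.idx i + 2)) * h3

/-- The pleated surface associated to an enhanced homomorphism. -/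
def pleatedMap (hp : IsCoveringMap p)
    (hρ : ∀ t : Tri p lam, Function.Injective (ρ.vert t)) (e : E) : H3 :=
  ρ.pleat hp hρ (Tri.exists_map_eq hp lam e).choose
    (Tri.exists_map_eq hp lam e).choose_spec.choose

theorem pleatedMap_map (hp : IsCoveringMap p)
    (hρ : ∀ t : Tri p lam, Function.Injective (ρ.vert t)) (t : Tri p lam) (x : IdealSimplex) :
    ρ.pleatedMap hp hρ (t.map x) = ρ.pleat hp hρ t x := by
  have h := (Tri.exists_map_eq hp lam (t.map x)).choose_spec.choose_spec
  rcases (Tri.map_eq_iff hp _ _ _ _).1 h.symm with ⟨h1, h2⟩ | ⟨i, hi, h1, h2⟩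
  · rw [pleatedMap, ← h2, ← h1]
  · rw [pleatedMap, h2, h1, pleat_flip _ _ _ _ hi]

theorem isEmbedding_pleat (hp : IsCoveringMap p)
    (hρ : ∀ t : Tri p lam, Function.Injective (ρ.vert t)) (t : Tri p lam) : IsEmbedding (ρ.pleat hp hρ t) :=
  (isEmbedding_idealPoint (hρ t)).comp (shears _).isEmbedding

theorem tendsto_pleat (hp : IsCoveringMap p)
    (hρ : ∀ t : Tri p lam, Function.Injective (ρ.vert t)) (t : Tri p lam) (k : Fin 3) :
    TendstoBoundary (ρ.pleat hp hρ t) (nhdsVertex k) (ρ.vert t k) :=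
  Tendsto.comp (g := fun y => klein (idealPoint (hρ t) y)) (tendsto_idealPoint (hρ t) k)
    (tendsto_shears _ k)

theorem pleat_smul (hp : IsCoveringMap p)
    (hρ : ∀ t : Tri p lam, Function.Injective (ρ.vert t)) (γ : Deck p) (t : Tri p lam) (x : IdealSimplex) :
    ρ.pleat hp hρ (t.smul γ) x = (ρ.hom γ).1 (ρ.pleat hp hρ t x) := by
  rw [pleat, pleat, apply_idealPoint (hρ t) (hρ (t.smul γ)) (ρ.boundaryMaps_vert γ t)]
  simp only [shearAt_smul]

theorem continuous_pleatedMap (hp : IsCoveringMap p)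
    (hρ : ∀ t : Tri p lam, Function.Injective (ρ.vert t)) [T2Space Sbar] : Continuous (ρ.pleatedMap hp hρ) := by
  rw [Tri.continuous_iff hp lam]
  intro t
  simp only [pleatedMap_map]
  exact (ρ.isEmbedding_pleat hp hρ t).continuous

theorem isEmbedding_pleatedMap (hp : IsCoveringMap p)
    (hρ : ∀ t : Tri p lam, Function.Injective (ρ.vert t)) [T2Space Sbar] (t : Tri p lam) (s : Set IdealSimplex) :
    IsEmbedding ((t.map '' s).domRestrict (ρ.pleatedMap hp hρ)) := by
  refine isEmbedding_domRestrict_image t.map.continuous (ρ.continuous_pleatedMap hp hρ) ?_ s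
  simp only [pleatedMap_map]
  exact ρ.isEmbedding_pleat hp hρ t

theorem isPleatedSurface_pleatedMap (hp : IsCoveringMap p)
    (hρ : ∀ t : Tri p lam, Function.Injective (ρ.vert t)) [T2Space Sbar] :
    IsPleatedSurface p lam (ρ.pleatedMap hp hρ) ρ.hom where
  continuous := ρ.continuous_pleatedMap hp hρ
  edge e he := by
    obtain ⟨t, x, rfl⟩ := Tri.exists_map_eq hp lam e
    obtain ⟨i, hi⟩ := (t.map_mem_edges_iff x).1 he
    rw [Tri.connectedComponentIn_edges hp t hi]
    refine ⟨ρ.isEmbedding_pleatedMap hp hρ t _, ρ.vert t (i + 1), ρ.vert t (i + 2),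
      (hρ t).ne (by clear * -; revert i; decide), ?_⟩
    rw [← idealPoint_image_side (hρ t) i, Set.image_image]
    simp only [pleatedMap_map, pleat]
    rw [← Set.image_image (idealPoint (hρ t)) (shears (ρ.shearAt_pos hp hρ t))]
    congr 1
    ext y
    constructor
    · rintro ⟨z, hz, rfl⟩
      exact (shears_eq_zero_iff _ _ _).2 hz
    · intro hy
      obtain ⟨z, rfl⟩ := (shears (ρ.shearAt_pos hp hρ t)).surjective y
      exact ⟨z, (shears_eq_zero_iff _ _ _).1 hy, rfl⟩
  face e he := by
    obtain ⟨t, x, rfl⟩ := Tri.exists_map_eq hp lam e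
    rw [Tri.map_mem_edges_iff] at he
    push Not at he
    rw [Tri.closure_connectedComponentIn hp t he, ← Set.image_univ]
    refine ⟨ρ.isEmbedding_pleatedMap hp hρ t _, ρ.vert t, hρ t, ?_⟩
    rw [← range_idealPoint (hρ t), Set.image_image, Set.image_univ]
    simp only [pleatedMap_map, pleat]
    exact (shears (ρ.shearAt_pos hp hρ t)).surjective.range_comp (idealPoint (hρ t))
  equivariant γ e := by
    obtain ⟨t, x, rfl⟩ := Tri.exists_map_eq hp lam e
    rw [← Tri.smul_map, pleatedMap_map, pleatedMap_map, pleat_smul]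

/-- By `mem_comap_faceMap`, near a puncture a face reduces to its corners there. A corner whose cusp
is the given component converges to the assigned point; any other corner lies in a different, hence
disjoint, component and imposes nothing. -/
theorem isAssociated_pleatedMap (hp : IsCoveringMap p)
    (hρ : ∀ t : Tri p lam, Function.Injective (ρ.vert t)) [T2Space Sbar] : IsAssociated ρ lam (ρ.pleatedMap hp hρ) := by
  intro e he v e' he'
  obtain ⟨t, x, rfl⟩ := Tri.exists_map_eq hp lam e
  rw [Tri.map_mem_edges_iff] at he
  push Not at he
  rw [Tri.closure_connectedComponentIn hp t he]
  intro N hN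
  obtain ⟨W, hW, hWN⟩ := mem_comap.1 (lam.mem_comap_faceMap t.face v
    (s := {y | t.map y ∈ annulusComponent A p v e' → klein (ρ.pleat hp hρ t y) ∈ N}) (by
      intro k _
      by_cases hk : t.cusp A k = annulusComponent A p v e'
      · have hv := ρ.pt_eq (t.isPeripheral_cusp A k) ⟨v, e', he', rfl⟩ hk
        have hN' : N ∈ 𝓝 (ρ.vert t k : E3) := by
          rw [vert, hv]
          exact hN
        filter_upwards [ρ.tendsto_pleat hp hρ t k hN'] with y hy _
        exact hy
      · filter_upwards [lam.corner_mem A t.face k] with y hy hy'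
        exact absurd (annulusComponent_eq_of_mem (t.map_mem_cusp A hy) hy') hk))
  rw [mem_map, mem_inf_principal]
  refine mem_comap.2 ⟨W, hW, ?_⟩
  rintro a ha ⟨⟨y, rfl⟩, hy⟩
  rw [Set.mem_preimage, t.lift] at ha
  rw [Set.mem_preimage, pleatedMap_map]
  exact hWN ha hy

end EnhancedHom

end Pleated

end PleatedSurfaces

end

/-- Let `S = Sbar ∖ V` be a closed connected surface with finitely many (at least one) points
removed, and let `p : E → S` be its universal covering. Every enhanced homomorphism from the
fundamental group of `S` to the group of orientation-preserving isometries of hyperbolic 3-space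
whose underlying homomorphism is injective realizes every ideal triangulation of `S`. -/
theorem mainTheorem11 {Sbar : Type*} [TopologicalSpace Sbar] [T2Space Sbar]
    [CompactSpace Sbar] [ConnectedSpace Sbar] [ChartedSpace (EuclideanSpace ℝ (Fin 2)) Sbar]
    (V : Set Sbar) (hfin : V.Finite) (hne : V.Nonempty)
    {E : Type*} [TopologicalSpace E] [SimplyConnectedSpace E]
    (p : E → ↥(Vᶜ)) (hp : IsCoveringMap p)
    (A : PleatedSurfaces.PunctureDiscs V)
    (ρ : PleatedSurfaces.EnhancedHom A p) (hinj : Function.Injective ρ.hom) :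
    ρ.PeripherallyGeneric := by
  intro lam
  have : LocallyPathConnectedSpace Sbar :=
    ChartedSpace.locallyPathConnectedSpace (EuclideanSpace ℝ (Fin 2)) Sbar
  have : LocallyPathConnectedSpace ↥(Vᶜ) := hfin.isClosed.isOpen_compl.locallyPathConnectedSpace
  have : LocallyPathConnectedSpace E :=
    PleatedSurfaces.locallyPathConnectedSpace_of_isLocalHomeomorph hp.isLocalHomeomorph
  have hρ : ∀ t : PleatedSurfaces.Tri p lam, Function.Injective (ρ.vert t) :=
    ρ.injective_vert hp hinj
  exact ⟨ρ.pleatedMap hp hρ, ρ.isPleatedSurface_pleatedMap hp hρ, ρ.isAssociated_pleatedMap hp hρ⟩
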